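/- Let $0<q<1$ and $\nu>-1$ be real. Put $(a;b)_n=\prod_{k=0}^{n-1}(1-ab^k)$, $(a;b)_\infty=\prod_{k\ge 0}(1-ab^k)$, $$j_\nu(x,q^2)=\sum_{n\ge 0}(-1)^n\frac{q^{n(n+1)}}{(q^{2\nu+2};q^2)_n\,(q^2;q^2)_n}x^{2n},\qquad \int_0^\infty f(z)\,d_qz=(1-q)\sum_{n\in\mathbb Z}q^nf(q^n),\qquad c_{q,\nu}=\frac{1}{1-q}\,\frac{(q^{2\nu+2};q^2)_\infty}{(q^2;q^2)_\infty},$$ and, for $n,r\in\mathbb Z$ and $t\ge 0$, $$p_{nr}(t)=(1-q)\,q^{2(\nu+1)n}\,c_{q,\nu}^2\int_0^\infty e^{-tz^2}\,j_\nu(q^nz,q^2)\,j_\nu(q^rz,q^2)\,z^{2\nu+1}\,d_qz .$$ Call a family of functions $\tilde p_{nr}:[0,\infty)\to\mathbb R$ $(n,r\in\mathbb Z)$ a *transition function of the bilateral birth and death process* on $\{q^n:n\in\mathbb Z\}$ with birth rates $\lambda_n=q^{2\nu-2n}$ and death rates $\mu_n=q^{-2n}$ (where $\tilde p_{nr}(t)$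 is the probability of being at $q^n$ at time $t$ when starting from $q^r$ at time $0$) if for all $n,r\in\mathbb Z$ and $s,t\ge 0$ (a) $\tilde p_{nr}(t)\ge 0$; (b) $\sum_{n\in\mathbb Z}\tilde p_{nr}(t)=1$; (c) $\tilde p_{nr}(0)=\delta_{nr}$; (d) $\tilde p_{nr}(t+s)=\sum_{k\in\mathbb Z}\tilde p_{nk}(t)\,\tilde p_{kr}(s)$; and if, as $h\downarrow 0$, for every $i\in\mathbb Z$, $$\tilde p_{i+1,i}(h)=\lambda_ih+o(h),\qquad \tilde p_{i-1,i}(h)=\mu_ih+o(h),\qquad \tilde p_{i,i}(h)=1-(\lambda_i+\mu_i)h+o(h),\qquad \tilde p_{j,i}(h)=o(h)\ \text{ if } |i-j|>1 .$$ Then the family $(p_{nr})$ is such a transition function, and it is the only one if and only if $\nu\ge 0$. -/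

import Mathlib

open scoped Topology Asymptotics

noncomputable section

namespace QBirthDeath

/-- The infinite `q`-shifted factorial `(a; b)_∞ = ∏_{k ≥ 0} (1 - a b^k)`. -/
def qFactInf (a b : ℝ) : ℝ := ∏' k : ℕ, (1 - a * b ^ k)

/-- The finite `q`-shifted factorial `(a; b)_n = ∏_{k < n} (1 - a b^k)`. -/
def qFact (a b : ℝ) (n : ℕ) : ℝ := ∏ k ∈ Finset.range n, (1 - a * b ^ k)

/-- The normalized `q`-Bessel function `j_ν(x, q²)`. -/
def qBessel (q ν x : ℝ) : ℝ :=
  ∑' n : ℕ, (-1 : ℝ) ^ n * q ^ (n * (n + 1)) /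
    (qFact (q ^ (2 * ν + 2)) (q ^ 2) n * qFact (q ^ 2) (q ^ 2) n) * x ^ (2 * n)

/-- The Jackson integral `∫₀^∞ f(t) d_q t = (1 - q) ∑_{n ∈ ℤ} q^n f(q^n)`. -/
def jacksonIntegral (q : ℝ) (f : ℝ → ℝ) : ℝ :=
  (1 - q) * ∑' n : ℤ, q ^ n * f (q ^ n)

/-- The constant `c_{q,ν} = (q^{2ν+2}; q²)_∞ / ((1 - q) (q²; q²)_∞)`. -/
def besselConst (q ν : ℝ) : ℝ :=
  1 / (1 - q) * (qFactInf (q ^ (2 * ν + 2)) (q ^ 2) / qFactInf (q ^ 2) (q ^ 2))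

/-- `P_y(x, t) = c² ∫₀^∞ e^{-t z²} j_ν(x z, q²) j_ν(y z, q²) z^{2ν+1} d_q z`. -/
def heatKernel (q ν y x t : ℝ) : ℝ :=
  besselConst q ν ^ 2 * jacksonIntegral q (fun z =>
    Real.exp (-t * z ^ 2) * qBessel q ν (x * z) * qBessel q ν (y * z) * z ^ (2 * ν + 1))

/-- `p_{nr}(t) = (1 - q) q^{2(ν+1)n} P_{q^r}(q^n, t)`: the candidate for the probability
to be at `q^n` at time `t` when starting from `q^r`. -/
def qTransition (q ν : ℝ) (n r : ℤ) (t : ℝ) : ℝ :=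
  (1 - q) * q ^ (2 * (ν + 1) * n) * heatKernel q ν (q ^ r) (q ^ n) t

/-- Birth rate `λ_i = q^{2ν-2i}`, the rate of the jump from `q^i` to `q^{i+1}`. -/
def birthRate (q ν : ℝ) (i : ℤ) : ℝ := q ^ (2 * ν - 2 * i)

/-- Death rate `μ_i = q^{-2i}`, the rate of the jump from `q^i` to `q^{i-1}`. -/
def deathRate (q : ℝ) (i : ℤ) : ℝ := q ^ (-2 * i)

/-- `p n r t`, for `t ≥ 0`, is the stationary transition probability from `q^r` to `q^n` in
time `t` of a bilateral birth and death process with rates `birthRate`, `deathRate`. The first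
index is the arrival state, the second the starting state. -/
structure IsTransitionFunction (q ν : ℝ) (p : ℤ → ℤ → ℝ → ℝ) : Prop where
  nonneg : ∀ n r t, 0 ≤ t → 0 ≤ p n r t
  hasSum_one : ∀ r t, 0 ≤ t → HasSum (fun n => p n r t) 1
  initial : ∀ n r, p n r 0 = if n = r then 1 else 0
  chapman_kolmogorov : ∀ n r t s, 0 ≤ t → 0 ≤ s →
    HasSum (fun k => p n k t * p k r s) (p n r (t + s))
  birth : ∀ i, (fun h => p (i + 1) i h - birthRate q ν i * h) =o[𝓝[>] 0] (fun h => h)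
  death : ∀ i, (fun h => p (i - 1) i h - deathRate q i * h) =o[𝓝[>] 0] (fun h => h)
  stay : ∀ i, (fun h => p i i h - (1 - (birthRate q ν i + deathRate q i) * h))
    =o[𝓝[>] 0] (fun h => h)
  far : ∀ i j, 1 < |i - j| → (fun h => p j i h) =o[𝓝[>] 0] (fun h => h)

end QBirthDeath

end

open scoped Topology Asymptotics

noncomputable section

namespace QBirthDeath

open Filter Finset MeasureTheory

/-! ### Euler's two series for `(x; p)_∞` and its reciprocal -/

section Euler

variable {p : ℝ}

/-! Put `w = q^{ν+1}` and `u m = C w^m j_ν(q^m, q²)` with `C` the normalizing constant `orthoConst`.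
The second order `q`-difference equation of the Bessel function (`latticeBessel_recurrence`) says
that, for every `k`, the function `i ↦ w^{-i} u(i+k)` of the starting state is an eigenfunction of
the generator with eigenvalue `-q^{2k}`. The translates of `u` are orthonormal in `ℓ²(ℤ)`
(`hasSum_orthoBessel_mul`), and the matrix `u(n+k)` is symmetric, so the same relation gives
orthonormality of its rows and of its columns. The candidate is therefore the semigroup in spectral
form, `p_{nr}(t) = w^{n-r} ∑_k e^{-t q^{2k}} u(n+k) u(r+k)`. Its initial value is orthonormality,
Chapman-Kolmogorov is Parseval's identity, and the rates are the Taylor expansion of the exponential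
at `t = 0`.

Two properties need more. Positivity: the multiplier `1/(1+θ q^{2k})` gives a solution of the
resolvent equation with nonnegative source and no flux at `+∞`, so a minimum principle applies
(`nonneg_of_resolvent`); exponentials are limits of powers of resolvents. Total mass one: the loss
of mass would carry the factor `∑_m w^{2m} j_ν(q^m, q²)`, which vanishes (`hasSum_sq_weight_mul`).

For `ν ≥ 0` uniqueness is a parabolic maximum principle for the backward equation. The function
`|i|` is proper and its image under the generator is bounded above, which controls the noncompact
state space (`generator_abs_le`, `le_of_nonneg`).

For `-1 < ν < 0` the process can reach `i = +∞` in finite time. The transform by the harmonic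
function `q^{2νi}` of the process with parameter `-ν`, run at speed `q^{2ν}`, has the required rates
but loses mass; the lost mass has an explicit density, that of the explosion time
(`isExitSystem_killed`). Restarting at a fixed state `c` after each explosion gives, through a
renewal equation, a genuine transition function with the same rates. If `c = 0` and `c = 1` gave the
same one, the explosion density would vanish near time `0`, hence everywhere, whereas the mass of
the killed process tends to `0` (`IsExitSystem.not_unique`, `exitDensity_ne_zero`). -/

theorem qFact_succ (a b : ℝ) (n : ℕ) : qFact a b (n + 1) = qFact a b n * (1 - a * b ^ n) := by
  simp [qFact, prod_range_succ]

theorem qFact_zero (a b : ℝ) : qFact a b 0 = 1 := by simp [qFact]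

theorem one_sub_mul_pow_pos (hp0 : 0 < p) (hp1 : p < 1) {a : ℝ} (ha0 : 0 < a) (ha1 : a < 1)
    (n : ℕ) : 0 < 1 - a * p ^ n := by
  have h1 : p ^ n ≤ 1 := pow_le_one₀ hp0.le hp1.le
  have h2 : a * p ^ n ≤ a * 1 := mul_le_mul_of_nonneg_left h1 ha0.le
  linarith

theorem qFact_pos (hp0 : 0 < p) (hp1 : p < 1) {a : ℝ} (ha0 : 0 < a) (ha1 : a < 1) (n : ℕ) :
    0 < qFact a p n :=
  prod_pos fun k _ => one_sub_mul_pow_pos hp0 hp1 ha0 ha1 k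

theorem multipliable_one_sub_mul_pow (hp0 : 0 < p) (hp1 : p < 1) (x : ℝ) :
    Multipliable fun k : ℕ => 1 - x * p ^ k := by
  have h : Summable fun k : ℕ => -(x * p ^ k) :=
    ((summable_geometric_of_lt_one hp0.le hp1).mul_left x).neg
  simpa [sub_eq_add_neg] using Real.multipliable_one_add_of_summable h

theorem tendsto_qFact (hp0 : 0 < p) (hp1 : p < 1) (x : ℝ) :
    Tendsto (fun n => qFact x p n) atTop (𝓝 (qFactInf x p)) :=
  (multipliable_one_sub_mul_pow hp0 hp1 x).hasProd.tendsto_prod_nat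

theorem qFactInf_pos (hp0 : 0 < p) (hp1 : p < 1) {a : ℝ} (ha0 : 0 < a) (ha1 : a < 1) :
    0 < qFactInf a p := by
  have hs : Summable fun k : ℕ => -(a * p ^ k) :=
    ((summable_geometric_of_lt_one hp0.le hp1).mul_left a).neg
  have h0 : 0 ≤ qFactInf a p :=
    ge_of_tendsto' (tendsto_qFact hp0 hp1 a) fun n => (qFact_pos hp0 hp1 ha0 ha1 n).le
  refine lt_of_le_of_ne h0 (Ne.symm ?_)
  have := tprod_one_add_ne_zero_of_summable (f := fun k : ℕ => -(a * p ^ k))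
    (fun k => by
      have := one_sub_mul_pow_pos hp0 hp1 ha0 ha1 k
      rw [← sub_eq_add_neg]; exact this.ne') hs.norm
  simpa [qFactInf, sub_eq_add_neg] using this

theorem qFactInf_le_qFact (hp0 : 0 < p) (hp1 : p < 1) {a : ℝ} (ha0 : 0 < a) (ha1 : a < 1)
    (n : ℕ) : qFactInf a p ≤ qFact a p n := by
  have hanti : Antitone fun n => qFact a p n := antitone_nat_of_succ_le fun k => by
    rw [qFact_succ]
    have h1 := qFact_pos hp0 hp1 ha0 ha1 k
    have h2 : 0 ≤ a * p ^ k := by positivity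
    nlinarith
  exact hanti.le_of_tendsto (tendsto_qFact hp0 hp1 a) n

/-- Taylor coefficients of the infinite product `(x; p)_∞`. -/
def eulerCoeff (p : ℝ) (n : ℕ) : ℝ := (-1) ^ n * p ^ (n.choose 2) / qFact p p n

theorem eulerCoeff_zero : eulerCoeff p 0 = 1 := by simp [eulerCoeff, qFact_zero]

theorem eulerCoeff_succ (hp0 : 0 < p) (hp1 : p < 1) (n : ℕ) :
    eulerCoeff p (n + 1) * (1 - p ^ (n + 1)) = -(p ^ n * eulerCoeff p n) := by
  have h1 := (qFact_pos hp0 hp1 hp0 hp1 n).ne'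
  have h2 := (one_sub_mul_pow_pos hp0 hp1 hp0 hp1 n).ne'
  have h3 : 1 - p ^ (n + 1) = 1 - p * p ^ n := by ring
  rw [eulerCoeff, eulerCoeff, qFact_succ, h3, Nat.choose_succ_succ', Nat.choose_one_right]
  field_simp
  ring

theorem eulerCoeff_ne_zero (hp0 : 0 < p) (hp1 : p < 1) (n : ℕ) : eulerCoeff p n ≠ 0 := by
  have h1 := (qFact_pos hp0 hp1 hp0 hp1 n).ne'
  unfold eulerCoeff
  positivity

theorem summable_eulerCoeff (hp0 : 0 < p) (hp1 : p < 1) (x : ℝ) :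
    Summable fun n => eulerCoeff p n * x ^ n := by
  rcases eq_or_ne x 0 with rfl | hx
  · refine summable_of_ne_finset_zero (s := {0}) fun n hn => ?_
    rw [zero_pow (by simpa using hn), mul_zero]
  have hpn : Tendsto (fun n : ℕ => p ^ n) atTop (𝓝 0) :=
    tendsto_pow_atTop_nhds_zero_of_lt_one hp0.le hp1
  refine summable_of_ratio_test_tendsto_lt_one (l := 0) one_pos
    (Eventually.of_forall fun n => mul_ne_zero (eulerCoeff_ne_zero hp0 hp1 n) (pow_ne_zero n hx)) ?_
  have key : ∀ n : ℕ, ‖eulerCoeff p (n + 1) * x ^ (n + 1)‖ / ‖eulerCoeff p n * x ^ n‖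
      = p ^ n * |x| / (1 - p * p ^ n) := fun n => by
    have h2 := one_sub_mul_pow_pos hp0 hp1 hp0 hp1 n
    have h3 : 1 - p ^ (n + 1) = 1 - p * p ^ n := by ring
    have h0 := eulerCoeff_ne_zero hp0 hp1 n
    have h := eulerCoeff_succ hp0 hp1 n
    rw [h3, ← eq_div_iff h2.ne'] at h
    rw [h, Real.norm_eq_abs, Real.norm_eq_abs, abs_mul, abs_mul, abs_div, abs_neg, abs_mul,
      abs_of_pos h2, abs_of_pos (pow_pos hp0 n), pow_succ, abs_mul]
    have hx' : |x ^ n| ≠ 0 := by positivity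
    have h0' : |eulerCoeff p n| ≠ 0 := by positivity
    field_simp
  simp_rw [key]
  have : Tendsto (fun n : ℕ => p ^ n * |x| / (1 - p * p ^ n)) atTop
      (𝓝 (0 * |x| / (1 - p * 0))) :=
    (hpn.mul_const _).div (tendsto_const_nhds.sub (hpn.const_mul p)) (by simp)
  simpa using this

theorem summable_abs_eulerCoeff (hp0 : 0 < p) (hp1 : p < 1) {x : ℝ} (hx : 0 ≤ x) :
    Summable fun n => |eulerCoeff p n| * x ^ n := by
  have := (summable_eulerCoeff hp0 hp1 x).abs
  simpa only [abs_mul, abs_pow, abs_of_nonneg hx] using this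

/-- Euler's series for `(x; p)_∞`. -/
def eulerSum (p x : ℝ) : ℝ := ∑' n, eulerCoeff p n * x ^ n

theorem eulerSum_eq (hp0 : 0 < p) (hp1 : p < 1) (x : ℝ) :
    eulerSum p x = (1 - x) * eulerSum p (p * x) := by
  have hs := summable_eulerCoeff hp0 hp1 x
  have hs' := summable_eulerCoeff hp0 hp1 (p * x)
  have h1 : eulerSum p x - eulerSum p (p * x)
      = ∑' n, (eulerCoeff p n * x ^ n - eulerCoeff p n * (p * x) ^ n) := (hs.tsum_sub hs').symm
  rw [(hs.sub hs').tsum_eq_zero_add] at h1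
  have h2 : ∀ n : ℕ, eulerCoeff p (n + 1) * x ^ (n + 1) - eulerCoeff p (n + 1) * (p * x) ^ (n + 1)
      = -x * (eulerCoeff p n * (p * x) ^ n) := fun n => by
    have := eulerCoeff_succ hp0 hp1 n
    calc _ = eulerCoeff p (n + 1) * (1 - p ^ (n + 1)) * x ^ (n + 1) := by rw [mul_pow]; ring
      _ = _ := by rw [this, mul_pow]; ring
  simp_rw [h2, tsum_mul_left] at h1
  have : ∑' n, eulerCoeff p n * (p * x) ^ n = eulerSum p (p * x) := rfl
  rw [this] at h1
  simp only [pow_zero, mul_one, sub_self, zero_add] at h1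
  linarith

theorem tendsto_tsum_mul_pow_zero {c : ℕ → ℝ} {x : ℝ} (hc : Summable fun n => c n * x ^ n)
    (hp0 : 0 < p) (hp1 : p < 1) :
    Tendsto (fun k : ℕ => ∑' n, c n * (p ^ k * x) ^ n) atTop (𝓝 (c 0)) := by
  have hlim : ∑' n, (if n = 0 then c 0 else 0) = c 0 := tsum_ite_eq 0 _
  rw [← hlim]
  refine tendsto_tsum_of_dominated_convergence hc.abs (fun n => ?_)
    (Eventually.of_forall fun k n => ?_)
  · rcases n with _ | n
    · simp
    · have h : Tendsto (fun k : ℕ => p ^ k * x) atTop (𝓝 (0 * x)) :=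
        (tendsto_pow_atTop_nhds_zero_of_lt_one hp0.le hp1).mul_const x
      simpa using (h.pow (n + 1)).const_mul (c (n + 1))
  · have h1 : |p ^ k| ^ n ≤ 1 :=
      pow_le_one₀ (abs_nonneg _) (by rw [abs_of_pos (pow_pos hp0 k)]; exact pow_le_one₀ hp0.le hp1.le)
    rw [Real.norm_eq_abs, abs_mul, abs_mul, abs_pow, abs_mul, mul_pow, abs_pow x]
    have h2 : 0 ≤ |c n| * |x| ^ n := by positivity
    nlinarith

theorem eulerSum_eq_qFact_mul (hp0 : 0 < p) (hp1 : p < 1) (x : ℝ) (n : ℕ) :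
    eulerSum p x = qFact x p n * eulerSum p (p ^ n * x) := by
  induction n with
  | zero => simp [qFact_zero]
  | succ n ih =>
    rw [ih, eulerSum_eq hp0 hp1 (p ^ n * x), qFact_succ, pow_succ']
    ring_nf

/-- Iterating `E(x) = (1 - x) E(px)` splits off the factors of the product one by one, and the
remaining `E(p^n x)` tends to `E(0) = 1`. -/
theorem eulerSum_eq_qFactInf (hp0 : 0 < p) (hp1 : p < 1) (x : ℝ) :
    eulerSum p x = qFactInf x p := by
  have h1 := (tendsto_qFact hp0 hp1 x).mul
    (tendsto_tsum_mul_pow_zero (summable_eulerCoeff hp0 hp1 x) hp0 hp1)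
  rw [eulerCoeff_zero, mul_one] at h1
  refine tendsto_nhds_unique (tendsto_const_nhds.congr fun n => ?_) h1
  exact eulerSum_eq_qFact_mul hp0 hp1 x n

/-- Taylor coefficients `1 / (p; p)_j` of `1 / (x; p)_∞`, extended by zero to negative `j`. -/
def invCoeff (p : ℝ) (j : ℤ) : ℝ := if 0 ≤ j then 1 / qFact p p j.toNat else 0

theorem invCoeff_natCast (n : ℕ) : invCoeff p n = 1 / qFact p p n := by simp [invCoeff]

theorem invCoeff_nonneg (hp0 : 0 < p) (hp1 : p < 1) (j : ℤ) : 0 ≤ invCoeff p j := by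
  unfold invCoeff
  split_ifs
  · exact (one_div_pos.2 (qFact_pos hp0 hp1 hp0 hp1 _)).le
  · exact le_rfl

theorem invCoeff_le (hp0 : 0 < p) (hp1 : p < 1) (j : ℤ) :
    invCoeff p j ≤ 1 / qFactInf p p := by
  have h := qFactInf_pos hp0 hp1 hp0 hp1
  unfold invCoeff
  split_ifs
  · exact one_div_le_one_div_of_le h (qFactInf_le_qFact hp0 hp1 hp0 hp1 _)
  · positivity

theorem summable_invCoeff (hp0 : 0 < p) (hp1 : p < 1) {x : ℝ} (hx0 : 0 ≤ x) (hx1 : x < 1) :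
    Summable fun n : ℕ => invCoeff p n * x ^ n := by
  refine Summable.of_nonneg_of_le
    (fun n => mul_nonneg (invCoeff_nonneg hp0 hp1 _) (pow_nonneg hx0 n))
    (fun n => mul_le_mul_of_nonneg_right (invCoeff_le hp0 hp1 n) (pow_nonneg hx0 n))
    ((summable_geometric_of_lt_one hx0 hx1).mul_left _)

theorem invSum_eq (hp0 : 0 < p) (hp1 : p < 1) {x : ℝ} (hx0 : 0 ≤ x) (hx1 : x < 1) :
    ∑' n : ℕ, invCoeff p n * (p * x) ^ n = (1 - x) * ∑' n : ℕ, invCoeff p n * x ^ n := by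
  have hs := summable_invCoeff hp0 hp1 hx0 hx1
  have hs' := summable_invCoeff hp0 hp1 (mul_nonneg hp0.le hx0)
    (mul_lt_one_of_nonneg_of_lt_one_left hp0.le hp1 hx1.le)
  have h1 := hs.tsum_sub hs'
  rw [(hs.sub hs').tsum_eq_zero_add] at h1
  have h2 : ∀ n : ℕ, invCoeff p ((n + 1 : ℕ) : ℤ) * x ^ (n + 1)
      - invCoeff p ((n + 1 : ℕ) : ℤ) * (p * x) ^ (n + 1) = x * (invCoeff p n * x ^ n) := fun n => by
    have h1 := (qFact_pos hp0 hp1 hp0 hp1 n).ne'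
    have h2 := (one_sub_mul_pow_pos hp0 hp1 hp0 hp1 n).ne'
    rw [invCoeff_natCast, invCoeff_natCast, qFact_succ, mul_pow]
    field_simp
    ring
  simp_rw [h2, tsum_mul_left] at h1
  simp only [pow_zero, mul_one, sub_self, zero_add] at h1
  linarith

/-- Passing from `x` to `px` divides one factor by `1 - x` and multiplies the other by it. The
product is thus constant along `p^k x`, with limit `1`. -/
theorem eulerSum_mul_invSum (hp0 : 0 < p) (hp1 : p < 1) {x : ℝ} (hx0 : 0 ≤ x) (hx1 : x < 1) :
    eulerSum p x * ∑' n : ℕ, invCoeff p n * x ^ n = 1 := by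
  have step : ∀ k : ℕ, eulerSum p x * ∑' n : ℕ, invCoeff p n * x ^ n
      = eulerSum p (p ^ k * x) * ∑' n : ℕ, invCoeff p n * (p ^ k * x) ^ n := fun k => by
    induction k with
    | zero => simp
    | succ k ih =>
      have hk0 : 0 ≤ p ^ k * x := by positivity
      have hk1 : p ^ k * x < 1 :=
        lt_of_le_of_lt (mul_le_of_le_one_left hx0 (pow_le_one₀ hp0.le hp1.le)) hx1
      rw [ih, pow_succ', mul_assoc p, invSum_eq hp0 hp1 hk0 hk1, eulerSum_eq hp0 hp1 (p ^ k * x)]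
      ring
  have h := (tendsto_tsum_mul_pow_zero (summable_eulerCoeff hp0 hp1 x) hp0 hp1).mul
    (tendsto_tsum_mul_pow_zero (summable_invCoeff hp0 hp1 hx0 hx1) hp0 hp1)
  have h0 : invCoeff p ((0 : ℕ) : ℤ) = 1 := by rw [invCoeff_natCast, qFact_zero, div_one]
  rw [eulerCoeff_zero, h0, mul_one] at h
  exact tendsto_nhds_unique (tendsto_const_nhds.congr step) h

end Euler

/-- For `j ≥ 0` the first `j` factors of `(p; p)_∞` are missing from `(p^{j+1}; p)_∞`; for `j < 0`
the product contains the factor `1 - p^0 = 0`. This is why the extension of `invCoeff` by zero is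
the right one. -/
theorem eulerSum_zpow {p : ℝ} (hp0 : 0 < p) (hp1 : p < 1) (j : ℤ) :
    eulerSum p (p ^ (j + 1)) = eulerSum p p * invCoeff p j := by
  rcases le_or_gt 0 j with hj | hj
  · lift j to ℕ using hj
    have h := eulerSum_eq_qFact_mul hp0 hp1 p j
    have hq := (qFact_pos hp0 hp1 hp0 hp1 j).ne'
    have h3 : p ^ ((j : ℤ) + 1) = p ^ j * p := by exact_mod_cast pow_succ p j
    rw [h3, invCoeff_natCast, h]
    field_simp
  · have h0 : ∀ n : ℕ, eulerSum p (p ^ (-(n : ℤ))) = 0 := fun n => by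
      induction n with
      | zero => rw [eulerSum_eq hp0 hp1]; simp
      | succ n ih =>
        have h3 : p * p ^ (-((n + 1 : ℕ) : ℤ)) = p ^ (-(n : ℤ)) := by
          rw [← zpow_one_add₀ hp0.ne']
          push_cast
          ring_nf
        rw [eulerSum_eq hp0 hp1, h3, ih, mul_zero]
    obtain ⟨n, hn⟩ : ∃ n : ℕ, j + 1 = -(n : ℤ) := ⟨(-(j + 1)).toNat, by omega⟩
    rw [hn, h0, invCoeff, if_neg (by omega), mul_zero]

/-! ### A transformation of the confluent basic hypergeometric series -/

section Hypergeometric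

variable {p a : ℝ}

theorem summable_qBessel_terms (hp0 : 0 < p) (hp1 : p < 1) (ha0 : 0 < a) (ha1 : a < 1) {z : ℝ}
    (hz : 0 ≤ z) : Summable fun n => eulerCoeff p n / qFact a p n * z ^ n := by
  refine Summable.of_norm_bounded
    ((summable_abs_eulerCoeff hp0 hp1 hz).mul_left (1 / qFactInf a p)) fun n => ?_
  have h1 := qFactInf_pos hp0 hp1 ha0 ha1
  have h2 := qFactInf_le_qFact hp0 hp1 ha0 ha1 n
  have h3 := one_div_le_one_div_of_le h1 h2
  rw [Real.norm_eq_abs, abs_mul, abs_div, abs_of_pos (qFact_pos hp0 hp1 ha0 ha1 n), abs_pow,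
    abs_of_nonneg hz, div_eq_mul_one_div, mul_comm |_| (1 / _), mul_assoc]
  exact mul_le_mul_of_nonneg_right h3 (by positivity)

/-- Both sides are the double series `∑ e_n e_l z^n a^l p^{nl}`, with `e` the Euler coefficients,
which is symmetric in `a` and `z`. Summing over `l` first gives `(p^n a; p)_∞ = (a; p)_∞ / (a;
p)_n`; summing over `n` first gives `(p^l z; p)_∞`. -/
theorem eulerSum_mul_hypergeometric (hp0 : 0 < p) (hp1 : p < 1) (ha0 : 0 < a) (ha1 : a < 1)
    {z : ℝ} (hz : 0 ≤ z) :
    HasSum (fun l => eulerCoeff p l * a ^ l * eulerSum p (p ^ l * z))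
      (eulerSum p a * ∑' n, eulerCoeff p n / qFact a p n * z ^ n) := by
  have hs : Summable (fun x : ℕ × ℕ =>
      (eulerCoeff p x.1 * z ^ x.1) * (eulerCoeff p x.2 * (p ^ x.1 * a) ^ x.2)) := by
    refine Summable.of_norm_bounded ((summable_abs_eulerCoeff hp0 hp1 hz).mul_of_nonneg
      (summable_abs_eulerCoeff hp0 hp1 ha0.le) (fun n => by positivity)
      (fun n => by positivity)) fun x => ?_
    have h1 : p ^ x.1 * a ≤ a := mul_le_of_le_one_left ha0.le (pow_le_one₀ hp0.le hp1.le)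
    have h0 : 0 ≤ p ^ x.1 * a := by positivity
    rw [Real.norm_eq_abs, abs_mul, abs_mul, abs_mul, abs_pow, abs_pow, abs_of_nonneg hz,
      abs_of_nonneg h0]
    gcongr
  have h1 : HasSum (fun x : ℕ × ℕ =>
      (eulerCoeff p x.1 * z ^ x.1) * (eulerCoeff p x.2 * (p ^ x.1 * a) ^ x.2))
      (eulerSum p a * ∑' n, eulerCoeff p n / qFact a p n * z ^ n) := by
    have h := hs.hasSum
    have h' := h.prod_fiberwise (g := fun n => eulerSum p a * (eulerCoeff p n / qFact a p n * z ^ n))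
      fun n => by
        have hq := (qFact_pos hp0 hp1 ha0 ha1 n).ne'
        have h4 := ((summable_eulerCoeff hp0 hp1 (p ^ n * a)).hasSum).mul_left
          (eulerCoeff p n * z ^ n)
        have e : eulerSum p a * (eulerCoeff p n / qFact a p n * z ^ n)
            = eulerCoeff p n * z ^ n * ∑' b, eulerCoeff p b * (p ^ n * a) ^ b := by
          rw [eulerSum_eq_qFact_mul hp0 hp1 a n]
          field_simp
          rw [eulerSum]
          ring
        rw [e]
        exact h4
    have h5 := h'.unique ((summable_qBessel_terms hp0 hp1 ha0 ha1 hz).hasSum.mul_left (eulerSum p a))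
    rwa [h5] at h
  have h2 := ((Equiv.prodComm ℕ ℕ).hasSum_iff).2 h1
  refine h2.prod_fiberwise fun l => ?_
  have h4 := ((summable_eulerCoeff hp0 hp1 (p ^ l * z)).hasSum).mul_left (eulerCoeff p l * a ^ l)
  refine h4.congr_fun ?_
  intro n
  simp only [Function.comp, Equiv.prodComm_apply, Prod.swap]
  rw [mul_pow, mul_pow, ← pow_mul, ← pow_mul, mul_comm l n]
  ring

end Hypergeometric

/-- The `q`-Bessel function on the lattice `q^ℤ`. -/
def latticeBessel (q ν : ℝ) (m : ℤ) : ℝ := qBessel q ν (q ^ m)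

/-- The normalization of the orthonormal functions. -/
def orthoConst (q ν : ℝ) : ℝ := qFactInf (q ^ (2 * ν + 2)) (q ^ 2) / qFactInf (q ^ 2) (q ^ 2)

/-! ### The `q`-Bessel function on the lattice: bounds, recurrence, asymptotics -/

section Lattice

variable {q ν : ℝ}

theorem rpow_mem (hq0 : 0 < q) (hq1 : q < 1) (hν : -1 < ν) :
    0 < q ^ (2 * ν + 2) ∧ q ^ (2 * ν + 2) < 1 :=
  ⟨Real.rpow_pos_of_pos hq0 _, Real.rpow_lt_one hq0.le hq1 (by linarith)⟩

theorem sq_mem (hq0 : 0 < q) (hq1 : q < 1) : 0 < q ^ 2 ∧ q ^ 2 < 1 :=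
  ⟨by positivity, pow_lt_one₀ hq0.le hq1 two_ne_zero⟩

theorem orthoConst_pos (hq0 : 0 < q) (hq1 : q < 1) (hν : -1 < ν) : 0 < orthoConst q ν := by
  obtain ⟨h1, h2⟩ := rpow_mem hq0 hq1 hν
  obtain ⟨h3, h4⟩ := sq_mem hq0 hq1
  exact div_pos (qFactInf_pos h3 h4 h1 h2) (qFactInf_pos h3 h4 h3 h4)

theorem hasSum_latticeBessel (hq0 : 0 < q) (hq1 : q < 1) (hν : -1 < ν) (m : ℤ) :
    HasSum (fun n => eulerCoeff (q ^ 2) n / qFact (q ^ (2 * ν + 2)) (q ^ 2) n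
      * ((q ^ 2) ^ (m + 1)) ^ n) (latticeBessel q ν m) := by
  obtain ⟨h1, h2⟩ := rpow_mem hq0 hq1 hν
  obtain ⟨h3, h4⟩ := sq_mem hq0 hq1
  convert (summable_qBessel_terms h3 h4 h1 h2 (z := (q ^ 2) ^ (m + 1)) (by positivity)).hasSum
    using 1
  unfold latticeBessel qBessel
  congr 1
  ext n
  have hn : n * (n + 1) = 2 * n.choose 2 + 2 * n := by
    have h := Nat.add_one_mul_choose_eq n 1
    simp only [Nat.choose_one_right, Nat.choose_succ_succ' n 1] at h
    rw [mul_comm n]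
    linarith
  have h5 : ((q ^ 2) ^ (m + 1)) ^ n = q ^ (2 * n) * (q ^ m) ^ (2 * n) := by
    rw [zpow_add_one₀ h3.ne', mul_pow, ← pow_mul, mul_comm]
    congr 1
    rw [pow_mul, ← zpow_natCast q 2, ← zpow_mul, ← zpow_natCast (q ^ m) 2, ← zpow_mul,
      mul_comm m]
  rw [h5, eulerCoeff, hn, pow_add, pow_mul]
  field_simp

/-- The transformation at `z = q^{2(m+1)}`. Unlike the alternating power series, this expansion is
usable as `m → -∞`: its coefficients `invCoeff` are bounded uniformly in `m`, and the terms with `m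
+ l < 0` vanish. -/
theorem hasSum_orthoConst_mul (hq0 : 0 < q) (hq1 : q < 1) (hν : -1 < ν) (m : ℤ) :
    HasSum (fun l : ℕ => eulerCoeff (q ^ 2) l * (q ^ (2 * ν + 2)) ^ l * invCoeff (q ^ 2) (m + l))
      (orthoConst q ν * latticeBessel q ν m) := by
  obtain ⟨h1, h2⟩ := rpow_mem hq0 hq1 hν
  obtain ⟨h3, h4⟩ := sq_mem hq0 hq1
  have h := eulerSum_mul_hypergeometric h3 h4 h1 h2 (z := (q ^ 2) ^ (m + 1)) (by positivity)
  rw [(hasSum_latticeBessel hq0 hq1 hν m).tsum_eq] at h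
  have h5 := h.div_const (eulerSum (q ^ 2) (q ^ 2))
  have h6 : eulerSum (q ^ 2) (q ^ 2) ≠ 0 := by
    rw [eulerSum_eq_qFactInf h3 h4]; exact (qFactInf_pos h3 h4 h3 h4).ne'
  have e : orthoConst q ν * latticeBessel q ν m
      = eulerSum (q ^ 2) (q ^ (2 * ν + 2)) * latticeBessel q ν m / eulerSum (q ^ 2) (q ^ 2) := by
    rw [eulerSum_eq_qFactInf h3 h4, eulerSum_eq_qFactInf h3 h4, orthoConst]
    ring
  rw [e]
  refine h5.congr_fun fun l => ?_
  have h7 : (q ^ 2) ^ l * (q ^ 2) ^ (m + 1) = (q ^ 2) ^ ((m + l) + 1) := by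
    rw [← zpow_natCast (q ^ 2) l, ← zpow_add₀ h3.ne']; ring_nf
  rw [h7, eulerSum_zpow h3 h4]
  field_simp

theorem abs_latticeBessel_le (hq0 : 0 < q) (hq1 : q < 1) (hν : -1 < ν) :
    ∃ M : ℝ, 0 < M ∧ ∀ m, |latticeBessel q ν m| ≤ M := by
  obtain ⟨h1, h2⟩ := rpow_mem hq0 hq1 hν
  obtain ⟨h3, h4⟩ := sq_mem hq0 hq1
  have hC := orthoConst_pos hq0 hq1 hν
  have hs := (summable_abs_eulerCoeff h3 h4 h1.le).mul_right (1 / qFactInf (q ^ 2) (q ^ 2))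
  set T := ∑' l, |eulerCoeff (q ^ 2) l| * (q ^ (2 * ν + 2)) ^ l * (1 / qFactInf (q ^ 2) (q ^ 2))
  have hb : ∀ m, |latticeBessel q ν m| ≤ T / orthoConst q ν := fun m => by
    rw [le_div_iff₀' hC]
    have h := hasSum_orthoConst_mul hq0 hq1 hν m
    rw [← abs_of_pos hC, ← abs_mul, ← h.tsum_eq]
    refine (norm_tsum_le_tsum_norm h.summable.norm).trans (h.summable.norm.tsum_le_tsum ?_ hs)
    intro l
    rw [Real.norm_eq_abs, abs_mul, abs_mul, abs_pow, abs_of_pos h1,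
      abs_of_nonneg (invCoeff_nonneg h3 h4 _)]
    exact mul_le_mul_of_nonneg_left (invCoeff_le h3 h4 _) (by positivity)
  exact ⟨max 1 (T / orthoConst q ν), by positivity, fun m => (hb m).trans (le_max_right _ _)⟩

/-- The generating function of the lattice Bessel function. -/
theorem hasSum_zpow_mul (hq0 : 0 < q) (hq1 : q < 1) (hν : -1 < ν) {b : ℝ} (hb0 : 0 < b)
    (hb1 : b < 1) :
    (Summable fun m : ℤ => b ^ m * |latticeBessel q ν m|) ∧
    HasSum (fun m : ℤ => b ^ m * (orthoConst q ν * latticeBessel q ν m))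
      (eulerSum (q ^ 2) (q ^ (2 * ν + 2) / b) * ∑' n : ℕ, invCoeff (q ^ 2) n * b ^ n) := by
  obtain ⟨h1, h2⟩ := rpow_mem hq0 hq1 hν
  obtain ⟨h3, h4⟩ := sq_mem hq0 hq1
  have hC := orthoConst_pos hq0 hq1 hν
  set a := q ^ (2 * ν + 2)
  set p := q ^ 2
  have hB : HasSum (fun j : ℤ => invCoeff p j * b ^ j) (∑' n : ℕ, invCoeff p n * b ^ n) := by
    refine (Function.Injective.hasSum_iff Nat.cast_injective ?_).1
      (summable_invCoeff h3 h4 hb0.le hb1).hasSum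
    intro j hj
    have : ¬ 0 ≤ j := fun h => hj ⟨j.toNat, by simp [h]⟩
    rw [invCoeff, if_neg this, zero_mul]
  have hBabs : Summable (fun j : ℤ => |invCoeff p j * b ^ j|) := hB.summable.abs
  have hA := (summable_eulerCoeff h3 h4 (a / b)).hasSum
  have hAB := hB.mul hA (summable_mul_of_summable_norm hB.summable.norm hA.summable.norm)
  -- The shear `(m, l) ↦ (m + l, l)` turns the product of the two Euler series into the sum over `m`
  -- of the expansions of the Bessel values.
  let e : ℤ × ℕ ≃ ℤ × ℕ :=
    { toFun := fun x => (x.1 + x.2, x.2)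
      invFun := fun x => (x.1 - x.2, x.2)
      left_inv := fun x => by simp
      right_inv := fun x => by simp }
  have h5 := e.hasSum_iff.2 hAB
  have h6 : ((fun x : ℤ × ℕ => invCoeff p x.1 * b ^ x.1 * (eulerCoeff p x.2 * (a / b) ^ x.2)) ∘ e)
      = fun x : ℤ × ℕ => b ^ x.1 * (eulerCoeff p x.2 * a ^ x.2 * invCoeff p (x.1 + x.2)) := by
    ext ⟨m, l⟩
    simp only [Function.comp, e, Equiv.coe_fn_mk]
    rw [zpow_add₀ hb0.ne', div_pow, zpow_natCast]
    field_simp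
  rw [h6] at h5
  have h7 : HasSum (fun m : ℤ => b ^ m * (orthoConst q ν * latticeBessel q ν m)) _ :=
    h5.prod_fiberwise fun m => (hasSum_orthoConst_mul hq0 hq1 hν m).mul_left (b ^ m)
  refine ⟨?_, by rwa [mul_comm] at h7⟩
  have h8 := (h7.summable.abs).mul_left (1 / orthoConst q ν)
  refine h8.congr fun m => ?_
  rw [abs_mul, abs_mul, abs_of_pos hC, abs_of_pos (zpow_pos hb0 m)]
  field_simp

theorem summable_zpow_mul_abs (hq0 : 0 < q) (hq1 : q < 1) (hν : -1 < ν) {b : ℝ} (hb0 : 0 < b)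
    (hb1 : b < 1) : Summable fun m : ℤ => b ^ m * |latticeBessel q ν m| :=
  (hasSum_zpow_mul hq0 hq1 hν hb0 hb1).1

/-- At `b = q^{ν+1}` the quotient `q^{2ν+2} / b` equals `b`, so the two Euler products in the
generating function cancel. This fixes the normalization of the orthonormal system. -/
theorem hasSum_generating_one (hq0 : 0 < q) (hq1 : q < 1) (hν : -1 < ν) :
    HasSum (fun m : ℤ => (q ^ (ν + 1)) ^ m * (orthoConst q ν * latticeBessel q ν m)) 1 := by
  have hb0 : 0 < q ^ (ν + 1) := Real.rpow_pos_of_pos hq0 _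
  have hb1 : q ^ (ν + 1) < 1 := Real.rpow_lt_one hq0.le hq1 (by linarith)
  obtain ⟨h3, h4⟩ := sq_mem hq0 hq1
  have h := (hasSum_zpow_mul hq0 hq1 hν hb0 hb1).2
  have h5 : q ^ (2 * ν + 2) / q ^ (ν + 1) = q ^ (ν + 1) := by
    rw [← Real.rpow_sub hq0]; ring_nf
  rwa [h5, eulerSum_mul_invSum h3 h4 hb0.le hb1] at h

/-- Comparison of power series in `q^{2m}`: on the term of degree `n + 1` the left side acts by `(1
- p^{n+1})(1 - q^{2ν} p^{n+1})`, up to the shift of the argument, and these two factors are exactly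
the ones relating consecutive coefficients (`p = q²`). The constant terms cancel. -/
theorem latticeBessel_recurrence (hq0 : 0 < q) (hq1 : q < 1) (hν : -1 < ν) (m : ℤ) :
    latticeBessel q ν (m - 1) - (1 + q ^ (2 * ν)) * latticeBessel q ν m
      + q ^ (2 * ν) * latticeBessel q ν (m + 1) = -((q ^ 2) ^ m * latticeBessel q ν m) := by
  obtain ⟨h1, h2⟩ := rpow_mem hq0 hq1 hν
  obtain ⟨h3, h4⟩ := sq_mem hq0 hq1
  have ha : q ^ (2 * ν + 2) = q ^ (2 * ν) * q ^ 2 := by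
    rw [Real.rpow_add hq0]; norm_num
  have h := (((hasSum_latticeBessel hq0 hq1 hν (m - 1)).sub
    ((hasSum_latticeBessel hq0 hq1 hν m).mul_left (1 + q ^ (2 * ν)))).add
    ((hasSum_latticeBessel hq0 hq1 hν (m + 1)).mul_left (q ^ (2 * ν))))
  have hr := ((hasSum_latticeBessel hq0 hq1 hν m).mul_left ((q ^ 2) ^ m)).neg
  refine h.unique ?_
  rw [← hasSum_nat_add_iff' 1]
  simp only [range_one, sum_singleton, pow_zero]
  convert hr using 1
  · ext n
    have e1 : (q ^ 2) ^ (m - 1 + 1) = (q ^ 2) ^ m := by ring_nf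
    have e2 : (q ^ 2) ^ (m + 1) = (q ^ 2) ^ m * q ^ 2 := zpow_add_one₀ h3.ne' _
    have e3 : (q ^ 2) ^ (m + 1 + 1) = (q ^ 2) ^ m * q ^ 2 * q ^ 2 := by
      rw [zpow_add_one₀ h3.ne', e2]
    rw [e1, e2, e3]
    have hq2 := (one_sub_mul_pow_pos h3 h4 h1 h2 n).ne'
    have hq3 := (qFact_pos h3 h4 h1 h2 n).ne'
    have hE := eulerCoeff_succ h3 h4 n
    rw [qFact_succ, mul_pow, mul_pow, mul_pow]
    rw [ha] at hq2 hq3 ⊢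
    generalize hp : q ^ 2 = p at *
    generalize hg : q ^ (2 * ν) = g at *
    generalize eulerCoeff p (n + 1) = E1 at *
    generalize eulerCoeff p n = E0 at *
    generalize qFact (g * p) p n = Q at *
    have hpm : (p ^ m) ≠ 0 := by positivity
    generalize p ^ m = z at *
    field_simp
    have : E1 - (1 + g) * E1 * p ^ (n + 1) + g * E1 * p ^ (n + 1) * p ^ (n + 1)
      = E1 * (1 - p ^ (n + 1)) * (1 - g * p ^ (n + 1)) := by ring
    have h9 : 1 - g * p ^ (n + 1) = 1 - g * p * p ^ n := by ring
    have h10 : p ^ (n + 1) = p ^ n * p := pow_succ _ _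
    rw [hE, h9] at this
    linear_combination (z ^ (n + 1)) * this
  · simp [qFact_zero, eulerCoeff_zero]

theorem abs_latticeBessel_sub_one_le (hq0 : 0 < q) (hq1 : q < 1) (hν : -1 < ν) :
    ∃ K : ℝ, 0 < K ∧ ∀ m : ℤ, |latticeBessel q ν m - 1| ≤ K * (q ^ 2) ^ m := by
  obtain ⟨h1, h2⟩ := rpow_mem hq0 hq1 hν
  obtain ⟨h3, h4⟩ := sq_mem hq0 hq1
  obtain ⟨M, hM0, hM⟩ := abs_latticeBessel_le hq0 hq1 hν
  have hs := (summable_qBessel_terms h3 h4 h1 h2 (z := q ^ 2) h3.le)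
  have hs' := ((summable_nat_add_iff 1).2 hs).abs
  set T := ∑' n, |eulerCoeff (q ^ 2) (n + 1) / qFact (q ^ (2 * ν + 2)) (q ^ 2) (n + 1)
    * (q ^ 2) ^ (n + 1)|
  have hT : 0 ≤ T := tsum_nonneg fun n => abs_nonneg _
  -- `T` serves `m ≥ 0`, where the series without its constant term carries a factor `q^{2m}`; `M +
  -- 1` serves `m < 0`, where `q^{2m} ≥ 1`.
  refine ⟨T + (M + 1), by linarith, fun m => ?_⟩
  have hpm : 0 < (q ^ 2) ^ m := by positivity
  rcases le_or_gt 0 m with hm | hm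
  · have hz1 : (q ^ 2) ^ m ≤ 1 := by
      lift m to ℕ using hm
      exact_mod_cast pow_le_one₀ h3.le h4.le
    have h := hasSum_latticeBessel hq0 hq1 hν m
    rw [← hasSum_nat_add_iff' 1] at h
    simp only [range_one, sum_singleton, pow_zero, qFact_zero, eulerCoeff_zero, div_one,
      mul_one] at h
    have hle : |latticeBessel q ν m - 1| ≤ T * (q ^ 2) ^ m := by
      rw [← h.tsum_eq, ← tsum_mul_right]
      refine (norm_tsum_le_tsum_norm h.summable.norm).trans
        (h.summable.norm.tsum_le_tsum ?_ (hs'.mul_right _))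
      intro n
      rw [Real.norm_eq_abs, zpow_add_one₀ h3.ne', mul_pow, mul_comm (((q ^ 2) ^ m) ^ (n + 1)),
        ← mul_assoc, abs_mul, abs_of_pos (pow_pos hpm (n + 1)), pow_succ ((q ^ 2) ^ m)]
      refine mul_le_mul_of_nonneg_left ?_ (abs_nonneg _)
      exact mul_le_of_le_one_left hpm.le (pow_le_one₀ hpm.le hz1)
    nlinarith
  · have hz1 : 1 ≤ (q ^ 2) ^ m := by
      obtain ⟨n, rfl⟩ : ∃ n : ℕ, m = -(n : ℤ) := ⟨(-m).toNat, by omega⟩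
      rw [zpow_neg, zpow_natCast]
      exact (one_le_inv₀ (by positivity)).2 (pow_le_one₀ h3.le h4.le)
    have : |latticeBessel q ν m - 1| ≤ M + 1 :=
      (abs_sub _ _).trans (by simpa using hM m)
    nlinarith

theorem abs_latticeBessel_sub_le (hq0 : 0 < q) (hq1 : q < 1) (hν : -1 < ν) :
    ∃ K : ℝ, 0 < K ∧ ∀ m : ℤ, |latticeBessel q ν (m + 1) - latticeBessel q ν m| ≤ K * (q ^ 2) ^ m := by
  obtain ⟨h3, h4⟩ := sq_mem hq0 hq1
  obtain ⟨K, hK0, hK⟩ := abs_latticeBessel_sub_one_le hq0 hq1 hν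
  refine ⟨2 * K, by linarith, fun m => ?_⟩
  have h1 := hK m
  have h2 := hK (m + 1)
  rw [zpow_add_one₀ h3.ne'] at h2
  have hpm : 0 < (q ^ 2) ^ m := by positivity
  have h5 : K * ((q ^ 2) ^ m * q ^ 2) ≤ K * (q ^ 2) ^ m :=
    mul_le_mul_of_nonneg_left (mul_le_of_le_one_right hpm.le h4.le) hK0.le
  rw [abs_le] at *
  constructor <;> linarith

theorem tendsto_zpow_atTop {b : ℝ} (hb0 : 0 < b) (hb1 : b < 1) :
    Tendsto (fun m : ℤ => b ^ m) atTop (𝓝 0) := by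
  have ht : Tendsto Int.toNat atTop atTop := tendsto_atTop.2 fun n => by
    filter_upwards [eventually_ge_atTop (n : ℤ)] with m hm
    omega
  refine ((tendsto_pow_atTop_nhds_zero_of_lt_one hb0.le hb1).comp ht).congr' ?_
  filter_upwards [eventually_ge_atTop 0] with m hm
  lift m to ℕ using hm
  simp

theorem tendsto_latticeBessel_atTop (hq0 : 0 < q) (hq1 : q < 1) (hν : -1 < ν) :
    Tendsto (latticeBessel q ν) atTop (𝓝 1) := by
  obtain ⟨h3, h4⟩ := sq_mem hq0 hq1
  obtain ⟨K, hK0, hK⟩ := abs_latticeBessel_sub_one_le hq0 hq1 hν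
  rw [tendsto_iff_norm_sub_tendsto_zero]
  refine squeeze_zero (fun m => norm_nonneg _) hK ?_
  simpa using (tendsto_zpow_atTop h3 h4).const_mul K

/-- At `-∞` the lattice Bessel function decays faster than any exponential. -/
theorem tendsto_zpow_mul_latticeBessel_atBot (hq0 : 0 < q) (hq1 : q < 1) (hν : -1 < ν) {b : ℝ}
    (hb0 : 0 < b) : Tendsto (fun m : ℤ => b ^ m * latticeBessel q ν m) atBot (𝓝 0) := by
  -- For a base below `1` the terms are summable, hence tend to `0`. For `m ≤ 0` a smaller base
  -- gives a larger power, so `min b (1/2)` dominates every `b`.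
  have hd0 : 0 < min b (1 / 2) := by positivity
  have hd1 : min b (1 / 2) < 1 := (min_le_right _ _).trans_lt (by norm_num)
  have h := (summable_zpow_mul_abs hq0 hq1 hν hd0 hd1).tendsto_cofinite_zero
  have h2 := h.mono_left (Int.cofinite_eq ▸ (le_sup_left : (atBot : Filter ℤ) ≤ atBot ⊔ atTop))
  refine squeeze_zero_norm' ?_ h2
  filter_upwards [eventually_le_atBot 0] with m hm
  rw [Real.norm_eq_abs, abs_mul, abs_of_pos (zpow_pos hb0 m)]
  refine mul_le_mul_of_nonneg_right ?_ (abs_nonneg _)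
  obtain ⟨n, rfl⟩ : ∃ n : ℕ, m = -(n : ℤ) := ⟨(-m).toNat, by omega⟩
  rw [zpow_neg, zpow_neg, zpow_natCast, zpow_natCast]
  have := pow_le_pow_left₀ hd0.le (min_le_left b (1 / 2)) n
  exact inv_anti₀ (pow_pos hd0 n) this

end Lattice

/-! ### Bilateral telescoping and shifts -/

theorem hasSum_int_telescope {w : ℤ → ℝ} {A B : ℝ} (hs : Summable fun k => w (k + 1) - w k)
    (hA : Tendsto w atTop (𝓝 A)) (hB : Tendsto w atBot (𝓝 B)) :
    HasSum (fun k => w (k + 1) - w k) (A - B) := by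
  have h1 : Tendsto (fun N : ℕ => ∑ k ∈ Ico (-(N : ℤ)) N, (w (k + 1) - w k)) atTop
      (𝓝 (∑' k, (w (k + 1) - w k))) := by
    refine hs.hasSum.comp (tendsto_atTop_finset_of_monotone ?_ fun x => ?_)
    · intro a b hab
      exact Ico_subset_Ico (by simpa using hab) (by simpa using hab)
    · exact ⟨x.natAbs + 1, by rw [mem_Ico]; omega⟩
  have h2 : ∀ N : ℕ, ∑ k ∈ Ico (-(N : ℤ)) N, (w (k + 1) - w k) = w N - w (-N) := fun N => by
    induction N with
    | zero => simp
    | succ N ih =>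
      have e : Ico (-((N + 1 : ℕ) : ℤ)) ((N + 1 : ℕ) : ℤ)
          = insert (N : ℤ) (insert (-(N : ℤ) - 1) (Ico (-(N : ℤ)) N)) := by
        ext x; simp only [mem_Ico, mem_insert]; omega
      rw [e, sum_insert, sum_insert, ih]
      · push_cast; ring_nf
      · simp
      · simp only [mem_Ico, mem_insert]; omega
  simp_rw [h2] at h1
  have h3 : Tendsto (fun N : ℕ => w N - w (-N)) atTop (𝓝 (A - B)) :=
    (hA.comp tendsto_natCast_atTop_atTop).sub
      (hB.comp (tendsto_neg_atTop_atBot.comp tendsto_natCast_atTop_atTop))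
  rw [← tendsto_nhds_unique h1 h3]
  exact hs.hasSum

theorem sq_zpow (b : ℝ) (k : ℤ) : (b ^ 2) ^ k = (b ^ k) ^ 2 := by
  rw [sq, sq, mul_zpow]

theorem summable_shift {f : ℤ → ℝ} (hf : Summable f) (n : ℤ) : Summable fun k => f (n + k) :=
  (Equiv.addLeft n).summable_iff.2 hf

theorem hasSum_shift {f : ℤ → ℝ} {c : ℝ} (hf : HasSum f c) (n : ℤ) :
    HasSum (fun k => f (n + k)) c :=
  (Equiv.addLeft n).hasSum_iff.2 hf

/-! ### Parseval's identity for translates of a summable sequence -/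

section Translates

variable {u : ℤ → ℝ}

theorem exists_abs_le_of_summable (hu : Summable fun k => |u k|) :
    ∃ M, 0 ≤ M ∧ ∀ k, |u k| ≤ M :=
  ⟨∑' k, |u k|, tsum_nonneg fun _ => abs_nonneg _,
    fun k => hu.le_tsum k fun _ _ => abs_nonneg _⟩

theorem summable_mul_bdd {x u : ℤ → ℝ} (hx : Summable fun k => |x k|) {M : ℝ}
    (hM : ∀ k, |u k| ≤ M) : Summable fun k => x k * u k := by
  refine Summable.of_norm_bounded (hx.mul_right M) fun k => ?_
  rw [Real.norm_eq_abs, abs_mul]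
  exact mul_le_mul_of_nonneg_left (hM k) (abs_nonneg _)

/-- The sum over `m` of `|u(m+k) u(m+l)|` is at most `‖u‖₁ ‖u‖_∞`, uniformly in `k` and `l`.
Absolute convergence of the triple series then justifies every interchange in Parseval's identity,
with no Hilbert space argument. -/
theorem summable_mul_mul_shift (hu : Summable fun k => |u k|)
    {x y : ℤ → ℝ} (hx : Summable fun k => |x k|) (hy : Summable fun k => |y k|) :
    Summable fun z : (ℤ × ℤ) × ℤ =>
      (x z.1.1 * u (z.2 + z.1.1)) * (y z.1.2 * u (z.2 + z.1.2)) := by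
  obtain ⟨M, hM0, hM⟩ := exists_abs_le_of_summable hu
  have hin : ∀ k l, Summable fun m => |u (m + k)| * |u (m + l)| := fun k l => by
    refine Summable.of_nonneg_of_le (fun m => by positivity)
      (fun m => mul_le_mul_of_nonneg_left (hM (m + l)) (abs_nonneg _)) ?_
    simpa only [add_comm k] using (summable_shift hu k).mul_right M
  have hin_le : ∀ k l, ∑' m, |u (m + k)| * |u (m + l)| ≤ (∑' m, |u m|) * M := fun k l => by
    have h1 : Summable fun m => |u (m + k)| := by
      simpa only [add_comm k] using summable_shift hu k
    have h2 : ∑' m, |u (m + k)| = ∑' m, |u m| := by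
      simpa only [add_comm k] using (hasSum_shift hu.hasSum k).tsum_eq
    rw [← h2, ← tsum_mul_right]
    exact (hin k l).tsum_le_tsum
      (fun m => mul_le_mul_of_nonneg_left (hM (m + l)) (abs_nonneg _)) (h1.mul_right M)
  have hxy := hx.mul_of_nonneg hy (fun _ => abs_nonneg _) (fun _ => abs_nonneg _)
  rw [← summable_abs_iff, summable_prod_of_nonneg (fun _ => abs_nonneg _)]
  have e : ∀ (c : ℤ × ℤ) (m : ℤ), |x c.1 * u (m + c.1) * (y c.2 * u (m + c.2))|
      = |x c.1| * |y c.2| * (|u (m + c.1)| * |u (m + c.2)|) := fun c m => by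
    simp only [abs_mul]; ring
  simp only [e]
  refine ⟨fun c => (hin c.1 c.2).mul_left _, ?_⟩
  simp_rw [tsum_mul_left]
  refine Summable.of_nonneg_of_le
    (fun c => mul_nonneg (by positivity) (tsum_nonneg fun m => by positivity))
    (fun c => mul_le_mul_of_nonneg_left (hin_le c.1 c.2) (by positivity)) (hxy.mul_right _)

/-- Parseval's identity for the expansion along the translates of `u`. -/
theorem hasSum_mul_of_orthonormal (hu : Summable fun k => |u k|)
    (ho : ∀ n r, HasSum (fun k => u (n + k) * u (r + k)) (if n = r then 1 else 0))
    {x y : ℤ → ℝ} (hx : Summable fun k => |x k|) (hy : Summable fun k => |y k|) :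
    HasSum (fun m => (∑' k, x k * u (m + k)) * ∑' l, y l * u (m + l)) (∑' k, x k * y k) := by
  obtain ⟨M, hM0, hM⟩ := exists_abs_le_of_summable hu
  have hbd : ∀ m, Summable fun k => x k * u (m + k) := fun m =>
    summable_mul_bdd hx fun k => hM (m + k)
  have hbd' : ∀ m, Summable fun k => y k * u (m + k) := fun m =>
    summable_mul_bdd hy fun k => hM (m + k)
  have hs := summable_mul_mul_shift hu hx hy
  -- Summing over `m` first leaves the Kronecker delta in `(k, l)`; here `u(m+k)` is read as
  -- `u(k+m)`, so that orthonormality applies in the other index.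
  have h1 : HasSum (fun c : ℤ × ℤ => x c.1 * y c.2 * (if c.1 = c.2 then 1 else 0))
      (∑' z : (ℤ × ℤ) × ℤ, (x z.1.1 * u (z.2 + z.1.1)) * (y z.1.2 * u (z.2 + z.1.2))) :=
    hs.hasSum.prod_fiberwise fun c => by
      have h := (ho c.1 c.2).mul_left (x c.1 * y c.2)
      have e : (fun m => x c.1 * u (m + c.1) * (y c.2 * u (m + c.2)))
          = fun m => x c.1 * y c.2 * (u (c.1 + m) * u (c.2 + m)) := by
        funext m
        rw [add_comm c.1, add_comm c.2]; ring
      rw [← e] at h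
      exact h
  have h2 : HasSum (fun k => x k * y k)
      (∑' z : (ℤ × ℤ) × ℤ, (x z.1.1 * u (z.2 + z.1.1)) * (y z.1.2 * u (z.2 + z.1.2))) :=
    h1.prod_fiberwise fun k => by
      have := hasSum_single (f := fun l => x k * y l * (if k = l then (1 : ℝ) else 0)) k
        (fun l hl => by simp [hl.symm])
      simpa using this
  rw [h2.tsum_eq]
  have h3 : HasSum (fun z : ℤ × (ℤ × ℤ) =>
      (x z.2.1 * u (z.1 + z.2.1)) * (y z.2.2 * u (z.1 + z.2.2)))
      (∑' z : (ℤ × ℤ) × ℤ, (x z.1.1 * u (z.2 + z.1.1)) * (y z.1.2 * u (z.2 + z.1.2))) :=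
    ((Equiv.prodComm ℤ (ℤ × ℤ)).hasSum_iff).2 hs.hasSum
  refine h3.prod_fiberwise fun m => ?_
  have := (hbd m).hasSum.mul (hbd' m).hasSum
    (summable_mul_of_summable_norm (hbd m).norm (hbd' m).norm)
  exact this

end Translates

/-- The base `q^{ν+1}` of the weights: `q^{2(ν+1)n}` is its `2n`-th power. -/
def weightBase (q ν : ℝ) : ℝ := q ^ (ν + 1)

/-- The orthonormal Bessel sequence. -/
def orthoBessel (q ν : ℝ) (m : ℤ) : ℝ :=
  weightBase q ν ^ m * (orthoConst q ν * latticeBessel q ν m)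

/-! ### Orthonormality of the translated Bessel sequences -/

section Orthogonality

variable {q ν : ℝ}

theorem weightBase_pos (hq0 : 0 < q) : 0 < weightBase q ν := Real.rpow_pos_of_pos hq0 _

theorem weightBase_lt_one (hq0 : 0 < q) (hq1 : q < 1) (hν : -1 < ν) : weightBase q ν < 1 :=
  Real.rpow_lt_one hq0.le hq1 (by linarith)

theorem weightBase_sq (hq0 : 0 < q) : weightBase q ν ^ 2 = q ^ (2 * ν) * q ^ 2 := by
  rw [weightBase, ← Real.rpow_natCast, ← Real.rpow_mul hq0.le, ← Real.rpow_natCast,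
    ← Real.rpow_add hq0]
  congr 1
  push_cast
  ring

theorem weightBase_sq_lt_one (hq0 : 0 < q) (hq1 : q < 1) (hν : -1 < ν) : weightBase q ν ^ 2 < 1 :=
  pow_lt_one₀ (weightBase_pos hq0).le (weightBase_lt_one hq0 hq1 hν) two_ne_zero

theorem summable_zpow_mul_shift (hq0 : 0 < q) (hq1 : q < 1) (hν : -1 < ν) {b : ℝ} (hb0 : 0 < b)
    (hb1 : b < 1) (n : ℤ) : Summable fun k : ℤ => b ^ k * |latticeBessel q ν (n + k)| := by
  have h := (summable_shift (summable_zpow_mul_abs hq0 hq1 hν hb0 hb1) n).mul_left (b ^ (-n))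
  refine h.congr fun k => ?_
  rw [← mul_assoc, ← zpow_add₀ hb0.ne']
  ring_nf

theorem summable_abs_orthoBessel (hq0 : 0 < q) (hq1 : q < 1) (hν : -1 < ν) :
    Summable fun k => |orthoBessel q ν k| := by
  have h := (summable_zpow_mul_abs hq0 hq1 hν (weightBase_pos hq0)
    (weightBase_lt_one hq0 hq1 hν)).mul_left (orthoConst q ν)
  refine h.congr fun k => ?_
  rw [orthoBessel, abs_mul, abs_mul, abs_of_pos (orthoConst_pos hq0 hq1 hν),
    abs_of_pos (zpow_pos (weightBase_pos hq0) k)]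
  ring

theorem tendsto_zpow_mul_sub_atTop (hq0 : 0 < q) (hq1 : q < 1) (hν : -1 < ν) (n : ℤ) :
    Tendsto (fun k : ℤ => (q ^ (2 * ν)) ^ k *
      (latticeBessel q ν (n + k) - latticeBessel q ν (n + k - 1))) atTop (𝓝 0) := by
  obtain ⟨K, hK0, hK⟩ := abs_latticeBessel_sub_le hq0 hq1 hν
  have hg : 0 < q ^ (2 * ν) := Real.rpow_pos_of_pos hq0 _
  have hp : q ^ 2 ≠ 0 := by positivity
  have h := (tendsto_zpow_atTop (pow_pos (weightBase_pos (ν := ν) hq0) 2)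
    (weightBase_sq_lt_one hq0 hq1 hν)).const_mul (K * (q ^ 2) ^ (n - 1))
  rw [mul_zero] at h
  refine squeeze_zero_norm (fun k => ?_) h
  have h1 := hK (n + k - 1)
  rw [sub_add_cancel] at h1
  rw [Real.norm_eq_abs, abs_mul, abs_of_pos (zpow_pos hg k), weightBase_sq hq0, mul_zpow]
  calc _ ≤ (q ^ (2 * ν)) ^ k * (K * (q ^ 2) ^ (n + k - 1)) :=
        mul_le_mul_of_nonneg_left h1 (zpow_pos hg k).le
    _ = _ := by
      rw [show n + k - 1 = (n - 1) + k by ring, zpow_add₀ hp]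
      ring

theorem tendsto_zpow_mul_shift_atBot (hq0 : 0 < q) (hq1 : q < 1) (hν : -1 < ν) {b : ℝ}
    (hb0 : 0 < b) (n : ℤ) :
    Tendsto (fun k : ℤ => b ^ k * latticeBessel q ν (n + k)) atBot (𝓝 0) := by
  have h := ((tendsto_zpow_mul_latticeBessel_atBot hq0 hq1 hν hb0).comp
    (tendsto_atBot_add_const_left atBot n tendsto_id)).const_mul (b ^ (-n))
  rw [mul_zero] at h
  refine h.congr fun k => ?_
  simp only [Function.comp, id]
  rw [← mul_assoc, ← zpow_add₀ hb0.ne']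
  ring_nf

/-- Multiplied by `q^{2νm}`, the recurrence writes each term as minus the increment of the flux
`q^{2νm} (j(m) - j(m-1))`. At `+∞` the flux is `O(w^{2m})`, which tends to `0` because `ν > -1`; at
`-∞` it dies by superexponential decay. -/
theorem hasSum_sq_weight_mul (hq0 : 0 < q) (hq1 : q < 1) (hν : -1 < ν) :
    HasSum (fun m : ℤ => (weightBase q ν ^ 2) ^ m * latticeBessel q ν m) 0 := by
  have hg : 0 < q ^ (2 * ν) := Real.rpow_pos_of_pos hq0 _
  set w : ℤ → ℝ := fun m => (q ^ (2 * ν)) ^ m *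
    (latticeBessel q ν (0 + m) - latticeBessel q ν (0 + m - 1)) with hw
  have hstep : ∀ m : ℤ, -((weightBase q ν ^ 2) ^ m * latticeBessel q ν m) = w (m + 1) - w m := by
    intro m
    have h := latticeBessel_recurrence hq0 hq1 hν m
    simp only [hw, zero_add, add_sub_cancel_right]
    rw [weightBase_sq hq0, mul_zpow, zpow_add_one₀ hg.ne']
    linear_combination (-(q ^ (2 * ν)) ^ m) * h
  have hs : Summable fun m => w (m + 1) - w m := by
    have h := (summable_zpow_mul_abs hq0 hq1 hν (pow_pos (weightBase_pos (ν := ν) hq0) 2)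
      (weightBase_sq_lt_one hq0 hq1 hν))
    rw [← summable_abs_iff]
    refine h.congr fun m => ?_
    rw [← hstep, abs_neg, abs_mul, abs_of_pos (zpow_pos (pow_pos (weightBase_pos hq0) 2) m)]
  have hbot : Tendsto w atBot (𝓝 0) := by
    have h := (tendsto_zpow_mul_shift_atBot hq0 hq1 hν hg 0).sub
      (tendsto_zpow_mul_shift_atBot hq0 hq1 hν hg (-1))
    rw [sub_zero] at h
    refine h.congr fun m => ?_
    simp only [hw]
    rw [show 0 + m - 1 = -1 + m by ring]
    ring
  have h := hasSum_int_telescope hs (tendsto_zpow_mul_sub_atTop hq0 hq1 hν 0) hbot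
  simp_rw [← hstep] at h
  simpa using h.neg

theorem hasSum_latticeBessel_mul (hq0 : 0 < q) (hq1 : q < 1) (hν : -1 < ν) {n r : ℤ}
    (hnr : n ≠ r) : HasSum (fun k : ℤ => (weightBase q ν ^ 2) ^ k *
      (latticeBessel q ν (n + k) * latticeBessel q ν (r + k))) 0 := by
  have hg : 0 < q ^ (2 * ν) := Real.rpow_pos_of_pos hq0 _
  have hp : q ^ 2 ≠ 0 := by positivity
  obtain ⟨h3, h4⟩ := sq_mem hq0 hq1
  obtain ⟨M, hM0, hM⟩ := abs_latticeBessel_le hq0 hq1 hν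
  -- The weighted Casoratian of two eigenfunctions. Its increment is the difference `q^{2r} -
  -- q^{2n}` of eigenvalues times the summand, as in Green's formula, and it vanishes at both ends.
  set w : ℤ → ℝ := fun k => (q ^ (2 * ν)) ^ k *
    (latticeBessel q ν (n + k) * latticeBessel q ν (r + k - 1)
      - latticeBessel q ν (r + k) * latticeBessel q ν (n + k - 1)) with hw
  have hstep : ∀ k : ℤ, ((q ^ 2) ^ r - (q ^ 2) ^ n) * ((weightBase q ν ^ 2) ^ k *
      (latticeBessel q ν (n + k) * latticeBessel q ν (r + k))) = w (k + 1) - w k := by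
    intro k
    have h1 := latticeBessel_recurrence hq0 hq1 hν (n + k)
    have h2 := latticeBessel_recurrence hq0 hq1 hν (r + k)
    rw [zpow_add₀ hp] at h1 h2
    simp only [hw]
    rw [weightBase_sq hq0, mul_zpow, zpow_add_one₀ hg.ne', ← add_assoc, ← add_assoc,
      add_sub_cancel_right, add_sub_cancel_right]
    linear_combination ((q ^ (2 * ν)) ^ k * latticeBessel q ν (n + k)) * h2
      - ((q ^ (2 * ν)) ^ k * latticeBessel q ν (r + k)) * h1
  have hs0 : Summable fun k : ℤ => (weightBase q ν ^ 2) ^ k *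
      (latticeBessel q ν (n + k) * latticeBessel q ν (r + k)) := by
    have h := (summable_zpow_mul_shift hq0 hq1 hν (pow_pos (weightBase_pos (ν := ν) hq0) 2)
      (weightBase_sq_lt_one hq0 hq1 hν) n).mul_right M
    refine Summable.of_norm_bounded h fun k => ?_
    rw [Real.norm_eq_abs, abs_mul, abs_mul, ← mul_assoc,
      abs_of_pos (zpow_pos (pow_pos (weightBase_pos hq0) 2) k)]
    exact mul_le_mul_of_nonneg_left (hM _) (mul_nonneg (by positivity) (abs_nonneg _))
  have hs : Summable fun k => w (k + 1) - w k := (hs0.mul_left _).congr hstep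
  have hbddR : ∀ c : ℤ, IsBoundedUnder (· ≤ ·) atTop (norm ∘ fun k => latticeBessel q ν (c + k)) :=
    fun c => isBoundedUnder_of ⟨M, fun k => hM _⟩
  have hbddL : ∀ c : ℤ, IsBoundedUnder (· ≤ ·) atBot (norm ∘ fun k => latticeBessel q ν (c + k)) :=
    fun c => isBoundedUnder_of ⟨M, fun k => hM _⟩
  have hbot : Tendsto w atBot (𝓝 0) := by
    have h := ((tendsto_zpow_mul_shift_atBot hq0 hq1 hν hg n).zero_mul_isBoundedUnder_le
        (hbddL (r - 1))).sub
      ((tendsto_zpow_mul_shift_atBot hq0 hq1 hν hg r).zero_mul_isBoundedUnder_le (hbddL (n - 1)))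
    rw [sub_zero] at h
    refine h.congr fun m => ?_
    simp only [hw]
    rw [show r - 1 + m = r + m - 1 by ring, show n - 1 + m = n + m - 1 by ring]
    ring
  have htop : Tendsto w atTop (𝓝 0) := by
    have h := ((tendsto_zpow_mul_sub_atTop hq0 hq1 hν n).zero_mul_isBoundedUnder_le (hbddR r)).sub
      ((tendsto_zpow_mul_sub_atTop hq0 hq1 hν r).zero_mul_isBoundedUnder_le (hbddR n))
    rw [sub_zero] at h
    refine h.congr fun m => ?_
    simp only [hw]
    ring
  have h := hasSum_int_telescope hs htop hbot
  simp_rw [← hstep] at h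
  have hne : (q ^ 2) ^ r - (q ^ 2) ^ n ≠ 0 := by
    rw [sub_ne_zero]
    intro h
    exact hnr (zpow_right_injective₀ h3 h4.ne h).symm
  have h5 := h.mul_left ((q ^ 2) ^ r - (q ^ 2) ^ n)⁻¹
  simpa [hne] using h5

/-- The off-diagonal case is Green's formula. The norm needs no separate computation: grouping the
square of `∑ u = 1` by the difference `d` of the two indices gives `∑_d ∑_k u(k) u(d+k) = 1`, and
only `d = 0` survives. -/
theorem hasSum_orthoBessel_mul (hq0 : 0 < q) (hq1 : q < 1) (hν : -1 < ν) (n r : ℤ) :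
    HasSum (fun k => orthoBessel q ν (n + k) * orthoBessel q ν (r + k))
      (if n = r then 1 else 0) := by
  have hw := weightBase_pos (ν := ν) hq0
  have hoff : ∀ n r : ℤ, n ≠ r →
      HasSum (fun k => orthoBessel q ν (n + k) * orthoBessel q ν (r + k)) 0 := fun n r hnr => by
    have h := (hasSum_latticeBessel_mul hq0 hq1 hν hnr).mul_left
      (orthoConst q ν ^ 2 * weightBase q ν ^ (n + r))
    rw [mul_zero] at h
    refine h.congr_fun fun k => ?_
    rw [orthoBessel, orthoBessel, zpow_add₀ hw.ne', zpow_add₀ hw.ne', zpow_add₀ hw.ne', sq_zpow]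
    ring
  have habs := summable_abs_orthoBessel hq0 hq1 hν
  have h1 : HasSum (orthoBessel q ν) 1 := hasSum_generating_one hq0 hq1 hν
  have h2 := h1.mul h1 (summable_mul_of_summable_norm h1.summable.norm h1.summable.norm)
  let e : ℤ × ℤ ≃ ℤ × ℤ :=
    { toFun := fun x => (x.2, x.1 + x.2)
      invFun := fun x => (x.2 - x.1, x.1)
      left_inv := fun x => by simp
      right_inv := fun x => by simp }
  have h3 := e.hasSum_iff.2 h2
  have h4 : HasSum (fun d => ∑' k, orthoBessel q ν (0 + k) * orthoBessel q ν (d + k)) (1 * 1) :=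
    h3.prod_fiberwise fun d => by
      have := h3.summable.prod_factor d
      simpa [e, Function.comp] using this.hasSum
  have h5 := hasSum_single (f := fun d => ∑' k, orthoBessel q ν (0 + k) * orthoBessel q ν (d + k)) 0
    fun d hd => (hoff 0 d hd.symm).tsum_eq
  have h6 : ∑' k, orthoBessel q ν (0 + k) * orthoBessel q ν (0 + k) = 1 := by
    simpa using h5.unique h4
  split_ifs with hnr
  · subst hnr
    obtain ⟨M, hM0, hM⟩ := exists_abs_le_of_summable habs
    have h7 : Summable fun k => orthoBessel q ν (0 + k) * orthoBessel q ν (0 + k) := by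
      simpa using summable_mul_bdd habs hM
    have h8 := h7.hasSum
    rw [h6] at h8
    simpa using hasSum_shift h8 n
  · exact hoff n r hnr

end Orthogonality

/-- The generator of the birth and death process acting on functions of the starting state. -/
def generator (q ν : ℝ) (v : ℤ → ℝ) (i : ℤ) : ℝ :=
  birthRate q ν i * (v (i + 1) - v i) + deathRate q i * (v (i - 1) - v i)

/-- The kernel of the spectral multiplier `φ`. -/
def spectralKernel (q ν : ℝ) (φ : ℤ → ℝ) (n r : ℤ) : ℝ :=
  weightBase q ν ^ (n - r) * ∑' k, (φ k * orthoBessel q ν (n + k)) * orthoBessel q ν (r + k)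

/-! ### Spectral multipliers, the resolvent and positivity -/

section Kernel

variable {q ν : ℝ}

theorem birthRate_eq (hq0 : 0 < q) (i : ℤ) :
    birthRate q ν i = q ^ (2 * ν) * ((q ^ 2) ^ i)⁻¹ := by
  rw [birthRate, Real.rpow_sub hq0, sq_zpow, div_eq_mul_inv]
  congr 2
  rw [show (2 : ℝ) * i = ((i * 2 : ℤ) : ℝ) by push_cast; ring, Real.rpow_intCast, zpow_mul]
  norm_cast

theorem deathRate_eq (i : ℤ) : deathRate q i = ((q ^ 2) ^ i)⁻¹ := by
  rw [deathRate, sq_zpow, show -2 * i = -(i * 2) by ring, zpow_neg, zpow_mul]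
  norm_cast

theorem birthRate_pos (hq0 : 0 < q) (i : ℤ) : 0 < birthRate q ν i :=
  Real.rpow_pos_of_pos hq0 _

theorem deathRate_pos (hq0 : 0 < q) (i : ℤ) : 0 < deathRate q i := zpow_pos hq0 _

/-- On the lattice, the factors `q^{2(ν+1)n}` and `q^k (q^k)^{2ν+1}` are the squares of `w^n` and
`w^k`; they distribute over the two Bessel factors and leave the prefactor `w^{n-r}`. -/
theorem qTransition_eq (hq0 : 0 < q) (hq1 : q < 1) (n r : ℤ) (t : ℝ) :
    qTransition q ν n r t = spectralKernel q ν (fun k => Real.exp (-t * (q ^ 2) ^ k)) n r := by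
  have hw := weightBase_pos (ν := ν) hq0
  have h1q : 1 - q ≠ 0 := by linarith
  have hn : q ^ (2 * (ν + 1) * n) = weightBase q ν ^ n * weightBase q ν ^ n := by
    rw [weightBase, ← Real.rpow_intCast, ← Real.rpow_mul hq0.le, ← Real.rpow_add hq0]
    ring_nf
  have hk : ∀ k : ℤ, q ^ k * (q ^ k) ^ (2 * ν + 1) = weightBase q ν ^ k * weightBase q ν ^ k := by
    intro k
    rw [weightBase, ← Real.rpow_intCast, ← Real.rpow_intCast, ← Real.rpow_mul hq0.le,
      ← Real.rpow_mul hq0.le, ← Real.rpow_add hq0, ← Real.rpow_add hq0]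
    ring_nf
  have hc : (1 - q) * besselConst q ν = orthoConst q ν := by
    rw [besselConst, orthoConst]
    field_simp
  unfold qTransition heatKernel jacksonIntegral spectralKernel
  rw [hn, ← tsum_mul_left, ← tsum_mul_left, ← tsum_mul_left, ← tsum_mul_left]
  refine tsum_congr fun k => ?_
  simp only [orthoBessel, latticeBessel]
  rw [← hc, zpow_add₀ hw.ne', zpow_add₀ hw.ne', zpow_sub₀ hw.ne', zpow_add₀ hq0.ne',
    zpow_add₀ hq0.ne', sq_zpow]
  have := hk k
  have hwr : weightBase q ν ^ r ≠ 0 := (zpow_pos hw r).ne'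
  generalize Real.exp (-t * (q ^ k) ^ 2) = E
  generalize qBessel q ν (q ^ n * q ^ k) = x
  generalize qBessel q ν (q ^ r * q ^ k) = y
  field_simp
  linear_combination (E * besselConst q ν ^ 2 * x * y) * this

theorem summable_mult (hq0 : 0 < q) (hq1 : q < 1) (hν : -1 < ν) {φ : ℤ → ℝ}
    {B : ℝ} (hφ : ∀ k, |φ k| ≤ B) (n : ℤ) :
    Summable fun k => |φ k * orthoBessel q ν (n + k)| := by
  have h := (summable_shift (summable_abs_orthoBessel hq0 hq1 hν) n).mul_left B
  refine Summable.of_nonneg_of_le (fun _ => abs_nonneg _) (fun k => ?_) h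
  rw [abs_mul]
  exact mul_le_mul_of_nonneg_right (hφ k) (abs_nonneg _)

theorem summable_kernel (hq0 : 0 < q) (hq1 : q < 1) (hν : -1 < ν) {φ : ℤ → ℝ}
    {B : ℝ} (hφ : ∀ k, |φ k| ≤ B) (n r : ℤ) :
    Summable fun k => (φ k * orthoBessel q ν (n + k)) * orthoBessel q ν (r + k) := by
  obtain ⟨M, -, hM⟩ := exists_abs_le_of_summable (summable_abs_orthoBessel hq0 hq1 hν)
  exact summable_mul_bdd (summable_mult hq0 hq1 hν hφ n) fun k => hM (r + k)

theorem hasSum_kernel (hq0 : 0 < q) (hq1 : q < 1) (hν : -1 < ν) {φ : ℤ → ℝ}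
    {B : ℝ} (hφ : ∀ k, |φ k| ≤ B) (n r : ℤ) :
    HasSum (fun k => weightBase q ν ^ (n - r) *
      ((φ k * orthoBessel q ν (n + k)) * orthoBessel q ν (r + k))) (spectralKernel q ν φ n r) :=
  (summable_kernel hq0 hq1 hν hφ n r).hasSum.mul_left _

theorem spectralKernel_one (hq0 : 0 < q) (hq1 : q < 1) (hν : -1 < ν) (n r : ℤ) :
    spectralKernel q ν (fun _ => 1) n r = if n = r then 1 else 0 := by
  unfold spectralKernel
  simp only [one_mul]
  rw [(hasSum_orthoBessel_mul hq0 hq1 hν n r).tsum_eq]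
  split_ifs with h
  · simp [h]
  · simp

/-- Composition of kernels is Parseval's identity, the prefactors combining as `w^{n-m} w^{m-r} =
w^{n-r}`. -/
theorem hasSum_kernel_comp (hq0 : 0 < q) (hq1 : q < 1) (hν : -1 < ν) {φ ψ : ℤ → ℝ}
    {B B' : ℝ} (hφ : ∀ k, |φ k| ≤ B) (hψ : ∀ k, |ψ k| ≤ B') (n r : ℤ) :
    HasSum (fun m => spectralKernel q ν φ n m * spectralKernel q ν ψ m r)
      (spectralKernel q ν (fun k => φ k * ψ k) n r) := by
  have hw := weightBase_pos (ν := ν) hq0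
  have h := (hasSum_mul_of_orthonormal (summable_abs_orthoBessel hq0 hq1 hν)
    (hasSum_orthoBessel_mul hq0 hq1 hν) (summable_mult hq0 hq1 hν hφ n)
    (summable_mult hq0 hq1 hν hψ r)).mul_left (weightBase q ν ^ (n - r))
  have e1 : ∑' k, φ k * orthoBessel q ν (n + k) * (ψ k * orthoBessel q ν (r + k))
      = ∑' k, φ k * ψ k * orthoBessel q ν (n + k) * orthoBessel q ν (r + k) :=
    tsum_congr fun k => by ring
  have e2 : ∀ m, ∑' k, ψ k * orthoBessel q ν (r + k) * orthoBessel q ν (m + k)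
      = ∑' k, ψ k * orthoBessel q ν (m + k) * orthoBessel q ν (r + k) :=
    fun m => tsum_congr fun k => by ring
  rw [e1] at h
  refine h.congr_fun fun m => ?_
  simp only [spectralKernel]
  rw [e2, show n - r = (n - m) + (m - r) by ring, zpow_add₀ hw.ne']
  ring

/-- The generator involves only three values, so it may be applied term by term, and each term is an
eigenfunction. The summability of the series with the additional weight `q^{2k}` comes out as a
by-product. -/
theorem hasSum_kernel_generator (hq0 : 0 < q) (hq1 : q < 1) (hν : -1 < ν) {φ : ℤ → ℝ}
    {B : ℝ} (hφ : ∀ k, |φ k| ≤ B) (n i : ℤ) :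
    HasSum (fun k => (q ^ 2) ^ k * (weightBase q ν ^ (n - i) *
      ((φ k * orthoBessel q ν (n + k)) * orthoBessel q ν (i + k))))
      (-generator q ν (spectralKernel q ν φ n) i) := by
  have hw := weightBase_pos (ν := ν) hq0
  have hp : 0 < q ^ 2 := by positivity
  have h := (((hasSum_kernel hq0 hq1 hν hφ n (i + 1)).sub
    (hasSum_kernel hq0 hq1 hν hφ n i)).mul_left (birthRate q ν i)).add
    (((hasSum_kernel hq0 hq1 hν hφ n (i - 1)).sub
    (hasSum_kernel hq0 hq1 hν hφ n i)).mul_left (deathRate q i))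
  refine h.neg.congr_fun fun k => ?_
  have hr := latticeBessel_recurrence hq0 hq1 hν (i + k)
  rw [zpow_add₀ hp.ne'] at hr
  rw [birthRate_eq hq0, deathRate_eq]
  simp only [orthoBessel]
  have hw1 : weightBase q ν ^ (n - (i + 1)) * weightBase q ν ^ (i + 1 + k)
      = weightBase q ν ^ (n + k) := by rw [← zpow_add₀ hw.ne']; ring_nf
  have hw2 : weightBase q ν ^ (n - (i - 1)) * weightBase q ν ^ (i - 1 + k)
      = weightBase q ν ^ (n + k) := by rw [← zpow_add₀ hw.ne']; ring_nf
  have hw3 : weightBase q ν ^ (n - i) * weightBase q ν ^ (i + k)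
      = weightBase q ν ^ (n + k) := by rw [← zpow_add₀ hw.ne']; ring_nf
  rw [show i + 1 + k = i + k + 1 by ring, show i - 1 + k = i + k - 1 by ring] at *
  have hpi : (q ^ 2) ^ i ≠ 0 := (zpow_pos hp i).ne'
  generalize weightBase q ν ^ (n - (i + 1)) = a1 at *
  generalize weightBase q ν ^ (n - (i - 1)) = a2 at *
  generalize weightBase q ν ^ (n - i) = a3 at *
  generalize weightBase q ν ^ (i + k + 1) = b1 at *
  generalize weightBase q ν ^ (i + k - 1) = b2 at *
  generalize weightBase q ν ^ (i + k) = b3 at *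
  generalize weightBase q ν ^ (n + k) = c at *
  generalize latticeBessel q ν (i + k + 1) = x1 at *
  generalize latticeBessel q ν (i + k - 1) = x2 at *
  generalize latticeBessel q ν (i + k) = x3 at *
  generalize latticeBessel q ν (n + k) = y at *
  generalize q ^ (2 * ν) = g at *
  generalize (q ^ 2) ^ i = P at *
  generalize (q ^ 2) ^ k = R at *
  generalize orthoConst q ν = C at *
  generalize φ k = f at *
  have e1 : a1 * (f * (c * (C * y)) * (b1 * (C * x1))) = c * (f * c * C ^ 2 * y) * x1 := by
    rw [← hw1]; ring
  have e2 : a2 * (f * (c * (C * y)) * (b2 * (C * x2))) = c * (f * c * C ^ 2 * y) * x2 := by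
    linear_combination (f * c * C ^ 2 * y * x2) * hw2
  have e3 : a3 * (f * (c * (C * y)) * (b3 * (C * x3))) = c * (f * c * C ^ 2 * y) * x3 := by
    linear_combination (f * c * C ^ 2 * y * x3) * hw3
  simp only [e1, e2, e3]
  field_simp
  linear_combination (c ^ 2 * f * C ^ 2 * y) * hr

/-- Minimum principle for the resolvent equation. -/
theorem nonneg_of_resolvent (hq0 : 0 < q) {v : ℤ → ℝ} {θ L : ℝ} (hθ : 0 < θ) {s : ℤ → ℝ}
    (hs : ∀ i, 0 ≤ s i) (hsN : ∀ᶠ i in atTop, s i = 0)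
    (hres : ∀ i, v i - θ * generator q ν v i = s i)
    (hbot : Tendsto v atBot (𝓝 0)) (htop : Tendsto v atTop (𝓝 L))
    (hflux : Tendsto (fun i : ℤ => (q ^ (2 * ν)) ^ i * (v i - v (i - 1))) atTop (𝓝 0)) (i : ℤ) :
    0 ≤ v i := by
  by_contra! hi
  have hg : 0 < q ^ (2 * ν) := Real.rpow_pos_of_pos hq0 _
  obtain ⟨j, hj, hjt⟩ : ∃ j, v j < 0 ∧ ∀ᶠ k in atTop, v j ≤ v k := by
    rcases lt_or_ge (v i) L with hL | hL
    · exact ⟨i, hi, (htop.eventually_const_lt hL).mono fun _ h => h.le⟩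
    -- If the limit lies below zero, then beyond the support of the source the resolvent equation
    -- makes the generator negative, so the flux `q^{2νk} (v k - v (k-1))` decreases. As it tends to
    -- `0` it is nonnegative; hence `v` increases from `N` on and `v N` bounds the tail from below.
    · obtain ⟨N, hN⟩ := eventually_atTop.1
        ((htop.eventually_lt_const (hL.trans_lt hi)).and hsN)
      have hstep : ∀ k, N ≤ k → (q ^ (2 * ν)) ^ (k + 1) * (v (k + 1) - v k)
          ≤ (q ^ (2 * ν)) ^ k * (v k - v (k - 1)) := fun k hk => by
        have h1 := (hN k hk).1
        have h2 := hres k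
        rw [(hN k hk).2] at h2
        have h3 : generator q ν v k < 0 := by
          by_contra! h
          have := mul_nonneg hθ.le h
          linarith
        rw [generator, birthRate_eq hq0, deathRate_eq] at h3
        have hp : 0 < ((q ^ 2) ^ k)⁻¹ := by positivity
        have h4 : ((q ^ 2) ^ k)⁻¹ * (q ^ (2 * ν) * (v (k + 1) - v k) + (v (k - 1) - v k)) < 0 := by
          linarith
        have h5 := (pos_iff_neg_of_mul_neg h4).1 hp
        have h6 := mul_neg_of_pos_of_neg (zpow_pos hg k) h5
        rw [zpow_add_one₀ hg.ne']
        linarith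
      have hanti : ∀ k, N ≤ k → ∀ d : ℕ, (q ^ (2 * ν)) ^ (k + d) * (v (k + d) - v (k + d - 1))
          ≤ (q ^ (2 * ν)) ^ k * (v k - v (k - 1)) := fun k hk d => by
        induction d with
        | zero => simp
        | succ d ih =>
          have := hstep (k + d) (by omega)
          push_cast
          rw [← add_assoc, add_sub_cancel_right]
          exact this.trans ih
      have hpos : ∀ k, N ≤ k → v (k - 1) ≤ v k := fun k hk => by
        have h1 : 0 ≤ (q ^ (2 * ν)) ^ k * (v k - v (k - 1)) := by
          refine le_of_tendsto hflux ?_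
          filter_upwards [eventually_ge_atTop k] with m hm
          obtain ⟨d, rfl⟩ : ∃ d : ℕ, m = k + d := ⟨(m - k).toNat, by omega⟩
          exact hanti k hk d
        have := nonneg_of_mul_nonneg_right h1 (zpow_pos hg k)
        linarith
      refine ⟨N, (hN N le_rfl).1, ?_⟩
      filter_upwards [eventually_ge_atTop N] with m hm
      obtain ⟨d, rfl⟩ : ∃ d : ℕ, m = N + d := ⟨(m - N).toNat, by omega⟩
      induction d with
      | zero => simp
      | succ d ih =>
        have h := hpos (N + ((d + 1 : ℕ) : ℤ)) (by omega)
        have e : N + ((d + 1 : ℕ) : ℤ) - 1 = N + (d : ℤ) := by push_cast; ring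
        rw [e] at h
        exact (ih (by omega)).trans h
  obtain ⟨b, hb⟩ := eventually_atTop.1 hjt
  obtain ⟨a, ha⟩ := eventually_atBot.1
    ((hbot.eventually_const_lt hj).mono fun _ h => h.le : ∀ᶠ k in atBot, v j ≤ v k)
  -- The negative value `v j` bounds `v` from below near both ends, so a global minimum is attained.
  -- There the generator is nonnegative, and the resolvent equation contradicts `v m < 0`.
  obtain ⟨m, -, hm⟩ := exists_min_image (Icc (min a j) (max b j)) v ⟨j, by simp⟩
  have hmj : v m ≤ v j := hm j (by simp)
  have hmin : ∀ k, v m ≤ v k := fun k => by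
    by_cases hk : k ∈ Icc (min a j) (max b j)
    · exact hm k hk
    · rw [mem_Icc, not_and_or, not_le, not_le] at hk
      rcases hk with hk | hk
      · exact hmj.trans (ha k (hk.le.trans (min_le_left _ _)))
      · exact hmj.trans (hb k ((le_max_left _ _).trans hk.le))
  have h1 : 0 ≤ generator q ν v m :=
    add_nonneg (mul_nonneg (birthRate_pos hq0 m).le (sub_nonneg.2 (hmin _)))
      (mul_nonneg (deathRate_pos hq0 m).le (sub_nonneg.2 (hmin _)))
  have h2 := hres m
  have h3 := hs m
  have h4 := mul_nonneg hθ.le h1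
  linarith

/-- The starting state `i` now occurs only in `j(i+k)`, so limits in `i` reduce to limits of the
Bessel function by dominated convergence. -/
theorem weight_mul_kernel_term (hq0 : 0 < q) (φ : ℤ → ℝ) (n i k : ℤ) :
    weightBase q ν ^ (n - i) * ((φ k * orthoBessel q ν (n + k)) * orthoBessel q ν (i + k))
      = weightBase q ν ^ n * orthoConst q ν * (φ k * (weightBase q ν ^ k * orthoBessel q ν (n + k)))
        * latticeBessel q ν (i + k) := by
  have hw := weightBase_pos (ν := ν) hq0
  have hw3 : weightBase q ν ^ (n - i) * weightBase q ν ^ (i + k)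
      = weightBase q ν ^ n * weightBase q ν ^ k := by
    rw [← zpow_add₀ hw.ne', ← zpow_add₀ hw.ne']; ring_nf
  rw [orthoBessel.eq_def q ν (i + k)]
  linear_combination (φ k * orthoBessel q ν (n + k) * orthoConst q ν * latticeBessel q ν (i + k))
    * hw3

theorem summable_zpow_mul_orthoBessel (hq0 : 0 < q) (hq1 : q < 1) (hν : -1 < ν) {b : ℝ}
    (hb0 : 0 < b) (hb1 : b * weightBase q ν < 1) (n : ℤ) :
    Summable fun k : ℤ => b ^ k * |orthoBessel q ν (n + k)| := by
  have hw := weightBase_pos (ν := ν) hq0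
  have h := (summable_zpow_mul_shift hq0 hq1 hν (mul_pos hb0 hw) hb1 n).mul_left
    (weightBase q ν ^ n * orthoConst q ν)
  refine h.congr fun k => ?_
  rw [orthoBessel, abs_mul, abs_mul, abs_of_pos (orthoConst_pos hq0 hq1 hν),
    abs_of_pos (zpow_pos hw (n + k)), mul_zpow, zpow_add₀ hw.ne']
  ring

/-- Applying `1 - θ · generator` multiplies the multiplier by `1 + θ q^{2k}` and gives the kernel of
`1`, that is, the source `δ_n`. The boundary behaviour required by the minimum principle comes from
that of `j`: limit `0` at `-∞`, limit `1` at `+∞`, increments `O(q^{2m})`. -/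
theorem spectralKernel_resolvent_nonneg (hq0 : 0 < q) (hq1 : q < 1) (hν : -1 < ν) {θ : ℝ}
    (hθ : 0 < θ) (n i : ℤ) : 0 ≤ spectralKernel q ν (fun k => 1 / (1 + θ * (q ^ 2) ^ k)) n i := by
  have hw := weightBase_pos (ν := ν) hq0
  have hg : 0 < q ^ (2 * ν) := Real.rpow_pos_of_pos hq0 _
  obtain ⟨h3, h4⟩ := sq_mem hq0 hq1
  have hwsq := weightBase_sq_lt_one hq0 hq1 hν
  set ρ : ℤ → ℝ := fun k => 1 / (1 + θ * (q ^ 2) ^ k) with hρ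
  have hden : ∀ k : ℤ, 0 < θ * (q ^ 2) ^ k := fun k => by positivity
  have hρ1 : ∀ k, |ρ k| ≤ 1 := fun k => by
    have := hden k
    rw [hρ, abs_of_pos (by positivity), div_le_one (by positivity)]
    linarith
  obtain ⟨M, hM0, hM⟩ := abs_latticeBessel_le hq0 hq1 hν
  obtain ⟨K, hK0, hK⟩ := abs_latticeBessel_sub_le hq0 hq1 hν
  set A : ℤ → ℝ := fun k => weightBase q ν ^ n * orthoConst q ν *
    (ρ k * (weightBase q ν ^ k * orthoBessel q ν (n + k))) with hA
  have hv : ∀ i, spectralKernel q ν ρ n i = ∑' k, A k * latticeBessel q ν (i + k) := fun i => by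
    rw [← (hasSum_kernel hq0 hq1 hν hρ1 n i).tsum_eq]
    exact tsum_congr fun k => weight_mul_kernel_term hq0 ρ n i k
  have hAle : ∀ k, |A k| ≤ weightBase q ν ^ n * orthoConst q ν *
      (weightBase q ν ^ k * |orthoBessel q ν (n + k)|) := fun k => by
    have hC := orthoConst_pos hq0 hq1 hν
    rw [hA]
    simp only
    rw [abs_mul, abs_mul, abs_mul, abs_mul, abs_of_pos hC, abs_of_pos (zpow_pos hw n),
      abs_of_pos (zpow_pos hw k)]
    refine mul_le_mul_of_nonneg_left ?_ (by positivity)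
    exact mul_le_of_le_one_left (by positivity) (hρ1 k)
  have hAs : Summable fun k => |A k| :=
    Summable.of_nonneg_of_le (fun _ => abs_nonneg _) hAle
      ((summable_zpow_mul_orthoBessel hq0 hq1 hν hw (by rwa [← sq]) n).mul_left _)
  have hAs2 : Summable fun k => (q ^ 2) ^ k * |A k| := by
    have h := (summable_zpow_mul_orthoBessel hq0 hq1 hν (mul_pos h3 hw)
      (by rw [mul_assoc, ← sq]; exact mul_lt_one_of_nonneg_of_lt_one_left h3.le h4 hwsq.le) n).mul_left
      (weightBase q ν ^ n * orthoConst q ν)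
    refine Summable.of_nonneg_of_le (fun k => by positivity) (fun k => ?_) h
    calc _ ≤ _ := mul_le_mul_of_nonneg_left (hAle k) (by positivity)
      _ = _ := by rw [mul_zpow]; ring
  refine nonneg_of_resolvent (ν := ν) (v := fun i => spectralKernel q ν ρ n i)
    (L := ∑' k, A k * 1) (s := fun i => if n = i then 1 else 0) hq0 hθ
    (fun i => by positivity) ?_ ?_ ?_ ?_ ?_ i
  · filter_upwards [eventually_gt_atTop n] with m hm
    rw [if_neg hm.ne]
  · intro i
    have h1 := hasSum_kernel hq0 hq1 hν hρ1 n i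
    have h2 := (hasSum_kernel_generator hq0 hq1 hν hρ1 n i).mul_left θ
    have h5 := h1.add h2
    have h6 := hasSum_kernel (φ := fun _ => 1) hq0 hq1 hν (B := 1) (fun k => by simp) n i
    rw [spectralKernel_one hq0 hq1 hν] at h6
    refine Eq.trans ?_ (h5.unique (h6.congr_fun fun k => ?_))
    · ring
    · have := hden k
      simp only [hρ]
      field_simp
  · have h := tendsto_tsum_of_dominated_convergence (𝓕 := atBot)
      (f := fun i k => A k * latticeBessel q ν (i + k)) (g := fun k => A k * 0)
      (hAs.mul_right M) (fun k => ?_) (Eventually.of_forall fun i k => ?_)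
    · simp only [mul_zero, tsum_zero] at h
      exact h.congr fun i => (hv i).symm
    · have := tendsto_zpow_mul_shift_atBot hq0 hq1 hν one_pos k
      simp only [one_zpow, one_mul] at this
      simpa only [add_comm k] using this.const_mul (A k)
    · rw [Real.norm_eq_abs, abs_mul]
      exact mul_le_mul_of_nonneg_left (hM _) (abs_nonneg _)
  · have h := tendsto_tsum_of_dominated_convergence (𝓕 := atTop)
      (f := fun i k => A k * latticeBessel q ν (i + k)) (g := fun k => A k * 1)
      (hAs.mul_right M) (fun k => ?_) (Eventually.of_forall fun i k => ?_)
    · exact h.congr fun i => (hv i).symm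
    · exact ((tendsto_latticeBessel_atTop hq0 hq1 hν).comp
        (tendsto_atTop_add_const_right atTop k tendsto_id)).const_mul (A k)
    · rw [Real.norm_eq_abs, abs_mul]
      exact mul_le_mul_of_nonneg_left (hM _) (abs_nonneg _)
  -- The increments of `v` at `i` are `O(q^{2i})`, and `q^{2νi} q^{2i} = w^{2i} → 0`.
  · have h := (tendsto_zpow_atTop (pow_pos hw 2) hwsq).const_mul
      ((q ^ 2) ^ (-1 : ℤ) * K * ∑' k, (q ^ 2) ^ k * |A k|)
    rw [mul_zero] at h
    refine squeeze_zero_norm (fun i => ?_) h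
    have hs : ∀ i, Summable fun k => A k * latticeBessel q ν (i + k) := fun i =>
      summable_mul_bdd hAs fun k => hM _
    rw [hv, hv, ← (hs i).tsum_sub (hs (i - 1)), Real.norm_eq_abs, abs_mul,
      abs_of_pos (zpow_pos hg i), weightBase_sq hq0, mul_zpow]
    have hb : ∀ k, ‖A k * latticeBessel q ν (i + k) - A k * latticeBessel q ν (i - 1 + k)‖
        ≤ ((q ^ 2) ^ i * ((q ^ 2) ^ (-1 : ℤ) * K)) * ((q ^ 2) ^ k * |A k|) := fun k => by
      have h1 := hK (i - 1 + k)
      rw [show i - 1 + k + 1 = i + k by ring, show i - 1 + k = i + -1 + k by ring,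
        zpow_add₀ h3.ne', zpow_add₀ h3.ne'] at h1
      rw [← mul_sub, Real.norm_eq_abs, abs_mul]
      have h2 := mul_le_mul_of_nonneg_left h1 (abs_nonneg (A k))
      rw [show i - 1 + k = i + -1 + k by ring]
      linarith
    have h1 := tsum_of_norm_bounded ((hAs2.mul_left ((q ^ 2) ^ i * ((q ^ 2) ^ (-1 : ℤ) * K))).hasSum) hb
    rw [tsum_mul_left, Real.norm_eq_abs] at h1
    have h2 := mul_le_mul_of_nonneg_left h1 (zpow_pos hg i).le
    linarith

theorem spectralKernel_pow_nonneg (hq0 : 0 < q) (hq1 : q < 1) (hν : -1 < ν) {φ : ℤ → ℝ}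
    (hφ : ∀ k, |φ k| ≤ 1) (h : ∀ n r, 0 ≤ spectralKernel q ν φ n r) (m : ℕ) (n r : ℤ) :
    0 ≤ spectralKernel q ν (fun k => φ k ^ m) n r := by
  induction m generalizing n r with
  | zero =>
    simp only [pow_zero]
    rw [spectralKernel_one hq0 hq1 hν]
    positivity
  | succ m ih =>
    have hm : ∀ k, |φ k ^ m| ≤ 1 := fun k => by
      rw [abs_pow]
      exact pow_le_one₀ (abs_nonneg _) (hφ k)
    simp only [pow_succ]
    exact (hasSum_kernel_comp hq0 hq1 hν hm hφ n r).nonneg fun j => mul_nonneg (ih n j) (h j r)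

theorem tendsto_spectralKernel (hq0 : 0 < q) (hq1 : q < 1) (hν : -1 < ν) {ι : Type*}
    {l : Filter ι} {φ : ι → ℤ → ℝ} {ψ : ℤ → ℝ} {B : ℝ} (hφ : ∀ᶠ j in l, ∀ k, |φ j k| ≤ B)
    (hlim : ∀ k, Tendsto (fun j => φ j k) l (𝓝 (ψ k))) (n r : ℤ) :
    Tendsto (fun j => spectralKernel q ν (φ j) n r) l (𝓝 (spectralKernel q ν ψ n r)) := by
  obtain ⟨M, hM0, hM⟩ := exists_abs_le_of_summable (summable_abs_orthoBessel hq0 hq1 hν)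
  refine Tendsto.const_mul _ (tendsto_tsum_of_dominated_convergence
    (((summable_shift (summable_abs_orthoBessel hq0 hq1 hν) n).mul_left B).mul_right M)
    (fun k => ((hlim k).mul_const _).mul_const _) ?_)
  filter_upwards [hφ] with j hj k
  rw [Real.norm_eq_abs, abs_mul, abs_mul]
  have hB : 0 ≤ B := (abs_nonneg _).trans (hj k)
  exact mul_le_mul (mul_le_mul_of_nonneg_right (hj k) (abs_nonneg _)) (hM _) (abs_nonneg _)
    (by positivity)

/-- `e^{-tλ}` is the limit of `(1 + tλ/m)^{-m}`, a power of a resolvent; compositions and bounded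
pointwise limits of multipliers preserve nonnegative kernels. -/
theorem qTransition_nonneg (hq0 : 0 < q) (hq1 : q < 1) (hν : -1 < ν) (n r : ℤ) {t : ℝ}
    (ht : 0 ≤ t) : 0 ≤ qTransition q ν n r t := by
  rw [qTransition_eq hq0 hq1]
  obtain ⟨h3, h4⟩ := sq_mem hq0 hq1
  rcases ht.eq_or_lt with rfl | ht
  · simp only [neg_zero, zero_mul, Real.exp_zero]
    rw [spectralKernel_one hq0 hq1 hν]
    positivity
  have hle : ∀ (m : ℕ) (k : ℤ), |1 / (1 + t / m * (q ^ 2) ^ k)| ≤ 1 := fun m k => by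
    have : 0 ≤ t / m * (q ^ 2) ^ k := by positivity
    rw [abs_of_pos (by positivity), div_le_one (by positivity)]
    linarith
  have hlim := tendsto_spectralKernel hq0 hq1 hν (l := atTop) (B := 1)
    (φ := fun (m : ℕ) k => (1 / (1 + t / m * (q ^ 2) ^ k)) ^ m)
    (ψ := fun k => Real.exp (-t * (q ^ 2) ^ k))
    (Eventually.of_forall fun m k => by
      rw [abs_pow]; exact pow_le_one₀ (abs_nonneg _) (hle m k)) (fun k => by
      have h := (Real.tendsto_one_add_div_pow_exp (t * (q ^ 2) ^ k)).inv₀ (Real.exp_ne_zero _)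
      rw [← Real.exp_neg, ← neg_mul] at h
      refine h.congr fun m => ?_
      rw [one_div, inv_pow]
      congr 3
      ring) n r
  refine ge_of_tendsto hlim ?_
  filter_upwards [eventually_gt_atTop 0] with m hm
  have hθ : 0 < t / m := div_pos ht (by exact_mod_cast hm)
  exact spectralKernel_pow_nonneg hq0 hq1 hν (hle m)
    (fun n r => spectralKernel_resolvent_nonneg hq0 hq1 hν hθ n r) m n r

end Kernel

/-! ### Total mass and infinitesimal rates of the candidate -/

theorem hasSum_tsum_mul_shift {G H : ℤ → ℝ} {c : ℝ} (hG : Summable fun k => |G k|)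
    (hH : HasSum H c) : HasSum (fun n => ∑' k, G k * H (n + k)) ((∑' k, G k) * c) := by
  have hG' : Summable G := hG.of_abs
  have h := hG'.hasSum.mul hH (summable_mul_of_summable_norm hG'.norm hH.summable.norm)
  let e : ℤ × ℤ ≃ ℤ × ℤ :=
    { toFun := fun x => (x.2, x.1 + x.2)
      invFun := fun x => (x.2 - x.1, x.1)
      left_inv := fun x => by simp
      right_inv := fun x => by simp }
  have h3 := e.hasSum_iff.2 h
  exact h3.prod_fiberwise fun n => (h3.summable.prod_factor n).hasSum

theorem abs_exp_neg_sub_one_le {x : ℝ} (hx : 0 ≤ x) : |Real.exp (-x) - 1| ≤ x := by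
  have h1 := Real.add_one_le_exp (-x)
  have h2 : Real.exp (-x) ≤ 1 := Real.exp_le_one_iff.2 (by linarith)
  rw [abs_le]
  constructor <;> linarith

theorem abs_exp_neg_sub_one_add_le {x : ℝ} (hx : 0 ≤ x) :
    |Real.exp (-x) - 1 + x| ≤ x ^ 2 := by
  rcases le_or_gt x 1 with h | h
  · have := Real.abs_exp_sub_one_sub_id_le (x := -x) (by rwa [abs_neg, abs_of_nonneg hx])
    rwa [sub_neg_eq_add, neg_sq] at this
  · have h1 := Real.add_one_le_exp (-x)
    have h2 : Real.exp (-x) ≤ 1 := Real.exp_le_one_iff.2 (by linarith)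
    rw [abs_le]
    constructor <;> nlinarith

theorem isLittleO_of_abs_le_sq {f : ℝ → ℝ} {K : ℝ} (h : ∀ x, 0 < x → |f x| ≤ K * x ^ 2) :
    f =o[𝓝[>] 0] (fun x => x) := by
  have h1 : f =O[𝓝[>] 0] (fun x : ℝ => x ^ 2) := by
    refine Asymptotics.IsBigO.of_bound K ?_
    filter_upwards [self_mem_nhdsWithin] with x hx
    rw [Real.norm_eq_abs, Real.norm_eq_abs, abs_of_nonneg (sq_nonneg x)]
    exact h x hx
  refine h1.trans_isLittleO ?_
  have h2 : (fun x : ℝ => x ^ 2) =o[𝓝 0] (fun x : ℝ => x ^ 1) :=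
    Asymptotics.isLittleO_pow_pow one_lt_two
  simpa using h2.mono nhdsWithin_le_nhds

section HeatTransition

variable {q ν : ℝ}

theorem abs_heatMult_le (hq0 : 0 < q) {t : ℝ} (ht : 0 ≤ t) (k : ℤ) :
    |Real.exp (-t * (q ^ 2) ^ k)| ≤ 1 := by
  have : 0 ≤ t * (q ^ 2) ^ k := by positivity
  rw [abs_of_pos (Real.exp_pos _)]
  exact Real.exp_le_one_iff.2 (by linarith)

/-- Subtracting the kernel of `1`, which is `δ`, replaces the multiplier by `e^{-t q^{2k}} - 1 =
O(q^{2k})`. This makes the double series in `n` and `k` absolutely convergent, and the sum over `n`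
produces the vanishing factor `∑ w^{2m} C j(m)`. -/
theorem hasSum_qTransition_one (hq0 : 0 < q) (hq1 : q < 1) (hν : -1 < ν) (r : ℤ) {t : ℝ}
    (ht : 0 ≤ t) : HasSum (fun n => qTransition q ν n r t) 1 := by
  have hw := weightBase_pos (ν := ν) hq0
  have hC := orthoConst_pos hq0 hq1 hν
  obtain ⟨h3, h4⟩ := sq_mem hq0 hq1
  set G : ℤ → ℝ := fun k =>
    (Real.exp (-t * (q ^ 2) ^ k) - 1) * (orthoConst q ν * latticeBessel q ν (r + k)) with hG
  have hGs : Summable fun k => |G k| := by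
    refine Summable.of_nonneg_of_le (fun _ => abs_nonneg _) (fun k => ?_)
      ((summable_zpow_mul_shift hq0 hq1 hν h3 h4 r).mul_left (t * orthoConst q ν))
    have h1 := abs_exp_neg_sub_one_le (x := t * (q ^ 2) ^ k) (by positivity)
    rw [← neg_mul] at h1
    rw [hG]
    simp only
    rw [abs_mul, abs_mul, abs_of_pos hC]
    calc _ ≤ (t * (q ^ 2) ^ k) * (orthoConst q ν * |latticeBessel q ν (r + k)|) :=
          mul_le_mul_of_nonneg_right h1 (by positivity)
      _ = _ := by ring
  have hH : HasSum (fun m => weightBase q ν ^ m * orthoBessel q ν m) 0 := by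
    have h := (hasSum_sq_weight_mul hq0 hq1 hν).mul_left (orthoConst q ν)
    rw [mul_zero] at h
    refine h.congr_fun fun m => ?_
    rw [orthoBessel, sq_zpow]
    ring
  have h1 := hasSum_tsum_mul_shift hGs hH
  rw [mul_zero] at h1
  have h2 : HasSum (fun n => if n = r then (1 : ℝ) else 0) 1 := by
    have := hasSum_single (f := fun n => if n = r then (1 : ℝ) else 0) r (fun n hn => by simp [hn])
    simpa using this
  have h5 := h2.add h1
  rw [add_zero] at h5
  refine h5.congr_fun fun n => ?_
  have h6 := hasSum_kernel hq0 hq1 hν (abs_heatMult_le hq0 ht) n r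
  have h7 := hasSum_kernel (φ := fun _ => 1) hq0 hq1 hν (B := 1) (fun k => by simp) n r
  rw [spectralKernel_one hq0 hq1 hν] at h7
  have h8 := h6.sub h7
  rw [qTransition_eq hq0 hq1, ← sub_eq_iff_eq_add', ← h8.tsum_eq]
  refine tsum_congr fun k => ?_
  rw [hG, orthoBessel.eq_def q ν (r + k)]
  have hw3 : weightBase q ν ^ (n - r) * weightBase q ν ^ (r + k)
      = weightBase q ν ^ (n + k) := by rw [← zpow_add₀ hw.ne']; ring_nf
  simp only
  linear_combination ((Real.exp (-t * (q ^ 2) ^ k) - 1) * orthoBessel q ν (n + k) *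
    orthoConst q ν * latticeBessel q ν (r + k)) * hw3

/-- Termwise second order Taylor expansion: the remainder is at most `t² q^{4k}`, which is summable
against the kernel, while the linear term is the generator applied to `δ_n`. All four rate
conditions are read off from this one estimate. -/
theorem abs_qTransition_sub_le (hq0 : 0 < q) (hq1 : q < 1) (hν : -1 < ν) (n r : ℤ) :
    ∃ K : ℝ, ∀ t, 0 < t → |qTransition q ν n r t - ((if n = r then 1 else 0)
      + t * generator q ν (fun i => if n = i then 1 else 0) r)| ≤ K * t ^ 2 := by
  have hw := weightBase_pos (ν := ν) hq0
  obtain ⟨h3, h4⟩ := sq_mem hq0 hq1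
  obtain ⟨M, hM0, hM⟩ := exists_abs_le_of_summable (summable_abs_orthoBessel hq0 hq1 hν)
  have hb : (q ^ 2) ^ 2 * weightBase q ν < 1 :=
    mul_lt_one_of_nonneg_of_lt_one_left (by positivity) (pow_lt_one₀ h3.le h4 two_ne_zero)
      (weightBase_lt_one hq0 hq1 hν).le
  have hs := ((summable_zpow_mul_orthoBessel hq0 hq1 hν (b := (q ^ 2) ^ 2) (by positivity) hb
    n).mul_right M).mul_left (weightBase q ν ^ (n - r))
  refine ⟨∑' k, weightBase q ν ^ (n - r) * (((q ^ 2) ^ 2) ^ k * |orthoBessel q ν (n + k)| * M),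
    fun t ht => ?_⟩
  have h6 := hasSum_kernel hq0 hq1 hν (abs_heatMult_le hq0 ht.le) n r
  have h7 := hasSum_kernel (φ := fun _ => 1) hq0 hq1 hν (B := 1) (fun k => by simp) n r
  have h8 := hasSum_kernel_generator (φ := fun _ => 1) hq0 hq1 hν (B := 1) (fun k => by simp) n r
  have e : spectralKernel q ν (fun _ => 1) n = fun i => if n = i then 1 else 0 :=
    funext fun i => spectralKernel_one hq0 hq1 hν n i
  rw [e] at h7 h8
  have h9 := (h6.sub h7).add (h8.mul_left t)
  rw [← qTransition_eq hq0 hq1] at h9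
  have e2 : qTransition q ν n r t - ((if n = r then 1 else 0)
      + t * generator q ν (fun i => if n = i then 1 else 0) r)
      = qTransition q ν n r t - (if n = r then 1 else 0)
        + t * -generator q ν (fun i => if n = i then 1 else 0) r := by ring
  rw [e2, ← h9.tsum_eq, ← Real.norm_eq_abs]
  refine tsum_of_norm_bounded (hs.hasSum.mul_right (t ^ 2)) fun k => ?_
  have h10 := abs_exp_neg_sub_one_add_le (x := t * (q ^ 2) ^ k) (by positivity)
  rw [← neg_mul] at h10
  have e3 : weightBase q ν ^ (n - r) *
      (Real.exp (-t * (q ^ 2) ^ k) * orthoBessel q ν (n + k) * orthoBessel q ν (r + k)) -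
      weightBase q ν ^ (n - r) * (1 * orthoBessel q ν (n + k) * orthoBessel q ν (r + k)) +
      t * ((q ^ 2) ^ k * (weightBase q ν ^ (n - r) *
        (1 * orthoBessel q ν (n + k) * orthoBessel q ν (r + k))))
      = weightBase q ν ^ (n - r) * ((Real.exp (-t * (q ^ 2) ^ k) - 1 + t * (q ^ 2) ^ k)
        * orthoBessel q ν (n + k) * orthoBessel q ν (r + k)) := by ring
  rw [e3, Real.norm_eq_abs, abs_mul, abs_mul, abs_mul, abs_of_pos (zpow_pos hw _)]
  calc _ ≤ weightBase q ν ^ (n - r) * ((t * (q ^ 2) ^ k) ^ 2 * |orthoBessel q ν (n + k)| * M) := by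
        gcongr
        exact hM _
    _ = _ := by rw [sq_zpow (q ^ 2) k]; ring

theorem isTransitionFunction_qTransition (hq0 : 0 < q) (hq1 : q < 1) (hν : -1 < ν) :
    IsTransitionFunction q ν (qTransition q ν) := by
  have hrate : ∀ n r : ℤ, (fun h => qTransition q ν n r h - ((if n = r then 1 else 0)
      + h * generator q ν (fun i => if n = i then 1 else 0) r)) =o[𝓝[>] 0] (fun h => h) := by
    intro n r
    obtain ⟨K, hK⟩ := abs_qTransition_sub_le hq0 hq1 hν n r
    exact isLittleO_of_abs_le_sq hK
  constructor
  · exact fun n r t ht => qTransition_nonneg hq0 hq1 hν n r ht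
  · exact fun r t ht => hasSum_qTransition_one hq0 hq1 hν r ht
  · intro n r
    rw [qTransition_eq hq0 hq1]
    simpa using spectralKernel_one hq0 hq1 hν n r
  · intro n r t s ht hs
    have h := hasSum_kernel_comp hq0 hq1 hν (abs_heatMult_le hq0 ht) (abs_heatMult_le hq0 hs) n r
    simp only [← Real.exp_add, ← add_mul, ← neg_add] at h
    simpa only [qTransition_eq hq0 hq1] using h
  · intro i
    refine (hrate (i + 1) i).congr_left fun h => ?_
    have : i + 1 ≠ i - 1 := by omega
    simp [generator, this]
    ring
  · intro i
    refine (hrate (i - 1) i).congr_left fun h => ?_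
    have : i - 1 ≠ i + 1 := by omega
    simp [generator, this]
    ring
  · intro i
    refine (hrate i i).congr_left fun h => ?_
    have : i ≠ i - 1 := by omega
    simp [generator, this]
    ring
  · intro i j hij
    refine (hrate j i).congr_left fun h => ?_
    have h1 : j ≠ i := by rintro rfl; simp at hij
    have h2 : j ≠ i + 1 := by rintro rfl; simp at hij
    have h3 : j ≠ i - 1 := by rintro rfl; simp at hij
    simp [generator, h1, h2, h3]

end HeatTransition

/-! ### The backward equation and uniqueness for `ν ≥ 0` -/

namespace IsTransitionFunction

variable {q ν : ℝ} {p : ℤ → ℤ → ℝ → ℝ}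

theorem le_one (hp : IsTransitionFunction q ν p) (n r : ℤ) {t : ℝ} (ht : 0 ≤ t) : p n r t ≤ 1 :=
  le_hasSum (hp.hasSum_one r t ht) n fun k _ => hp.nonneg k r t ht

/-- Truncating Chapman-Kolmogorov to `s` costs at most the mass outside `s` after the short time
`h`. The bound does not depend on `t`, which makes the continuity and differentiability estimates
below uniform. -/
theorem abs_add_sub_sum_le (hp : IsTransitionFunction q ν p) (s : Finset ℤ) (n r : ℤ) {t h : ℝ}
    (ht : 0 ≤ t) (hh : 0 ≤ h) :
    |p n r (t + h) - ∑ k ∈ s, p n k t * p k r h| ≤ 1 - ∑ k ∈ s, p k r h := by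
  have h1 := hp.chapman_kolmogorov n r t h ht hh
  have h2 := (hp.hasSum_one r h hh).sub h1
  have h3 := sum_le_hasSum s
    (fun k _ => mul_nonneg (hp.nonneg n k t ht) (hp.nonneg k r h hh)) h1
  have h4 := sum_le_hasSum s
    (fun k _ => sub_nonneg.2 (mul_le_of_le_one_left (hp.nonneg k r h hh) (hp.le_one n k ht))) h2
  rw [sum_sub_distrib] at h4
  rw [abs_of_nonneg (sub_nonneg.2 h3)]
  linarith

theorem abs_add_sub_le (hp : IsTransitionFunction q ν p) (n r : ℤ) {t h : ℝ}
    (ht : 0 ≤ t) (hh : 0 ≤ h) : |p n r (t + h) - p n r t| ≤ 2 * (1 - p r r h) := by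
  have h1 := hp.abs_add_sub_sum_le {r} n r ht hh
  simp only [sum_singleton] at h1
  have h2 := hp.nonneg n r t ht
  have h3 := hp.le_one n r ht
  have h4 := hp.le_one r r hh
  rw [abs_le] at *
  constructor <;> nlinarith

theorem tendsto_diag (hp : IsTransitionFunction q ν p) (r : ℤ) :
    Tendsto (fun h => p r r h) (𝓝[>] 0) (𝓝 1) := by
  have hid : Tendsto (fun h : ℝ => h) (𝓝[>] 0) (𝓝 0) := tendsto_id.mono_left nhdsWithin_le_nhds
  have h1 := (hp.stay r).isBigO.trans_tendsto hid
  have h2 : Tendsto (fun h : ℝ => 1 - (birthRate q ν r + deathRate q r) * h) (𝓝[>] 0) (𝓝 1) := by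
    simpa using (hid.const_mul (birthRate q ν r + deathRate q r)).const_sub 1
  simpa using h1.add h2

theorem continuousOn (hp : IsTransitionFunction q ν p) (n r : ℤ) :
    ContinuousOn (p n r) (Set.Ici 0) := by
  rw [Metric.continuousOn_iff]
  intro t ht ε hε
  have h1 := (hp.tendsto_diag r).eventually_const_lt (show 1 - ε / 2 < 1 by linarith)
  obtain ⟨δ, hδ, hδ'⟩ := (mem_nhdsGT_iff_exists_Ioo_subset).1 h1
  refine ⟨δ, hδ, fun s hs hst => ?_⟩
  rw [Real.dist_eq] at *
  rcases lt_trichotomy s t with h | h | h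
  · have h2 := hp.abs_add_sub_le n r hs (sub_pos.2 h).le
    have h3 : 1 - ε / 2 < p r r (t - s) := hδ' ⟨sub_pos.2 h, by
      rw [abs_sub_comm, abs_of_pos (sub_pos.2 h)] at hst; exact hst⟩
    rw [add_sub_cancel] at h2
    rw [abs_sub_comm]
    linarith
  · simpa [h] using hε
  · have h2 := hp.abs_add_sub_le n r ht (sub_pos.2 h).le
    have h3 : 1 - ε / 2 < p r r (s - t) := hδ' ⟨sub_pos.2 h, by
      rwa [abs_of_pos (sub_pos.2 h)] at hst⟩
    rw [add_sub_cancel] at h2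
    linarith

/-- The backward equation, uniformly in time. -/
theorem eventually_abs_sub_le (hp : IsTransitionFunction q ν p) (n r : ℤ) {ε : ℝ} (hε : 0 < ε) :
    ∀ᶠ h in 𝓝[>] (0 : ℝ), ∀ t, 0 ≤ t →
      |p n r (t + h) - p n r t - h * generator q ν (fun i => p n i t) r| ≤ ε * h := by
  -- Six errors of size `ε/6`: three from replacing the short-time probabilities by their
  -- expansions, and three bounding the mass outside the three states, where the rates cancel.
  have hb := (hp.birth r).bound (show 0 < ε / 6 by positivity)
  have hd := (hp.death r).bound (show 0 < ε / 6 by positivity)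
  have hs := (hp.stay r).bound (show 0 < ε / 6 by positivity)
  filter_upwards [hb, hd, hs, self_mem_nhdsWithin] with h hb hd hs hh t ht
  have hh : 0 < h := hh
  have h1 := hp.abs_add_sub_sum_le {r + 1, r - 1, r} n r ht hh.le
  rw [sum_insert (by simp; omega), sum_insert (by simp), sum_singleton,
    sum_insert (by simp; omega), sum_insert (by simp), sum_singleton] at h1
  rw [Real.norm_eq_abs, Real.norm_eq_abs, abs_of_pos hh] at hb hd hs
  have hmul : ∀ k x, |x| ≤ ε / 6 * h → |p n k t * x| ≤ ε / 6 * h := fun k x hx => by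
    rw [abs_mul, abs_of_nonneg (hp.nonneg n k t ht)]
    exact (mul_le_of_le_one_left (abs_nonneg _) (hp.le_one n k ht)).trans hx
  have hb' := hmul (r + 1) _ hb
  have hd' := hmul (r - 1) _ hd
  have hs' := hmul r _ hs
  simp only [generator]
  rw [abs_le] at *
  constructor <;> nlinarith

/-- Left of zero only deaths increase `|i|`, and their rate is at most `1`. Right of zero the value
is `λ_i - μ_i`, which is nonpositive exactly because `ν ≥ 0`. -/
theorem generator_abs_le (hq0 : 0 < q) (hq1 : q < 1) (hν : 0 ≤ ν) (i : ℤ) :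
    generator q ν (fun i => |(i : ℝ)|) i ≤ birthRate q ν 0 + deathRate q 0 + 1 := by
  obtain ⟨h3, h4⟩ := sq_mem hq0 hq1
  have hb := birthRate_pos (ν := ν) hq0 i
  have hd := deathRate_pos hq0 i
  have hb0 := birthRate_pos (ν := ν) hq0 0
  have hd0 := deathRate_pos hq0 0
  simp only [generator]
  push_cast
  rcases lt_trichotomy i 0 with hi | rfl | hi
  · have hi' : (i : ℝ) ≤ -1 := by exact_mod_cast (by omega : i ≤ -1)
    rw [abs_of_neg (by linarith : (i : ℝ) < 0), abs_of_nonpos (by linarith : (i : ℝ) + 1 ≤ 0),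
      abs_of_neg (by linarith : (i : ℝ) - 1 < 0)]
    have : deathRate q i ≤ 1 := by
      obtain ⟨m, rfl⟩ : ∃ m : ℕ, i = -(m : ℤ) := ⟨(-i).toNat, by omega⟩
      rw [deathRate_eq, zpow_neg, inv_inv, zpow_natCast]
      exact pow_le_one₀ h3.le h4.le
    linarith
  · simp only [Int.cast_zero, abs_zero, zero_add, zero_sub, abs_neg, abs_one]
    linarith
  · have hi' : (1 : ℝ) ≤ i := by exact_mod_cast hi
    rw [abs_of_pos (by linarith : (0 : ℝ) < i), abs_of_pos (by linarith : (0 : ℝ) < (i : ℝ) + 1),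
      abs_of_nonneg (by linarith : (0 : ℝ) ≤ (i : ℝ) - 1)]
    have : birthRate q ν i ≤ deathRate q i := by
      rw [birthRate_eq hq0, deathRate_eq]
      exact mul_le_of_le_one_left (by positivity) (Real.rpow_le_one hq0.le hq1.le (by linarith))
    linarith

theorem le_of_nonneg (hq0 : 0 < q) (hq1 : q < 1) (hν : 0 ≤ ν) {p' : ℤ → ℤ → ℝ → ℝ}
    (hp : IsTransitionFunction q ν p) (hp' : IsTransitionFunction q ν p') (n r : ℤ) {t : ℝ}
    (ht : 0 ≤ t) : p n r t ≤ p' n r t := by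
  set K := birthRate q ν 0 + deathRate q 0 + 1
  have hK : 0 < K := by
    have h1 := birthRate_pos (ν := ν) hq0 0
    have h2 := deathRate_pos hq0 0
    simp only [K]; linarith
  set w : ℤ → ℝ → ℝ := fun i s => p n i s - p' n i s with hw
  have hw1 : ∀ i s, 0 ≤ s → w i s ≤ 1 := fun i s hs => by
    have := hp.le_one n i hs
    have := hp'.nonneg n i s hs
    simp only [hw]; linarith
  have hwc : ∀ i, ContinuousOn (w i) (Set.Ici 0) := fun i =>
    (hp.continuousOn n i).sub (hp'.continuousOn n i)
  suffices h : ∀ ε > 0, w r t ≤ ε * (|(r : ℝ)| + (K + 1) * t) by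
    have hlim : Tendsto (fun ε : ℝ => ε * (|(r : ℝ)| + (K + 1) * t)) (𝓝[>] 0) (𝓝 0) := by
      have : Tendsto (fun ε : ℝ => ε * (|(r : ℝ)| + (K + 1) * t)) (𝓝 0) (𝓝 (0 * _)) :=
        tendsto_id.mul_const _
      rw [zero_mul] at this
      exact this.mono_left nhdsWithin_le_nhds
    have h1 : w r t ≤ 0 := ge_of_tendsto hlim (by
      filter_upwards [self_mem_nhdsWithin] with ε hε using h ε hε)
    simp only [hw] at h1
    linarith
  intro ε hε
  by_contra! hcon
  -- The term `ε |i|` makes `z` nonpositive once `|i| ≥ N > 1/ε`, since `w ≤ 1`, so a positive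
  -- maximum is attained. The term `ε (K+1) s` makes the inequality at the maximum strict.
  set z : ℤ → ℝ → ℝ := fun i s => w i s - ε * (|(i : ℝ)| + (K + 1) * s) with hz
  have hzc : ∀ i, ContinuousOn (z i) (Set.Icc 0 t) := fun i =>
    ((hwc i).mono Set.Icc_subset_Ici_self).sub (by fun_prop)
  have hmaxt : ∀ i, ∃ s ∈ Set.Icc 0 t, ∀ s' ∈ Set.Icc 0 t, z i s' ≤ z i s := fun i =>
    isCompact_Icc.exists_isMaxOn ⟨0, by simp [ht]⟩ (hzc i)
  choose τ hτ hτmax using hmaxt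
  obtain ⟨N, hN⟩ := exists_nat_gt (1 / ε)
  have hzr : 0 < z r t := by simp only [hz]; linarith
  obtain ⟨m, -, hm⟩ := exists_max_image (Icc (min r (-N)) (max r N)) (fun i => z i (τ i))
    ⟨r, by simp⟩
  have hzm : 0 < z m (τ m) :=
    hzr.trans_le ((hτmax r t ⟨ht, le_rfl⟩).trans (hm r (by simp)))
  have hmax : ∀ i, ∀ s ∈ Set.Icc 0 t, z i s ≤ z m (τ m) := fun i s hs => by
    by_cases hi : i ∈ Icc (min r (-N : ℤ)) (max r N)
    · exact (hτmax i s hs).trans (hm i hi)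
    · have hiN : (N : ℝ) ≤ |(i : ℝ)| := by
        rw [mem_Icc, not_and_or, not_le, not_le] at hi
        have : (N : ℤ) ≤ |i| := by
          rcases hi with hi | hi
          · have := hi.trans_le (min_le_right _ _)
            rw [abs_of_nonpos (by omega)]
            omega
          · have := (le_max_right _ _).trans_lt hi
            rw [abs_of_nonneg (by omega)]
            omega
        exact_mod_cast this
      have h1 : 1 < ε * |(i : ℝ)| := by
        rw [div_lt_iff₀ hε] at hN
        nlinarith
      have h2 := hw1 i s hs.1
      have h3 : 0 ≤ ε * ((K + 1) * s) := mul_nonneg hε.le (mul_nonneg (by linarith) hs.1)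
      have : z i s ≤ 0 := by simp only [hz]; linarith
      exact this.trans hzm.le
  set s := τ m
  have hs := hτ m
  have hs0 : 0 < s := by
    refine lt_of_le_of_ne hs.1 fun h => ?_
    have h1 : w m 0 = 0 := by simp only [hw]; rw [hp.initial, hp'.initial, sub_self]
    have h2 : 0 < z m s := hzm
    simp only [hz] at h2
    rw [← h, h1] at h2
    have : 0 ≤ ε * |(m : ℝ)| := by positivity
    linarith
  have hGs : generator q ν (fun i => w i s) m ≤ ε * K := by
    have hG := generator_abs_le hq0 hq1 hν m
    have h1 := hmax (m + 1) s hs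
    have h2 := hmax (m - 1) s hs
    have hb := birthRate_pos (ν := ν) hq0 m
    have hd := deathRate_pos hq0 m
    have h3 : w (m + 1) s - w m s ≤ ε * (|((m + 1 : ℤ) : ℝ)| - |(m : ℝ)|) := by
      have h1 : z (m + 1) s ≤ z m s := h1
      simp only [hz] at h1; linarith
    have h4 : w (m - 1) s - w m s ≤ ε * (|((m - 1 : ℤ) : ℝ)| - |(m : ℝ)|) := by
      have h2 : z (m - 1) s ≤ z m s := h2
      simp only [hz] at h2; linarith
    have h5 := mul_le_mul_of_nonneg_left h3 hb.le
    have h6 := mul_le_mul_of_nonneg_left h4 hd.le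
    have h7 := mul_le_mul_of_nonneg_left hG hε.le
    simp only [generator] at h7 ⊢
    linarith
  have hGc : Tendsto (fun h => generator q ν (fun i => w i (s - h)) m) (𝓝[>] 0)
      (𝓝 (generator q ν (fun i => w i s) m)) := by
    have hc : ∀ i, Tendsto (fun h => w i (s - h)) (𝓝[>] 0) (𝓝 (w i s)) := fun i => by
      have h1 : ContinuousAt (w i) s := (hwc i).continuousAt (Ici_mem_nhds hs0)
      have h2 : Tendsto (fun h : ℝ => s - h) (𝓝[>] 0) (𝓝 s) := by
        have : Tendsto (fun h : ℝ => s - h) (𝓝 0) (𝓝 (s - 0)) := tendsto_id.const_sub s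
        rw [sub_zero] at this
        exact this.mono_left nhdsWithin_le_nhds
      exact h1.tendsto.comp h2
    exact (((hc _).sub (hc _)).const_mul _).add (((hc _).sub (hc _)).const_mul _)
  -- The backward estimate is used from `s - h` to `s`. Maximality gives an increase of `w m` of at
  -- least `ε (K+1) h`, while the equations allow less than `ε K h + ε h / 2 + 2 (ε/8) h`.
  have hev := hGc.eventually_lt_const (show _ < ε * K + ε / 2 by linarith)
  have h1 := hp.eventually_abs_sub_le n m (show 0 < ε / 8 by positivity)
  have h2 := hp'.eventually_abs_sub_le n m (show 0 < ε / 8 by positivity)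
  have h3 : ∀ᶠ h in 𝓝[>] (0 : ℝ), h < s := nhdsWithin_le_nhds (gt_mem_nhds hs0)
  obtain ⟨h, hev, h1, h2, h3, hpos⟩ :=
    (hev.and (h1.and (h2.and (h3.and self_mem_nhdsWithin)))).exists
  have hpos : 0 < h := hpos
  have h1 := (abs_le.1 (h1 (s - h) (by linarith))).2
  have h2 := (abs_le.1 (h2 (s - h) (by linarith))).1
  rw [sub_add_cancel] at h1 h2
  have h4 : z m (s - h) ≤ z m s := hmax m (s - h) ⟨by linarith, by linarith [hs.2]⟩
  have h5 := mul_lt_mul_of_pos_left hev hpos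
  simp only [hz, hw, generator] at *
  nlinarith

theorem eq_of_nonneg (hq0 : 0 < q) (hq1 : q < 1) (hν : 0 ≤ ν) {p' : ℤ → ℤ → ℝ → ℝ}
    (hp : IsTransitionFunction q ν p) (hp' : IsTransitionFunction q ν p') (n r : ℤ) {t : ℝ}
    (ht : 0 ≤ t) : p n r t = p' n r t :=
  le_antisymm (hp.le_of_nonneg hq0 hq1 hν hp' n r ht) (hp'.le_of_nonneg hq0 hq1 hν hp n r ht)

end IsTransitionFunction

/-! ### Volterra equations -/

section Volterra

theorem integral_exp_neg_mul_le {l t : ℝ} (hl : 0 < l) :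
    ∫ v in (0 : ℝ)..t, Real.exp (-(l * v)) ≤ 1 / l := by
  have h : ∀ v ∈ Set.uIcc 0 t, HasDerivAt (fun v => -(Real.exp (-(l * v)) / l))
      (Real.exp (-(l * v))) v := fun v _ => by
    have h1 : HasDerivAt (fun v : ℝ => -(l * v)) (-(l * 1)) v :=
      ((hasDerivAt_id v).const_mul l).neg
    have h2 := (h1.exp.div_const l).neg
    exact h2.congr_deriv (by rw [mul_one, mul_neg, neg_div, neg_neg, mul_div_cancel_right₀ _ hl.ne'])
  rw [intervalIntegral.integral_eq_sub_of_hasDerivAt h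
    (Continuous.intervalIntegrable (by fun_prop) _ _)]
  have : 0 < Real.exp (-(l * t)) / l := by positivity
  simp only [mul_zero, neg_zero, Real.exp_zero]
  linarith

/-- Comparison principle for the Volterra inequality `y ≥ a * y`. -/
theorem nonneg_of_volterra {a y : ℝ → ℝ} {B Y T : ℝ} (ha0 : ∀ t, 0 ≤ a t) (haB : ∀ t, a t ≤ B)
    (hY : ∀ t ∈ Set.Icc 0 T, -Y ≤ y t) (hY0 : 0 ≤ Y)
    (h : ∀ t ∈ Set.Icc 0 T, ∫ v in (0 : ℝ)..t, a v * y (t - v) ≤ y t) :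
    ∀ t ∈ Set.Icc 0 T, 0 ≤ y t := by
  have hB : 0 ≤ B := (ha0 0).trans (haB 0)
  -- With this exponent `B ∫ e^{-lv} dv ≤ B / l ≤ 1/2`, so each iteration halves the lower bound in
  -- the norm weighted by `e^{-lt}`.
  set l := 2 * B + 1 with hl
  have hl0 : 0 < l := by linarith
  have key : ∀ m : ℕ, ∀ t ∈ Set.Icc 0 T, -(Y * Real.exp (l * t) / 2 ^ m) ≤ y t := fun m => by
    induction m with
    | zero =>
      intro t ht
      have h1 : 1 ≤ Real.exp (l * t) := Real.one_le_exp (mul_nonneg hl0.le ht.1)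
      have := hY t ht
      simp only [pow_zero, div_one]
      nlinarith
    | succ m ih =>
      intro t ht
      have hneg : 0 ≤ Y * Real.exp (l * t) / 2 ^ (m + 1) := by positivity
      -- Without integrability the integral has the default value `0`, and the hypothesis itself
      -- reads `0 ≤ y t`.
      by_cases hint : IntervalIntegrable (fun v => a v * y (t - v)) volume 0 t
      · refine le_trans ?_ (h t ht)
        have h1 : ∫ v in (0 : ℝ)..t, -(B * (Y * Real.exp (l * t) / 2 ^ m)) * Real.exp (-(l * v))
            ≤ ∫ v in (0 : ℝ)..t, a v * y (t - v) := by
          refine intervalIntegral.integral_mono_on ht.1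
            (Continuous.intervalIntegrable (by fun_prop) _ _) hint fun v hv => ?_
          have h2 := ih (t - v) ⟨by linarith [hv.2], by linarith [hv.1, ht.2]⟩
          have h3 : Real.exp (l * (t - v)) = Real.exp (l * t) * Real.exp (-(l * v)) := by
            rw [← Real.exp_add]; ring_nf
          rw [h3] at h2
          have h4 := mul_le_mul_of_nonneg_left h2 (ha0 v)
          have h5 : 0 ≤ Y * (Real.exp (l * t) * Real.exp (-(l * v))) / 2 ^ m := by positivity
          have h6 := mul_le_mul_of_nonneg_right (haB v) h5
          refine le_trans ?_ h4
          rw [mul_neg]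
          refine le_trans (le_of_eq ?_) (neg_le_neg h6)
          ring
        rw [intervalIntegral.integral_const_mul] at h1
        refine le_trans ?_ h1
        have h7 := integral_exp_neg_mul_le (t := t) hl0
        have h8 : 0 ≤ B * (Y * Real.exp (l * t) / 2 ^ m) := by positivity
        have h9 := mul_le_mul_of_nonneg_left h7 h8
        have h10 : B * (Y * Real.exp (l * t) / 2 ^ m) * (1 / l)
            ≤ Y * Real.exp (l * t) / 2 ^ (m + 1) := by
          have h11 : B * (1 / l) ≤ 1 / 2 := by
            rw [mul_one_div, div_le_iff₀ hl0]; linarith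
          have h12 : 0 ≤ Y * Real.exp (l * t) / 2 ^ m := by positivity
          calc _ = B * (1 / l) * (Y * Real.exp (l * t) / 2 ^ m) := by ring
            _ ≤ 1 / 2 * (Y * Real.exp (l * t) / 2 ^ m) := mul_le_mul_of_nonneg_right h11 h12
            _ = _ := by rw [pow_succ]; ring
        linarith
      · have := h t ht
        rw [intervalIntegral.integral_undef hint] at this
        linarith
  intro t ht
  have hlim : Tendsto (fun m : ℕ => -(Y * Real.exp (l * t) / 2 ^ m)) atTop (𝓝 0) := by
    have h1 : Tendsto (fun m : ℕ => -(Y * Real.exp (l * t)) * (1 / 2) ^ m) atTop (𝓝 (_ * 0)) :=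
      (tendsto_pow_atTop_nhds_zero_of_lt_one (by norm_num) (by norm_num)).const_mul _
    rw [mul_zero] at h1
    refine h1.congr fun m => ?_
    rw [one_div, inv_pow]
    ring
  exact le_of_tendsto' hlim fun m => key m t ht

theorem eq_zero_of_volterra {a y : ℝ → ℝ} {B Y T : ℝ} (ha0 : ∀ t, 0 ≤ a t) (haB : ∀ t, a t ≤ B)
    (hY : ∀ t ∈ Set.Icc 0 T, |y t| ≤ Y) (hY0 : 0 ≤ Y)
    (h : ∀ t ∈ Set.Icc 0 T, ∫ v in (0 : ℝ)..t, a v * y (t - v) = y t) :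
    ∀ t ∈ Set.Icc 0 T, y t = 0 := by
  intro t ht
  have h1 := nonneg_of_volterra ha0 haB (fun t ht => (abs_le.1 (hY t ht)).1) hY0
    (fun t ht => (h t ht).le) t ht
  have h2 := nonneg_of_volterra (y := fun t => -y t) ha0 haB
    (fun t ht => neg_le_neg (abs_le.1 (hY t ht)).2) hY0 (fun t ht => by
      simp only [mul_neg, intervalIntegral.integral_neg]
      rw [h t ht]) t ht
  linarith

/-- Banach's fixed point theorem for `e^{-lt} g(t)` in the space of bounded continuous functions.
Clamping time to `max t 0` gives functions on the whole line. -/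
theorem exists_volterra {a b : ℝ → ℝ} {B M : ℝ} (ha : Continuous a) (hb : Continuous b)
    (ha0 : ∀ t, 0 ≤ a t) (haB : ∀ t, a t ≤ B) (hbM : ∀ t, |b t| ≤ M) :
    ∃ g : ℝ → ℝ, Continuous g ∧ (∀ t, g t = g (max t 0)) ∧
      ∀ t, 0 ≤ t → g t = b t + ∫ v in (0 : ℝ)..t, a v * g (t - v) := by
  have hB : 0 ≤ B := (ha0 0).trans (haB 0)
  have hM : 0 ≤ M := (abs_nonneg _).trans (hbM 0)
  set l := 2 * B + 1 with hl
  have hl0 : 0 < l := by linarith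
  have hBl : B * (1 / l) ≤ 1 / 2 := by rw [mul_one_div, div_le_iff₀ hl0]; linarith
  have hbound : ∀ (G : ℝ → ℝ) (K s : ℝ), 0 ≤ s → (∀ t, |G t| ≤ K) →
      |∫ v in (0 : ℝ)..s, a v * Real.exp (-(l * v)) * G (s - v)| ≤ 1 / 2 * K := by
    intro G K s hs hG
    have hK : 0 ≤ K := (abs_nonneg _).trans (hG 0)
    have h1 := intervalIntegral.norm_integral_le_of_norm_le (μ := volume) hs
      (f := fun v => a v * Real.exp (-(l * v)) * G (s - v))
      (g := fun v => (B * K) * Real.exp (-(l * v)))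
      (Eventually.of_forall fun v _ => by
        rw [Real.norm_eq_abs, abs_mul, abs_mul, abs_of_nonneg (ha0 v),
          abs_of_pos (Real.exp_pos _)]
        have := haB v
        have := hG (s - v)
        calc _ ≤ B * Real.exp (-(l * v)) * K := by gcongr
          _ = B * K * Real.exp (-(l * v)) := by ring)
      (Continuous.intervalIntegrable (by fun_prop) _ _)
    rw [intervalIntegral.integral_const_mul, Real.norm_eq_abs] at h1
    refine h1.trans ?_
    have h2 := mul_le_mul_of_nonneg_left (integral_exp_neg_mul_le (t := s) hl0)
      (mul_nonneg hB hK)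
    nlinarith
  have hcont : ∀ G : ℝ → ℝ, Continuous G → Continuous fun t : ℝ =>
      Real.exp (-(l * max t 0)) * b (max t 0)
        + ∫ v in (0 : ℝ)..(max t 0), a v * Real.exp (-(l * v)) * G (max t 0 - v) := by
    intro G hG
    refine Continuous.add (by fun_prop) ?_
    refine intervalIntegral.continuous_parametric_intervalIntegral_of_continuous ?_ (by fun_prop)
    simp only [Function.uncurry_def]
    fun_prop
  have hbd : ∀ (G : ℝ → ℝ) (K : ℝ), (∀ t, |G t| ≤ K) → ∀ t : ℝ,
      ‖Real.exp (-(l * max t 0)) * b (max t 0)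
        + ∫ v in (0 : ℝ)..(max t 0), a v * Real.exp (-(l * v)) * G (max t 0 - v)‖
        ≤ M + 1 / 2 * K := by
    intro G K hG t
    have ht : 0 ≤ max t 0 := le_max_right _ _
    refine (norm_add_le _ _).trans (add_le_add ?_ (hbound G K _ ht hG))
    rw [Real.norm_eq_abs, abs_mul, abs_of_pos (Real.exp_pos _)]
    refine (mul_le_of_le_one_left (abs_nonneg _) ?_).trans (hbM _)
    exact Real.exp_le_one_iff.2 (by have := mul_nonneg hl0.le ht; linarith)
  let Φ : BoundedContinuousFunction ℝ ℝ → BoundedContinuousFunction ℝ ℝ := fun G =>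
    BoundedContinuousFunction.ofNormedAddCommGroup _ (hcont G G.continuous) _
      (hbd G ‖G‖ fun t => G.norm_coe_le_norm t)
  have hΦ : ContractingWith (1 / 2) Φ := by
    refine ⟨by rw [← NNReal.coe_lt_coe]; norm_num, LipschitzWith.of_dist_le_mul fun G G' => ?_⟩
    rw [BoundedContinuousFunction.dist_le (by positivity)]
    intro t
    simp only [Φ, BoundedContinuousFunction.coe_ofNormedAddCommGroup]
    have ht : 0 ≤ max t 0 := le_max_right _ _
    rw [Real.dist_eq, add_sub_add_left_eq_sub, ← intervalIntegral.integral_sub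
      (Continuous.intervalIntegrable (by fun_prop) _ _)
      (Continuous.intervalIntegrable (by fun_prop) _ _)]
    have h1 := hbound (fun t => G t - G' t) (dist G G') (max t 0) ht fun t =>
      (Real.dist_eq (G t) (G' t)).symm.le.trans (BoundedContinuousFunction.dist_coe_le_dist t)
    simp only [mul_sub] at h1
    simpa using h1
  obtain ⟨G, hG⟩ : ∃ G, Φ G = G := ⟨_, hΦ.fixedPoint_isFixedPt⟩
  have hG' : ∀ t, G t = Real.exp (-(l * max t 0)) * b (max t 0)
        + ∫ v in (0 : ℝ)..(max t 0), a v * Real.exp (-(l * v)) * G (max t 0 - v) := fun t => by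
    conv_lhs => rw [← hG]
    rfl
  have hmax : ∀ t : ℝ, max (max t 0) 0 = max t 0 := fun t => by simp
  refine ⟨fun t => Real.exp (l * max t 0) * G t, by fun_prop, fun t => ?_, fun t ht => ?_⟩
  · simp only [hmax]
    rw [hG' t, hG' (max t 0), hmax]
  · simp only
    rw [hG' t, max_eq_left ht, mul_add, ← mul_assoc, ← Real.exp_add, add_neg_cancel, Real.exp_zero,
      one_mul, ← intervalIntegral.integral_const_mul]
    congr 1
    refine intervalIntegral.integral_congr fun v hv => ?_
    rw [Set.uIcc_of_le ht] at hv
    have h1 : max (t - v) 0 = t - v := max_eq_left (by linarith [hv.2])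
    simp only [h1]
    have h2 : Real.exp (l * (t - v)) = Real.exp (l * t) * Real.exp (-(l * v)) := by
      rw [← Real.exp_add]; ring_nf
    rw [h2]
    ring

/-- Termwise integration of a series of nonnegative continuous functions. -/
theorem hasSum_integral_of_nonneg {F : ℤ → ℝ → ℝ} {M t : ℝ} (ht : 0 ≤ t)
    (hF : ∀ n, Continuous (F n)) (h0 : ∀ n, ∀ v ∈ Set.Ioc 0 t, 0 ≤ F n v)
    (hM : ∀ v ∈ Set.Ioc 0 t, ∀ s : Finset ℤ, ∑ n ∈ s, F n v ≤ M) :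
    HasSum (fun n => ∫ v in (0 : ℝ)..t, F n v) (∫ v in (0 : ℝ)..t, ∑' n, F n v) := by
  simp only [intervalIntegral.integral_of_le ht]
  have hint : ∀ n, Integrable (F n) (volume.restrict (Set.Ioc 0 t)) := fun n =>
    ((hF n).integrableOn_Icc).mono_set Set.Ioc_subset_Icc_self
  have hn : ∀ n, ∫ v in Set.Ioc 0 t, ‖F n v‖ = ∫ v in Set.Ioc 0 t, F n v := fun n =>
    setIntegral_congr_fun measurableSet_Ioc fun v hv => by
      rw [Real.norm_eq_abs, abs_of_nonneg (h0 n v hv)]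
  refine hasSum_integral_of_summable_integral_norm hint ?_
  simp_rw [hn]
  refine summable_of_sum_le (c := ∫ v in Set.Ioc 0 t, M)
    (fun n => setIntegral_nonneg measurableSet_Ioc (h0 n)) fun s => ?_
  rw [← integral_finsetSum s fun n _ => hint n]
  exact setIntegral_mono_on (integrable_finsetSum s fun n _ => hint n)
    (integrableOn_const (by simp)) measurableSet_Ioc fun v hv => hM v hv s

end Volterra

/-- A substochastic transition function `f` with the rates of the birth and death process, whose
defect from `r` has the density `a r`: the law of the explosion time. -/
structure IsExitSystem (q ν : ℝ) (f : ℤ → ℤ → ℝ → ℝ) (a : ℤ → ℝ → ℝ) : Prop where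
  cont : ∀ n r, Continuous (f n r)
  cont_exit : ∀ r, Continuous (a r)
  nonneg : ∀ n r t, 0 ≤ f n r t
  le_one : ∀ n r t, f n r t ≤ 1
  exit_nonneg : ∀ r t, 0 ≤ a r t
  exit_bdd : ∀ r, ∃ B, ∀ t, a r t ≤ B
  hasSum_mass : ∀ r t, 0 ≤ t → HasSum (fun n => f n r t) (1 - ∫ v in (0 : ℝ)..t, a r v)
  initial : ∀ n r, f n r 0 = if n = r then 1 else 0
  chapman_kolmogorov : ∀ n r t s, 0 ≤ t → 0 ≤ s →
    HasSum (fun k => f n k t * f k r s) (f n r (t + s))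
  exit_law : ∀ r t s, 0 < t → 0 ≤ s → HasSum (fun k => f k r s * a k t) (a r (s + t))
  birth : ∀ i, (fun h => f (i + 1) i h - birthRate q ν i * h) =o[𝓝[>] 0] (fun h => h)
  death : ∀ i, (fun h => f (i - 1) i h - deathRate q i * h) =o[𝓝[>] 0] (fun h => h)
  stay : ∀ i, (fun h => f i i h - (1 - (birthRate q ν i + deathRate q i) * h))
    =o[𝓝[>] 0] (fun h => h)

/-- The transition function from `c` of the process that is restarted at `c` at each explosion. -/
structure IsRestart (f : ℤ → ℤ → ℝ → ℝ) (a : ℤ → ℝ → ℝ) (c : ℤ) (g : ℤ → ℝ → ℝ) : Prop where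
  cont : ∀ n, Continuous (g n)
  eq_max : ∀ n t, g n t = g n (max t 0)
  volterra : ∀ n t, 0 ≤ t → g n t = f n c t + ∫ v in (0 : ℝ)..t, a c v * g n (t - v)

/-- The transition function of the process that is restarted at each explosion. -/
def restartTransition (f : ℤ → ℤ → ℝ → ℝ) (a : ℤ → ℝ → ℝ) (g : ℤ → ℝ → ℝ) (n r : ℤ) (t : ℝ) : ℝ :=
  f n r t + ∫ v in (0 : ℝ)..t, a r v * g n (t - v)

/-! ### Restarting an explosive process: the renewal construction -/

namespace IsExitSystem

variable {q ν : ℝ} {f : ℤ → ℤ → ℝ → ℝ} {a : ℤ → ℝ → ℝ} {c : ℤ} {g : ℤ → ℝ → ℝ}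

theorem exists_isRestart (H : IsExitSystem q ν f a) (c : ℤ) : ∃ g, IsRestart f a c g := by
  obtain ⟨B, hB⟩ := H.exit_bdd c
  choose g h1 h2 h3 using fun n => exists_volterra (H.cont_exit c) (H.cont n c) (H.exit_nonneg c) hB
    (M := 1) fun t => by rw [abs_of_nonneg (H.nonneg n c t)]; exact H.le_one n c t
  exact ⟨g, h1, h2, h3⟩

theorem intervalIntegrable_exit_mul (H : IsExitSystem q ν f a) (r : ℤ) {y : ℝ → ℝ} {Y : ℝ}
    (hy : Measurable y) (hY : ∀ t, |y t| ≤ Y) (x s t : ℝ) :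
    IntervalIntegrable (fun v => a r v * y (x - v)) volume s t := by
  obtain ⟨B, hB⟩ := H.exit_bdd r
  rw [intervalIntegrable_iff]
  have hfin : volume (Set.uIoc s t) ≠ ⊤ := by simp [Set.uIoc]
  refine Measure.integrableOn_of_bounded (M := B * Y) hfin
    ((H.cont_exit r).measurable.mul (hy.comp (by fun_prop))).aestronglyMeasurable
    (Eventually.of_forall fun v => ?_)
  rw [Real.norm_eq_abs, abs_mul, abs_of_nonneg (H.exit_nonneg r v)]
  exact mul_le_mul (hB v) (hY _) (abs_nonneg _) ((H.exit_nonneg r 0).trans (hB 0))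

section Restart

variable (H : IsExitSystem q ν f a) (hg : IsRestart f a c g)
include H hg

theorem restart_nonneg (n : ℤ) (t : ℝ) : 0 ≤ g n t := by
  rw [hg.eq_max]
  obtain ⟨B, hB⟩ := H.exit_bdd c
  obtain ⟨Y, hY⟩ := (isCompact_Icc (a := (0 : ℝ)) (b := max t 0)).exists_bound_of_continuousOn
    (hg.cont n).continuousOn
  refine nonneg_of_volterra (Y := max Y 0) (T := max t 0) (H.exit_nonneg c) hB
    (fun s hs => ?_) (le_max_right _ _) (fun s hs => ?_) _ ⟨le_max_right _ _, le_rfl⟩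
  · have := (abs_le.1 (hY s hs)).1
    have := le_max_left Y 0
    linarith
  · have := hg.volterra n s hs.1
    have := H.nonneg n c s
    linarith

theorem sum_restart_le_one (s : Finset ℤ) (t : ℝ) : ∑ n ∈ s, g n t ≤ 1 := by
  have e : ∑ n ∈ s, g n t = ∑ n ∈ s, g n (max t 0) := sum_congr rfl fun n _ => hg.eq_max n t
  rw [e]
  obtain ⟨B, hB⟩ := H.exit_bdd c
  have hcont : Continuous fun t => 1 - ∑ n ∈ s, g n t :=
    continuous_const.sub (continuous_finsetSum s fun n _ => hg.cont n)
  obtain ⟨Y, hY⟩ := (isCompact_Icc (a := (0 : ℝ)) (b := max t 0)).exists_bound_of_continuousOn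
    hcont.continuousOn
  have h := nonneg_of_volterra (y := fun t => 1 - ∑ n ∈ s, g n t) (Y := max Y 0) (T := max t 0)
    (H.exit_nonneg c) hB
    (fun x hx => ?_) (le_max_right _ _) (fun x hx => ?_) _ ⟨le_max_right _ _, le_rfl⟩
  · linarith
  · have := (abs_le.1 (hY x hx)).1
    have := le_max_left Y 0
    linarith
  · have hi : ∀ n, IntervalIntegrable (fun v => a c v * g n (x - v)) volume 0 x := fun n =>
      Continuous.intervalIntegrable
        ((H.cont_exit c).mul ((hg.cont n).comp (by fun_prop))) _ _
    have hc : Continuous fun v => ∑ n ∈ s, a c v * g n (x - v) :=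
      continuous_finsetSum s fun n _ =>
        (H.cont_exit c).mul ((hg.cont n).comp (continuous_const.sub continuous_id))
    simp only [mul_sub, mul_one, mul_sum]
    rw [intervalIntegral.integral_sub ((H.cont_exit c).intervalIntegrable _ _)
      (hc.intervalIntegrable _ _),
      intervalIntegral.integral_finsetSum fun n _ => hi n]
    have h1 : ∑ n ∈ s, g n x = ∑ n ∈ s, f n c x
        + ∑ n ∈ s, ∫ v in (0 : ℝ)..x, a c v * g n (x - v) := by
      rw [← sum_add_distrib]
      exact sum_congr rfl fun n _ => hg.volterra n x hx.1
    have h2 := sum_le_hasSum s (fun n _ => H.nonneg n c x) (H.hasSum_mass c x hx.1)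
    rw [h1]
    linarith

theorem summable_restart (t : ℝ) : Summable fun n => g n t :=
  summable_of_sum_le (fun n => H.restart_nonneg hg n t) fun s => H.sum_restart_le_one hg s t

theorem tsum_restart_le_one (t : ℝ) : ∑' n, g n t ≤ 1 :=
  (H.summable_restart hg t).tsum_le_of_sum_le fun s => H.sum_restart_le_one hg s t

/-- Interchange of the sum over states with the renewal integral. It is applied with weights `1` for
total masses and with transition probabilities for Chapman-Kolmogorov. Boundedness and measurability
of the series suffice for the Volterra uniqueness argument; its continuity is not needed. -/
theorem weighted_restart {w : ℤ → ℝ} (hw0 : ∀ n, 0 ≤ w n) (hw1 : ∀ n, w n ≤ 1) :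
    Measurable (fun t => ∑' n, w n * g n t) ∧ (∀ t, Summable fun n => w n * g n t) ∧
    (∀ t, |∑' n, w n * g n t| ≤ 1) ∧ ∀ r t, 0 ≤ t →
      HasSum (fun n => w n * ∫ v in (0 : ℝ)..t, a r v * g n (t - v))
        (∫ v in (0 : ℝ)..t, a r v * ∑' n, w n * g n (t - v)) := by
  have hs : ∀ t, Summable fun n => w n * g n t := fun t =>
    Summable.of_nonneg_of_le (fun n => mul_nonneg (hw0 n) (H.restart_nonneg hg n t))
      (fun n => mul_le_of_le_one_left (H.restart_nonneg hg n t) (hw1 n)) (H.summable_restart hg t)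
  refine ⟨Measurable.tsum fun n => ((hg.cont n).measurable.const_mul _), hs, fun t => ?_,
    fun r t ht => ?_⟩
  · rw [abs_of_nonneg (tsum_nonneg fun n => mul_nonneg (hw0 n) (H.restart_nonneg hg n t))]
    exact ((hs t).tsum_le_tsum (fun n => mul_le_of_le_one_left (H.restart_nonneg hg n t) (hw1 n))
      (H.summable_restart hg t)).trans (H.tsum_restart_le_one hg t)
  · obtain ⟨B, hB⟩ := H.exit_bdd r
    have h := hasSum_integral_of_nonneg (F := fun n v => w n * (a r v * g n (t - v))) (M := B) ht
      (fun n => continuous_const.mul ((H.cont_exit r).mul ((hg.cont n).comp (by fun_prop))))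
      (fun n v _ => mul_nonneg (hw0 n) (mul_nonneg (H.exit_nonneg r v) (H.restart_nonneg hg n _)))
      (fun v _ s => by
        calc ∑ n ∈ s, w n * (a r v * g n (t - v)) ≤ ∑ n ∈ s, a r v * g n (t - v) :=
              sum_le_sum fun n _ => mul_le_of_le_one_left
                (mul_nonneg (H.exit_nonneg r v) (H.restart_nonneg hg n _)) (hw1 n)
          _ = a r v * ∑ n ∈ s, g n (t - v) := (mul_sum _ _ _).symm
          _ ≤ a r v := mul_le_of_le_one_right (H.exit_nonneg r v) (H.sum_restart_le_one hg s _)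
          _ ≤ B := hB v)
    simp only [intervalIntegral.integral_const_mul] at h
    convert h using 3 with v
    rw [← tsum_mul_left]
    exact tsum_congr fun n => by ring

/-- The mass lost by `f` equals the integral of the exit density, so the defect `1 - ∑ g n` solves
the homogeneous Volterra equation and vanishes. -/
theorem hasSum_restart (t : ℝ) : HasSum (fun n => g n t) 1 := by
  obtain ⟨B, hB⟩ := H.exit_bdd c
  obtain ⟨hmeas, -, hle, hsum⟩ := H.weighted_restart hg (w := fun _ => 1) (fun _ => zero_le_one)
    (fun _ => le_rfl)
  simp only [one_mul] at hmeas hle hsum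
  have h := eq_zero_of_volterra (y := fun t => 1 - ∑' n, g n t) (Y := 2) (T := max t 0)
    (H.exit_nonneg c) hB (fun s _ => ?_) zero_le_two (fun s hs => ?_) (max t 0)
    ⟨le_max_right _ _, le_rfl⟩
  · have e : ∑' n, g n t = ∑' n, g n (max t 0) := tsum_congr fun n => hg.eq_max n t
    rw [sub_eq_zero.1 h, ← e]
    exact (H.summable_restart hg t).hasSum
  · have := abs_le.1 (hle s)
    rw [abs_le]
    constructor <;> linarith
  · have h1 := (H.hasSum_mass c s hs.1).add (hsum c s hs.1)
    have h2 : ∑' n, g n s = _ := (h1.congr_fun fun n => hg.volterra n s hs.1).tsum_eq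
    simp only [mul_sub, mul_one]
    rw [intervalIntegral.integral_sub ((H.cont_exit c).intervalIntegrable _ _)
      (H.intervalIntegrable_exit_mul c hmeas hle s 0 s), h2]
    ring

theorem restartTransition_nonneg (n r : ℤ) {t : ℝ} (ht : 0 ≤ t) :
    0 ≤ restartTransition f a g n r t :=
  add_nonneg (H.nonneg n r t) (intervalIntegral.integral_nonneg ht fun v _ =>
    mul_nonneg (H.exit_nonneg r v) (H.restart_nonneg hg n _))

theorem hasSum_restartTransition (r : ℤ) {t : ℝ} (ht : 0 ≤ t) :
    HasSum (fun n => restartTransition f a g n r t) 1 := by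
  obtain ⟨-, -, -, hsum⟩ := H.weighted_restart hg (w := fun _ => 1) (fun _ => zero_le_one)
    (fun _ => le_rfl)
  simp only [one_mul, (H.hasSum_restart hg _).tsum_eq, mul_one] at hsum
  have h := (H.hasSum_mass r t ht).add (hsum r t ht)
  rw [sub_add_cancel] at h
  exact h

theorem restartTransition_le_one (n r : ℤ) {t : ℝ} (ht : 0 ≤ t) :
    restartTransition f a g n r t ≤ 1 :=
  le_hasSum (H.hasSum_restartTransition hg r ht) n fun k _ => H.restartTransition_nonneg hg k r ht

omit H in
theorem restartTransition_self (n : ℤ) {t : ℝ} (ht : 0 ≤ t) :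
    restartTransition f a g n c t = g n t := (hg.volterra n t ht).symm

/-- A decomposition by the explosion time: requiring no explosion during the first `s` units of time
removes the paths that explode at some `v ≤ s`. The exit law moves explosions after `s` back to the
state occupied at time `s`. -/
theorem hasSum_restartTransition_mul (n r : ℤ) {t s : ℝ} (ht : 0 ≤ t) (hs : 0 ≤ s) :
    HasSum (fun k => restartTransition f a g n k t * f k r s)
      (restartTransition f a g n r (t + s) - ∫ v in (0 : ℝ)..s, a r v * g n (t + s - v)) := by
  obtain ⟨B, hB⟩ := H.exit_bdd r
  have hle : ∀ v, g n v ≤ 1 := fun v => by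
    simpa using H.sum_restart_le_one hg {n} v
  have h := hasSum_integral_of_nonneg (F := fun k v => f k r s * a k v * g n (t - v)) (M := B) ht
    (fun k => (continuous_const.mul (H.cont_exit k)).mul ((hg.cont n).comp (by fun_prop)))
    (fun k v _ => mul_nonneg (mul_nonneg (H.nonneg k r s) (H.exit_nonneg k v))
      (H.restart_nonneg hg n _))
    (fun v hv S => by
      have h1 := sum_le_hasSum S (fun k _ => mul_nonneg (H.nonneg k r s) (H.exit_nonneg k v))
        (H.exit_law r v s hv.1 hs)
      rw [← sum_mul]
      calc _ ≤ (∑ k ∈ S, f k r s * a k v) * 1 := mul_le_mul_of_nonneg_left (hle _)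
            (sum_nonneg fun k _ => mul_nonneg (H.nonneg k r s) (H.exit_nonneg k v))
        _ ≤ B := by rw [mul_one]; exact h1.trans (hB _))
  have e1 : ∫ v in (0 : ℝ)..t, ∑' k, f k r s * a k v * g n (t - v)
      = ∫ v in (0 : ℝ)..t, a r (s + v) * g n (t + s - (s + v)) := by
    rw [intervalIntegral.integral_of_le ht, intervalIntegral.integral_of_le ht]
    refine setIntegral_congr_fun measurableSet_Ioc fun v hv => ?_
    rw [tsum_mul_right, (H.exit_law r v s hv.1 hs).tsum_eq]
    congr 2
    ring
  have hi : ∀ x y, IntervalIntegrable (fun v => a r v * g n (t + s - v)) volume x y := fun x y =>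
    Continuous.intervalIntegrable ((H.cont_exit r).mul ((hg.cont n).comp (by fun_prop))) _ _
  have e2 : ∫ v in (0 : ℝ)..t, a r (s + v) * g n (t + s - (s + v))
      = (∫ v in (0 : ℝ)..(t + s), a r v * g n (t + s - v))
        - ∫ v in (0 : ℝ)..s, a r v * g n (t + s - v) := by
    rw [intervalIntegral.integral_comp_add_left (fun x => a r x * g n (t + s - x)) s,
      intervalIntegral.integral_interval_sub_left (hi _ _) (hi _ _), add_zero, add_comm s t]
  rw [e1, e2] at h
  have h2 := (H.chapman_kolmogorov n r t s ht hs).add h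
  rw [← add_sub_assoc] at h2
  refine h2.congr_fun fun k => ?_
  simp only [mul_assoc, intervalIntegral.integral_const_mul, restartTransition]
  ring

/-- As functions of `s`, both sides solve the same renewal equation, so their difference solves the
homogeneous one. This is Chapman-Kolmogorov started from the restart state. -/
theorem tsum_restartTransition_mul_restart (n : ℤ) {t s : ℝ} (ht : 0 ≤ t) (hs : 0 ≤ s) :
    ∑' k, restartTransition f a g n k t * g k s = g n (t + s) := by
  obtain ⟨B, hB⟩ := H.exit_bdd c
  obtain ⟨hmeas, hsm, hle, hsum⟩ := H.weighted_restart hg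
    (w := fun k => restartTransition f a g n k t)
    (fun k => H.restartTransition_nonneg hg n k ht)
    (fun k => H.restartTransition_le_one hg n k ht)
  have hg1 : ∀ v, |g n v| ≤ 1 := fun v => by
    rw [abs_of_nonneg (H.restart_nonneg hg n v)]
    simpa using H.sum_restart_le_one hg {n} v
  have h := eq_zero_of_volterra
    (y := fun s => g n (t + s) - ∑' k, restartTransition f a g n k t * g k s) (Y := 2) (T := s)
    (H.exit_nonneg c) hB (fun x _ => ?_) zero_le_two (fun x hx => ?_) s ⟨hs, le_rfl⟩
  · linarith
  · refine (abs_sub _ _).trans ?_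
    linarith [hg1 (t + x), hle x]
  · have h1 := (H.hasSum_restartTransition_mul hg n c ht hx.1).add (hsum c x hx.1)
    have h2 : ∑' k, restartTransition f a g n k t * g k x = _ := (h1.congr_fun fun k => by
      rw [hg.volterra k x hx.1]; ring).tsum_eq
    rw [h2, restartTransition_self hg n (add_nonneg ht hx.1)]
    have hc : Continuous fun v => a c v * g n (t + (x - v)) :=
      (H.cont_exit c).mul ((hg.cont n).comp
        (continuous_const.add (continuous_const.sub continuous_id)))
    simp only [mul_sub]
    rw [intervalIntegral.integral_sub (hc.intervalIntegrable _ _)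
      (H.intervalIntegrable_exit_mul c hmeas hle x 0 x)]
    simp only [add_sub_assoc]
    ring

theorem restartTransition_chapman_kolmogorov (n r : ℤ) {t s : ℝ} (ht : 0 ≤ t) (hs : 0 ≤ s) :
    HasSum (fun k => restartTransition f a g n k t * restartTransition f a g k r s)
      (restartTransition f a g n r (t + s)) := by
  obtain ⟨-, -, -, hsum⟩ := H.weighted_restart hg
    (w := fun k => restartTransition f a g n k t)
    (fun k => H.restartTransition_nonneg hg n k ht)
    (fun k => H.restartTransition_le_one hg n k ht)
  have h1 := (H.hasSum_restartTransition_mul hg n r ht hs).add (hsum r s hs)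
  have e : ∫ v in (0 : ℝ)..s, a r v * ∑' k, restartTransition f a g n k t * g k (s - v)
      = ∫ v in (0 : ℝ)..s, a r v * g n (t + s - v) := by
    refine intervalIntegral.integral_congr fun v hv => ?_
    rw [Set.uIcc_of_le hs] at hv
    rw [H.tsum_restartTransition_mul_restart hg n ht (by linarith [hv.2]), add_sub_assoc]
  rw [e, sub_add_cancel] at h1
  refine h1.congr_fun fun k => ?_
  rw [restartTransition.eq_def f a g k r s]
  ring

/-- The mass added by restarts is at most the total defect of `f`, and the three rates already
account for all of the mass to first order, so the defect is `o(h)`. -/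
theorem isLittleO_restartTransition_sub (j i : ℤ) :
    (fun h => restartTransition f a g j i h - f j i h) =o[𝓝[>] 0] (fun h => h) := by
  have h1 := (H.birth i).norm_left.add ((H.death i).norm_left.add (H.stay i).norm_left)
  refine Asymptotics.IsBigO.trans_isLittleO (Asymptotics.IsBigO.of_bound 1 ?_) h1
  filter_upwards [self_mem_nhdsWithin] with h hh
  have hh : 0 < h := hh
  have h2 := (H.hasSum_restartTransition hg i hh.le).sub (H.hasSum_mass i h hh.le)
  have hn : ∀ k, 0 ≤ restartTransition f a g k i h - f k i h := fun k => by
    rw [restartTransition, add_sub_cancel_left]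
    exact intervalIntegral.integral_nonneg hh.le fun v _ =>
      mul_nonneg (H.exit_nonneg i v) (H.restart_nonneg hg k _)
  have h3 := le_hasSum h2 j fun k _ => hn k
  have h4 := sum_le_hasSum {i + 1, i - 1, i} (fun k _ => H.nonneg k i h) (H.hasSum_mass i h hh.le)
  rw [sum_insert (by simp; omega), sum_insert (by simp), sum_singleton] at h4
  rw [one_mul, Real.norm_eq_abs, abs_of_nonneg (hn j), Real.norm_eq_abs, Real.norm_eq_abs,
    Real.norm_eq_abs, Real.norm_eq_abs]
  refine le_trans ?_ (le_abs_self _)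
  have h5 := neg_abs_le (f (i + 1) i h - birthRate q ν i * h)
  have h6 := neg_abs_le (f (i - 1) i h - deathRate q i * h)
  have h7 := neg_abs_le (f i i h - (1 - (birthRate q ν i + deathRate q i) * h))
  linarith

theorem isTransitionFunction_restartTransition :
    IsTransitionFunction q ν (restartTransition f a g) := by
  constructor
  · exact fun n r t ht => H.restartTransition_nonneg hg n r ht
  · exact fun r t ht => H.hasSum_restartTransition hg r ht
  · intro n r
    simp [restartTransition, H.initial]
  · exact fun n r t s ht hs => H.restartTransition_chapman_kolmogorov hg n r ht hs
  · intro i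
    refine ((H.isLittleO_restartTransition_sub hg (i + 1) i).add (H.birth i)).congr_left fun h => ?_
    ring
  · intro i
    refine ((H.isLittleO_restartTransition_sub hg (i - 1) i).add (H.death i)).congr_left fun h => ?_
    ring
  · intro i
    refine ((H.isLittleO_restartTransition_sub hg i i).add (H.stay i)).congr_left fun h => ?_
    ring
  · intro i j hij
    have h1 := (H.isLittleO_restartTransition_sub hg j i)
    have h2 : (fun h => f j i h) =o[𝓝[>] 0] (fun h => h) := by
      have h1 := (H.birth i).norm_left.add ((H.death i).norm_left.add (H.stay i).norm_left)
      refine Asymptotics.IsBigO.trans_isLittleO (Asymptotics.IsBigO.of_bound 1 ?_) h1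
      filter_upwards [self_mem_nhdsWithin] with h hh
      have hh : 0 < h := hh
      have hj1 : j ≠ i := by rintro rfl; simp at hij
      have hj2 : j ≠ i + 1 := by rintro rfl; simp at hij
      have hj3 : j ≠ i - 1 := by rintro rfl; simp at hij
      have h4 := sum_le_hasSum {j, i + 1, i - 1, i} (fun k _ => H.nonneg k i h)
        (H.hasSum_mass i h hh.le)
      rw [sum_insert (by simp [hj1, hj2, hj3]), sum_insert (by simp; omega),
        sum_insert (by simp), sum_singleton] at h4
      have h8 : 0 ≤ ∫ v in (0 : ℝ)..h, a i v :=
        intervalIntegral.integral_nonneg hh.le fun v _ => H.exit_nonneg i v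
      rw [one_mul, Real.norm_eq_abs, abs_of_nonneg (H.nonneg j i h), Real.norm_eq_abs,
        Real.norm_eq_abs, Real.norm_eq_abs, Real.norm_eq_abs]
      refine le_trans ?_ (le_abs_self _)
      have h5 := neg_abs_le (f (i + 1) i h - birthRate q ν i * h)
      have h6 := neg_abs_le (f (i - 1) i h - deathRate q i * h)
      have h7 := neg_abs_le (f i i h - (1 - (birthRate q ν i + deathRate q i) * h))
      linarith
    exact (h1.add h2).congr_left fun h => by ring

end Restart

end IsExitSystem

/-- Restarting an explosive process at `0` or at `1` gives different transition functions. -/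
theorem IsExitSystem.not_unique {q ν : ℝ} {f : ℤ → ℤ → ℝ → ℝ} {a : ℤ → ℝ → ℝ}
    (H : IsExitSystem q ν f a) (hne : ∃ r t, 0 < t ∧ a r t ≠ 0) (P : ℤ → ℤ → ℝ → ℝ)
    (hP : ∀ p, IsTransitionFunction q ν p → ∀ n r t, 0 ≤ t → p n r t = P n r t) : False := by
  obtain ⟨g, hg⟩ := H.exists_isRestart 0
  obtain ⟨g', hg'⟩ := H.exists_isRestart 1
  have h0 := hP _ (H.isTransitionFunction_restartTransition hg)
  have h1 := hP _ (H.isTransitionFunction_restartTransition hg')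
  have hgg : ∀ r t, 0 ≤ t →
      ∫ v in (0 : ℝ)..t, a r v * (g 0 (t - v) - g' 0 (t - v)) = 0 := fun r t ht => by
    have h2 := (h0 0 r t ht).trans (h1 0 r t ht).symm
    simp only [restartTransition] at h2
    have hc : Continuous fun v => a r v * g 0 (t - v) :=
      (H.cont_exit r).mul ((hg.cont 0).comp (continuous_const.sub continuous_id))
    have hc' : Continuous fun v => a r v * g' 0 (t - v) :=
      (H.cont_exit r).mul ((hg'.cont 0).comp (continuous_const.sub continuous_id))
    simp only [mul_sub]
    rw [intervalIntegral.integral_sub (hc.intervalIntegrable _ _) (hc'.intervalIntegrable _ _)]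
    linarith
  -- Only the first process starts at `0`, so the difference stays positive on some `[0, δ)`. A
  -- vanishing convolution with the nonnegative density then forces the density to be zero there,
  -- for every starting state.
  have hz : g 0 0 - g' 0 0 = 1 := by
    rw [hg.volterra 0 0 le_rfl, hg'.volterra 0 0 le_rfl]
    simp [H.initial]
  have hcont : Continuous fun t => g 0 t - g' 0 t := (hg.cont 0).sub (hg'.cont 0)
  have hev : ∀ᶠ t in 𝓝 (0 : ℝ), 1 / 2 < g 0 t - g' 0 t :=
    hcont.continuousAt.eventually (lt_mem_nhds (by simp only [hz]; norm_num))
  obtain ⟨δ, hδ, hδ'⟩ := Metric.eventually_nhds_iff.1 hev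
  have hδ2 : ∀ t, 0 ≤ t → t < δ → 0 < g 0 t - g' 0 t := fun t ht htδ => by
    have := hδ' (y := t) (by rwa [Real.dist_eq, sub_zero, abs_of_nonneg ht])
    linarith
  have hsmall : ∀ r t, 0 < t → t < δ → a r t = 0 := fun r t ht htδ => by
    by_contra hat
    have hc : Continuous fun v => a r v * (g 0 (t - v) - g' 0 (t - v)) :=
      (H.cont_exit r).mul (hcont.comp (continuous_const.sub continuous_id))
    refine (intervalIntegral.integral_pos ht hc.continuousOn (fun v hv => ?_)
      ⟨t, ⟨ht.le, le_rfl⟩, ?_⟩).ne' (hgg r t ht.le)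
    · exact mul_nonneg (H.exit_nonneg r v)
        (hδ2 _ (by linarith [hv.2]) (by linarith [hv.1])).le
    · exact mul_pos (lt_of_le_of_ne (H.exit_nonneg r t) (Ne.symm hat))
        (hδ2 _ (by linarith) (by linarith))
  obtain ⟨r, t, ht, hat⟩ := hne
  -- The exit law at the splitting `t = (t - m) + m`, with `m < δ`, expresses `a r t` through values
  -- `a k m`, all of which vanish.
  have hm : 0 < min (t / 2) (δ / 2) := by positivity
  have hm1 := min_le_left (t / 2) (δ / 2)
  have hm2 := min_le_right (t / 2) (δ / 2)
  have h := H.exit_law r (min (t / 2) (δ / 2)) (t - min (t / 2) (δ / 2)) hm (by linarith)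
  rw [sub_add_cancel] at h
  simp only [hsmall _ _ hm (by linarith), mul_zero] at h
  exact hat (h.unique hasSum_zero)

/-- The transition function of the process killed at explosion, for `-1 < ν < 0`: the
`h`-transform of the process with parameter `-ν`. -/
def killedTransition (q ν : ℝ) (n r : ℤ) (t : ℝ) : ℝ :=
  (q ^ (2 * ν)) ^ (n - r) * qTransition q (-ν) n r (q ^ (2 * ν) * t)

/-- The density of the explosion time, for `-1 < ν < 0`. -/
def exitDensity (q ν : ℝ) (r : ℤ) (t : ℝ) : ℝ :=
  (1 - (q ^ (2 * ν))⁻¹) * q ^ (2 * ν) * orthoConst q (-ν) ^ 2 * ((q ^ (2 * ν)) ^ r)⁻¹ *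
    ∑' k : ℤ, Real.exp (-(q ^ (2 * ν) * t) * (q ^ 2) ^ k) *
      ((weightBase q (-ν) ^ 2) ^ k * latticeBessel q (-ν) (r + k))

/-! ### The killed process and its explosion time for `-1 < ν < 0` -/

section Killed

variable {q ν : ℝ}

theorem rpow_two_mul_gt_one (hq0 : 0 < q) (hq1 : q < 1) (hν : ν < 0) : 1 < q ^ (2 * ν) :=
  Real.one_lt_rpow_of_pos_of_lt_one_of_neg hq0 hq1 (by linarith)

theorem rpow_two_mul_neg (hq0 : 0 < q) : q ^ (2 * -ν) = (q ^ (2 * ν))⁻¹ := by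
  rw [mul_neg, Real.rpow_neg hq0.le]

theorem weightBase_neg_sq (hq0 : 0 < q) : weightBase q (-ν) ^ 2 = (q ^ (2 * ν))⁻¹ * q ^ 2 := by
  rw [weightBase_sq hq0, rpow_two_mul_neg hq0]

theorem summable_exitDensity (hq0 : 0 < q) (hq1 : q < 1) (hν : ν < 0) (r : ℤ) :
    Summable fun k : ℤ => (weightBase q (-ν) ^ 2) ^ k * |latticeBessel q (-ν) (r + k)| :=
  summable_zpow_mul_shift hq0 hq1 (by linarith) (pow_pos (weightBase_pos hq0) 2)
    (weightBase_sq_lt_one hq0 hq1 (by linarith)) r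

theorem abs_exitDensity_term_le (hq0 : 0 < q) {t : ℝ} (ht : 0 ≤ t) (r k : ℤ) :
    ‖Real.exp (-(q ^ (2 * ν) * t) * (q ^ 2) ^ k) *
      ((weightBase q (-ν) ^ 2) ^ k * latticeBessel q (-ν) (r + k))‖
      ≤ (weightBase q (-ν) ^ 2) ^ k * |latticeBessel q (-ν) (r + k)| := by
  have hg : 0 < q ^ (2 * ν) := Real.rpow_pos_of_pos hq0 _
  have hw := weightBase_pos (ν := -ν) hq0
  rw [norm_mul, Real.norm_eq_abs, Real.norm_eq_abs, abs_mul,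
    abs_of_pos (zpow_pos (pow_pos hw 2) k)]
  exact mul_le_of_le_one_left (by positivity) (abs_heatMult_le hq0 (by positivity) k)

theorem continuousOn_exitDensity (hq0 : 0 < q) (hq1 : q < 1) (hν : ν < 0) (r : ℤ) :
    ContinuousOn (exitDensity q ν r) (Set.Ici 0) := by
  refine ContinuousOn.mul continuousOn_const ?_
  exact continuousOn_tsum (fun k => by fun_prop) (summable_exitDensity hq0 hq1 hν r)
    fun k t ht => abs_exitDensity_term_le hq0 ht r k

theorem exitDensity_bdd (hq0 : 0 < q) (hq1 : q < 1) (hν : ν < 0) (r : ℤ) :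
    ∃ B, ∀ t, 0 ≤ t → exitDensity q ν r t ≤ B := by
  refine ⟨|(1 - (q ^ (2 * ν))⁻¹) * q ^ (2 * ν) * orthoConst q (-ν) ^ 2 * ((q ^ (2 * ν)) ^ r)⁻¹| *
    ∑' k : ℤ, (weightBase q (-ν) ^ 2) ^ k * |latticeBessel q (-ν) (r + k)|, fun t ht => ?_⟩
  refine (le_abs_self _).trans ?_
  rw [exitDensity, abs_mul]
  exact mul_le_mul_of_nonneg_left (tsum_of_norm_bounded
    (summable_exitDensity hq0 hq1 hν r).hasSum fun k => abs_exitDensity_term_le hq0 ht r k)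
    (abs_nonneg _)

theorem exitDensity_eq (hq0 : 0 < q) (r : ℤ) (t : ℝ) :
    exitDensity q ν r t = (1 - (q ^ (2 * ν))⁻¹) * q ^ (2 * ν) * orthoConst q (-ν) *
      ((q ^ (2 * ν) * weightBase q (-ν)) ^ r)⁻¹ *
      ∑' k : ℤ, Real.exp (-(q ^ (2 * ν) * t) * (q ^ 2) ^ k) *
        (weightBase q (-ν) ^ k * orthoBessel q (-ν) (r + k)) := by
  have hg : 0 < q ^ (2 * ν) := Real.rpow_pos_of_pos hq0 _
  have hw := weightBase_pos (ν := -ν) hq0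
  have hgr := (zpow_pos hg r).ne'
  have hwr := (zpow_pos hw r).ne'
  rw [exitDensity, ← tsum_mul_left, ← tsum_mul_left]
  refine tsum_congr fun k => ?_
  rw [orthoBessel, mul_zpow, zpow_add₀ hw.ne', sq_zpow (weightBase q (-ν))]
  field_simp

/-- As the starting state `i` tends to `+∞`, `j(i+k) → 1`, so the series is, up to a positive
factor, the limit of the nonnegative transition probabilities of the process with parameter `-ν`
from `i` to `r`. -/
theorem exitDensity_nonneg (hq0 : 0 < q) (hq1 : q < 1) (hν : ν < 0) (r : ℤ) {t : ℝ}
    (ht : 0 ≤ t) : 0 ≤ exitDensity q ν r t := by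
  have hν' : -1 < -ν := by linarith
  have hg : 0 < q ^ (2 * ν) := Real.rpow_pos_of_pos hq0 _
  have hg1 := rpow_two_mul_gt_one hq0 hq1 hν
  have hw := weightBase_pos (ν := -ν) hq0
  have hC := orthoConst_pos hq0 hq1 hν'
  have hC1 : 0 < 1 - (q ^ (2 * ν))⁻¹ := sub_pos.2 (inv_lt_one_of_one_lt₀ hg1)
  obtain ⟨M, hM0, hM⟩ := abs_latticeBessel_le hq0 hq1 hν'
  rw [exitDensity_eq hq0]
  refine mul_nonneg (by positivity) ?_
  set φ : ℤ → ℝ := fun k => Real.exp (-(q ^ (2 * ν) * t) * (q ^ 2) ^ k) with hφ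
  have hφ1 : ∀ k, |φ k| ≤ 1 := fun k => abs_heatMult_le hq0 (by positivity) k
  have hs := summable_zpow_mul_orthoBessel hq0 hq1 hν' hw
    (by rw [← sq]; exact weightBase_sq_lt_one hq0 hq1 hν') r
  have h := tendsto_tsum_of_dominated_convergence (𝓕 := atTop)
    (f := fun (i k : ℤ) => φ k * (weightBase q (-ν) ^ k * orthoBessel q (-ν) (r + k))
      * latticeBessel q (-ν) (i + k))
    (g := fun k => φ k * (weightBase q (-ν) ^ k * orthoBessel q (-ν) (r + k)) * 1)
    (hs.mul_right M) (fun k => ?_) (Eventually.of_forall fun i k => ?_)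
  · simp only [mul_one] at h
    refine ge_of_tendsto' h fun i => ?_
    have h1 := qTransition_nonneg hq0 hq1 hν' r i (t := q ^ (2 * ν) * t) (by positivity)
    rw [qTransition_eq hq0 hq1, ← (hasSum_kernel hq0 hq1 hν' hφ1 r i).tsum_eq] at h1
    simp_rw [weight_mul_kernel_term hq0, mul_assoc, tsum_mul_left] at h1
    have h2 := nonneg_of_mul_nonneg_right h1 (zpow_pos hw r)
    have h3 := nonneg_of_mul_nonneg_right h2 hC
    simpa only [mul_assoc] using h3
  · exact ((tendsto_latticeBessel_atTop hq0 hq1 hν').comp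
      (tendsto_atTop_add_const_right atTop k tendsto_id)).const_mul _
  · rw [Real.norm_eq_abs, abs_mul, abs_mul, abs_mul, abs_of_pos (zpow_pos hw k)]
    have h1 : 0 ≤ weightBase q (-ν) ^ k * |orthoBessel q (-ν) (r + k)| := by positivity
    exact mul_le_mul (mul_le_of_le_one_left h1 (hφ1 k)) (hM _) (abs_nonneg _) h1

/-- The recurrence telescopes through `j(m-1) - q^{2ν} j(m)`, whose limits are `1 - q^{2ν}` at `+∞`
and `0` at `-∞`. The nonzero boundary term is the source of the loss of mass. -/
theorem hasSum_sq_zpow_mul (hq0 : 0 < q) (hq1 : q < 1) (hν : 0 < ν) :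
    HasSum (fun m : ℤ => (q ^ 2) ^ m * latticeBessel q ν m) (1 - q ^ (2 * ν)) := by
  have hν' : -1 < ν := by linarith
  obtain ⟨h3, h4⟩ := sq_mem hq0 hq1
  set w : ℤ → ℝ := fun m => latticeBessel q ν (m - 1) - q ^ (2 * ν) * latticeBessel q ν m with hw
  have hstep : ∀ m, (q ^ 2) ^ m * latticeBessel q ν m = w (m + 1) - w m := fun m => by
    have h := latticeBessel_recurrence hq0 hq1 hν' m
    simp only [hw, add_sub_cancel_right]
    linarith
  have hs : Summable fun m => w (m + 1) - w m := by
    rw [← summable_abs_iff]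
    refine (summable_zpow_mul_abs hq0 hq1 hν' h3 h4).congr fun m => ?_
    rw [← hstep, abs_mul, abs_of_pos (zpow_pos h3 m)]
  have ht := tendsto_latticeBessel_atTop hq0 hq1 hν'
  have hb : ∀ n : ℤ, Tendsto (fun k : ℤ => latticeBessel q ν (n + k)) atBot (𝓝 0) := fun n => by
    simpa using tendsto_zpow_mul_shift_atBot hq0 hq1 hν' one_pos n
  have htop : Tendsto w atTop (𝓝 (1 - q ^ (2 * ν) * 1)) :=
    (ht.comp (tendsto_atTop_add_const_right atTop (-1) tendsto_id)).sub (ht.const_mul _)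
  have hbot : Tendsto w atBot (𝓝 (0 - q ^ (2 * ν) * 0)) := by
    have h := (hb (-1)).sub ((hb 0).const_mul (q ^ (2 * ν)))
    refine h.congr fun m => ?_
    simp only [hw, zero_add]
    rw [show -1 + m = m - 1 by ring]
  have h := hasSum_int_telescope hs htop hbot
  simp_rw [← hstep] at h
  simpa using h

/-- The transform changes the weight in the arrival state from `w^{2m}` to `q^{2m}`, where `w =
q^{1-ν}`, so the sum over `n` is the telescoping value for parameter `-ν` instead of zero. -/
theorem hasSum_killedTransition (hq0 : 0 < q) (hq1 : q < 1) (hν : ν < 0) (r : ℤ) {t : ℝ}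
    (ht : 0 ≤ t) : HasSum (fun n => killedTransition q ν n r t)
      ((1 - (q ^ (2 * ν))⁻¹) * orthoConst q (-ν) ^ 2 * ((q ^ (2 * ν)) ^ r)⁻¹ *
        ∑' k : ℤ, Real.exp (-(q ^ (2 * ν) * t) * (q ^ 2) ^ k) *
          (((q ^ (2 * ν))⁻¹) ^ k * latticeBessel q (-ν) (r + k))) := by
  have hν' : -1 < -ν := by linarith
  have hg : 0 < q ^ (2 * ν) := Real.rpow_pos_of_pos hq0 _
  have hg1 := rpow_two_mul_gt_one hq0 hq1 hν
  have hw := weightBase_pos (ν := -ν) hq0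
  set φ : ℤ → ℝ := fun k => Real.exp (-(q ^ (2 * ν) * t) * (q ^ 2) ^ k) with hφ
  have hφ1 : ∀ k, |φ k| ≤ 1 := fun k => abs_heatMult_le hq0 (by positivity) k
  set G : ℤ → ℝ := fun k => orthoConst q (-ν) * ((q ^ (2 * ν)) ^ r)⁻¹ *
    (φ k * (((q ^ (2 * ν))⁻¹) ^ k * latticeBessel q (-ν) (r + k))) with hG
  have hGs : Summable fun k => |G k| := by
    refine Summable.of_nonneg_of_le (fun _ => abs_nonneg _) (fun k => ?_)
      ((summable_zpow_mul_shift hq0 hq1 hν' (inv_pos.2 hg) (inv_lt_one_of_one_lt₀ hg1) r).mul_left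
        |orthoConst q (-ν) * ((q ^ (2 * ν)) ^ r)⁻¹|)
    simp only [hG]
    rw [abs_mul, abs_mul (φ k), abs_mul (_ ^ k), abs_of_pos (zpow_pos (inv_pos.2 hg) k)]
    exact mul_le_mul_of_nonneg_left (mul_le_of_le_one_left (by positivity) (hφ1 k)) (abs_nonneg _)
  have hH := (hasSum_sq_zpow_mul (ν := -ν) hq0 hq1 (by linarith)).mul_left (orthoConst q (-ν))
  have h := hasSum_tsum_mul_shift hGs hH
  rw [hG] at h
  simp only [tsum_mul_left] at h
  rw [rpow_two_mul_neg hq0] at h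
  have e : (1 - (q ^ (2 * ν))⁻¹) * orthoConst q (-ν) ^ 2 * ((q ^ (2 * ν)) ^ r)⁻¹ *
        ∑' k : ℤ, φ k * (((q ^ (2 * ν))⁻¹) ^ k * latticeBessel q (-ν) (r + k))
      = orthoConst q (-ν) * ((q ^ (2 * ν)) ^ r)⁻¹ *
        (∑' k : ℤ, φ k * (((q ^ (2 * ν))⁻¹) ^ k * latticeBessel q (-ν) (r + k))) *
        (orthoConst q (-ν) * (1 - (q ^ (2 * ν))⁻¹)) := by ring
  rw [e]
  refine h.congr_fun fun n => ?_
  rw [killedTransition, qTransition_eq hq0 hq1, ← (hasSum_kernel hq0 hq1 hν' hφ1 n r).tsum_eq,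
    ← tsum_mul_left]
  refine tsum_congr fun k => ?_
  have hp : (q ^ 2) ^ (n + k) = (q ^ (2 * ν)) ^ (n + k) * (weightBase q (-ν) ^ (n + k)) ^ 2 := by
    rw [← sq_zpow, weightBase_neg_sq hq0, ← mul_zpow, mul_inv_cancel_left₀ hg.ne']
  have hw3 : weightBase q (-ν) ^ (n - r) * weightBase q (-ν) ^ (r + k)
      = weightBase q (-ν) ^ (n + k) := by rw [← zpow_add₀ hw.ne']; ring_nf
  have hg3 : ((q ^ (2 * ν)) ^ r)⁻¹ * ((q ^ (2 * ν))⁻¹) ^ k * (q ^ (2 * ν)) ^ (n + k)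
      = (q ^ (2 * ν)) ^ (n - r) := by
    rw [inv_zpow', ← zpow_neg, ← zpow_add₀ hg.ne', ← zpow_add₀ hg.ne']; ring_nf
  rw [hp, ← hg3, orthoBessel, orthoBessel]
  generalize latticeBessel q (-ν) (r + k) = x
  generalize latticeBessel q (-ν) (n + k) = y
  linear_combination (((q ^ (2 * ν)) ^ r)⁻¹ * ((q ^ (2 * ν))⁻¹) ^ k * (q ^ (2 * ν)) ^ (n + k) *
    φ k * weightBase q (-ν) ^ (n + k) * orthoConst q (-ν) ^ 2 * x * y) * hw3

theorem killedTransition_zero (hq0 : 0 < q) (hq1 : q < 1) (hν : ν < 0) (n r : ℤ) :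
    killedTransition q ν n r 0 = if n = r then 1 else 0 := by
  rw [killedTransition, mul_zero,
    (isTransitionFunction_qTransition hq0 hq1 (by linarith : -1 < -ν)).initial]
  split_ifs with h
  · simp [h]
  · simp

/-- Termwise differentiation in `t` of the series for the mass gives minus the exit density. The
mass at time `0` is `1` because the kernel is then `δ`. -/
theorem hasSum_killedTransition_integral (hq0 : 0 < q) (hq1 : q < 1) (hν : ν < 0) (r : ℤ) {t : ℝ}
    (ht : 0 ≤ t) : HasSum (fun n => killedTransition q ν n r t)
      (1 - ∫ v in (0 : ℝ)..t, exitDensity q ν r v) := by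
  have hν' : -1 < -ν := by linarith
  have hg : 0 < q ^ (2 * ν) := Real.rpow_pos_of_pos hq0 _
  have hg1 := rpow_two_mul_gt_one hq0 hq1 hν
  have hp : 0 < q ^ 2 := by positivity
  set D := (1 - (q ^ (2 * ν))⁻¹) * orthoConst q (-ν) ^ 2 * ((q ^ (2 * ν)) ^ r)⁻¹ with hD
  set L : ℤ → ℝ := fun k => ((q ^ (2 * ν))⁻¹) ^ k * latticeBessel q (-ν) (r + k) with hL
  have hLs : Summable fun k => |L k| := by
    refine (summable_zpow_mul_shift hq0 hq1 hν' (inv_pos.2 hg) (inv_lt_one_of_one_lt₀ hg1) r).congr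
      fun k => ?_
    rw [hL, abs_mul, abs_of_pos (zpow_pos (inv_pos.2 hg) k)]
  have hex : ∀ s, 0 ≤ s → Summable fun k => Real.exp (-(q ^ (2 * ν) * s) * (q ^ 2) ^ k) * L k :=
    fun s hs => by
      refine Summable.of_norm_bounded hLs fun k => ?_
      rw [Real.norm_eq_abs, abs_mul]
      exact mul_le_of_le_one_left (abs_nonneg _) (abs_heatMult_le hq0 (by positivity) k)
  have h0 := hasSum_killedTransition hq0 hq1 hν r le_rfl
  have h1 : D * ∑' k : ℤ, Real.exp (-(q ^ (2 * ν) * 0) * (q ^ 2) ^ k) * L k = 1 := by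
    refine h0.unique ?_
    simp_rw [killedTransition_zero hq0 hq1 hν]
    simpa using hasSum_single (f := fun n => if n = r then (1 : ℝ) else 0) r
      (fun n hn => by simp [hn])
  have hterm : ∀ k : ℤ, ∫ v in (0 : ℝ)..t, D * (q ^ (2 * ν) *
      (Real.exp (-(q ^ (2 * ν) * v) * (q ^ 2) ^ k) *
        ((weightBase q (-ν) ^ 2) ^ k * latticeBessel q (-ν) (r + k))))
      = D * (Real.exp (-(q ^ (2 * ν) * 0) * (q ^ 2) ^ k) * L k)
        - D * (Real.exp (-(q ^ (2 * ν) * t) * (q ^ 2) ^ k) * L k) := fun k => by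
    have hd : ∀ v ∈ Set.uIcc 0 t, HasDerivAt
        (fun v => -(D * (Real.exp (-(q ^ (2 * ν) * v) * (q ^ 2) ^ k) * L k)))
        (D * (q ^ (2 * ν) * (Real.exp (-(q ^ (2 * ν) * v) * (q ^ 2) ^ k) *
        ((weightBase q (-ν) ^ 2) ^ k * latticeBessel q (-ν) (r + k))))) v := fun v _ => by
      have h2 : HasDerivAt (fun v : ℝ => -(q ^ (2 * ν) * v) * (q ^ 2) ^ k)
          (-(q ^ (2 * ν) * 1) * (q ^ 2) ^ k) v :=
        (((hasDerivAt_id v).const_mul _).neg).mul_const _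
      refine (((h2.exp.mul_const (L k)).const_mul D).neg).congr_deriv ?_
      rw [hL, weightBase_neg_sq hq0, mul_zpow]
      ring
    rw [intervalIntegral.integral_eq_sub_of_hasDerivAt hd
      (Continuous.intervalIntegrable (by fun_prop) _ _)]
    ring
  have hint := intervalIntegral.hasSum_integral_of_dominated_convergence (μ := volume)
    (a := (0 : ℝ)) (b := t)
    (F := fun (k : ℤ) v => D * (q ^ (2 * ν) * (Real.exp (-(q ^ (2 * ν) * v) * (q ^ 2) ^ k) *
        ((weightBase q (-ν) ^ 2) ^ k * latticeBessel q (-ν) (r + k)))))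
    (f := fun v => exitDensity q ν r v)
    (fun k _ => |D * q ^ (2 * ν)| *
      ((weightBase q (-ν) ^ 2) ^ k * |latticeBessel q (-ν) (r + k)|))
    (fun k => Continuous.aestronglyMeasurable (by fun_prop))
    (fun k => Eventually.of_forall fun v hv => by
      rw [Set.uIoc_of_le ht] at hv
      rw [← mul_assoc, norm_mul, Real.norm_eq_abs]
      exact mul_le_mul_of_nonneg_left (abs_exitDensity_term_le hq0 hv.1.le r k) (abs_nonneg _))
    (Eventually.of_forall fun v _ => (summable_exitDensity hq0 hq1 hν r).mul_left _)
    intervalIntegrable_const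
    (Eventually.of_forall fun v hv => by
      rw [Set.uIoc_of_le ht] at hv
      have hs : Summable fun k : ℤ => Real.exp (-(q ^ (2 * ν) * v) * (q ^ 2) ^ k) *
        ((weightBase q (-ν) ^ 2) ^ k * latticeBessel q (-ν) (r + k)) :=
        Summable.of_norm_bounded (summable_exitDensity hq0 hq1 hν r)
          fun k => abs_exitDensity_term_le hq0 hv.1.le r k
      have h3 := (hs.hasSum.mul_left (q ^ (2 * ν))).mul_left D
      have e : D * (q ^ (2 * ν) * ∑' k : ℤ, Real.exp (-(q ^ (2 * ν) * v) * (q ^ 2) ^ k) *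
        ((weightBase q (-ν) ^ 2) ^ k * latticeBessel q (-ν) (r + k))) = exitDensity q ν r v := by
        rw [exitDensity, hD]; ring
      rwa [e] at h3)
  simp_rw [hterm] at hint
  have h4 := ((hex 0 le_rfl).hasSum.mul_left D).sub ((hex t ht).hasSum.mul_left D)
  rw [h1] at h4
  rw [hint.unique h4, sub_sub_cancel]
  exact hasSum_killedTransition hq0 hq1 hν r ht

/-- As `k → -∞` the weight grows, but `e^{-y} ≤ 1/y` already yields a geometric series of ratio `q²
/ q^{1-ν}`, which is below `1` since `ν > -1`. -/
theorem summable_exp_mul_weight (hq0 : 0 < q) (hq1 : q < 1) (hν : -1 < ν) (hν' : ν < 0) {x : ℝ}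
    (hx : 0 < x) : Summable fun k : ℤ => |Real.exp (-x * (q ^ 2) ^ k) * weightBase q (-ν) ^ k| := by
  have hw := weightBase_pos (ν := -ν) hq0
  have hw1 := weightBase_lt_one (ν := -ν) hq0 hq1 (by linarith)
  have hp : 0 < q ^ 2 := by positivity
  have hpw : q ^ 2 < weightBase q (-ν) := by
    rw [weightBase, ← Real.rpow_natCast]
    exact Real.rpow_lt_rpow_of_exponent_gt hq0 hq1 (by push_cast; linarith)
  have e : ∀ k : ℤ, |Real.exp (-x * (q ^ 2) ^ k) * weightBase q (-ν) ^ k|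
      = Real.exp (-x * (q ^ 2) ^ k) * weightBase q (-ν) ^ k := fun k =>
    abs_of_pos (mul_pos (Real.exp_pos _) (zpow_pos hw k))
  simp_rw [e]
  refine Summable.of_nat_of_neg ?_ ?_
  · refine Summable.of_nonneg_of_le (fun k => by positivity) (fun k => ?_)
      (summable_geometric_of_lt_one hw.le hw1)
    rw [zpow_natCast, zpow_natCast]
    exact mul_le_of_le_one_left (by positivity) (Real.exp_le_one_iff.2
      (by have : 0 ≤ x * (q ^ 2) ^ k := by positivity
          linarith))
  · have hr1 : q ^ 2 / weightBase q (-ν) < 1 := (div_lt_one hw).2 hpw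
    refine Summable.of_nonneg_of_le (fun k => by positivity) (fun k => ?_)
      ((summable_geometric_of_lt_one (by positivity) hr1).mul_left (1 / x))
    rw [zpow_neg, zpow_neg, zpow_natCast, zpow_natCast, div_pow]
    have h1 : Real.exp (-x * ((q ^ 2) ^ k)⁻¹) ≤ 1 / x * (q ^ 2) ^ k := by
      have h2 := Real.add_one_le_exp (x * ((q ^ 2) ^ k)⁻¹)
      have h3 : 0 < x * ((q ^ 2) ^ k)⁻¹ := by positivity
      rw [neg_mul, Real.exp_neg]
      refine (inv_anti₀ h3 (by linarith)).trans (le_of_eq ?_)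
      field_simp
    calc _ ≤ 1 / x * (q ^ 2) ^ k * (weightBase q (-ν) ^ k)⁻¹ :=
          mul_le_mul_of_nonneg_right h1 (by positivity)
      _ = _ := by ring

/-- Parseval's identity again, with the weights `w^k` in place of a translate of `u`. They are
summable only with the factor `e^{-q^{2ν} t q^{2k}}`, hence the requirement `t > 0`. -/
theorem hasSum_exit_law (hq0 : 0 < q) (hq1 : q < 1) (hν : -1 < ν) (hν' : ν < 0) (r : ℤ) {t s : ℝ}
    (ht : 0 < t) (hs : 0 ≤ s) :
    HasSum (fun k => killedTransition q ν k r s * exitDensity q ν k t)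
      (exitDensity q ν r (s + t)) := by
  have hneg : -1 < -ν := by linarith
  have hg : 0 < q ^ (2 * ν) := Real.rpow_pos_of_pos hq0 _
  have hw := weightBase_pos (ν := -ν) hq0
  have hφ1 : ∀ k : ℤ, |Real.exp (-(q ^ (2 * ν) * s) * (q ^ 2) ^ k)| ≤ 1 := fun k =>
    abs_heatMult_le hq0 (by positivity) k
  have h := (hasSum_mul_of_orthonormal (summable_abs_orthoBessel hq0 hq1 hneg)
    (hasSum_orthoBessel_mul hq0 hq1 hneg) (summable_mult hq0 hq1 hneg hφ1 r)
    (summable_exp_mul_weight hq0 hq1 hν hν' (x := q ^ (2 * ν) * t) (by positivity))).mul_left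
    ((1 - (q ^ (2 * ν))⁻¹) * q ^ (2 * ν) * orthoConst q (-ν) *
      ((q ^ (2 * ν) * weightBase q (-ν)) ^ r)⁻¹)
  have e : ∑' k, Real.exp (-(q ^ (2 * ν) * s) * (q ^ 2) ^ k) * orthoBessel q (-ν) (r + k) *
      (Real.exp (-(q ^ (2 * ν) * t) * (q ^ 2) ^ k) * weightBase q (-ν) ^ k)
      = ∑' k : ℤ, Real.exp (-(q ^ (2 * ν) * (s + t)) * (q ^ 2) ^ k) *
        (weightBase q (-ν) ^ k * orthoBessel q (-ν) (r + k)) := tsum_congr fun k => by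
    rw [show -(q ^ (2 * ν) * (s + t)) * (q ^ 2) ^ k = -(q ^ (2 * ν) * s) * (q ^ 2) ^ k
      + -(q ^ (2 * ν) * t) * (q ^ 2) ^ k by ring, Real.exp_add]
    ring
  rw [e, ← exitDensity_eq hq0] at h
  refine h.congr_fun fun m => ?_
  rw [killedTransition, exitDensity_eq hq0, qTransition_eq hq0 hq1, spectralKernel]
  have e1 : ∑' k, Real.exp (-(q ^ (2 * ν) * s) * (q ^ 2) ^ k) * orthoBessel q (-ν) (m + k) *
      orthoBessel q (-ν) (r + k) = ∑' k, Real.exp (-(q ^ (2 * ν) * s) * (q ^ 2) ^ k) *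
      orthoBessel q (-ν) (r + k) * orthoBessel q (-ν) (m + k) := tsum_congr fun k => by ring
  have e2 : ∑' k, Real.exp (-(q ^ (2 * ν) * t) * (q ^ 2) ^ k) *
      (weightBase q (-ν) ^ k * orthoBessel q (-ν) (m + k))
      = ∑' k, Real.exp (-(q ^ (2 * ν) * t) * (q ^ 2) ^ k) * weightBase q (-ν) ^ k *
      orthoBessel q (-ν) (m + k) := tsum_congr fun k => by ring
  rw [e1, e2, zpow_sub₀ hg.ne', zpow_sub₀ hw.ne', mul_zpow, mul_zpow]
  have hgm := (zpow_pos hg m).ne'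
  have hwm := (zpow_pos hw m).ne'
  have hgr := (zpow_pos hg r).ne'
  have hwr := (zpow_pos hw r).ne'
  field_simp

theorem tendsto_mass_atTop (hq0 : 0 < q) (hq1 : q < 1) (hν : ν < 0) (r : ℤ) :
    Tendsto (fun t : ℝ => ∑' k : ℤ, Real.exp (-(q ^ (2 * ν) * t) * (q ^ 2) ^ k) *
      (((q ^ (2 * ν))⁻¹) ^ k * latticeBessel q (-ν) (r + k))) atTop (𝓝 0) := by
  have hν' : -1 < -ν := by linarith
  have hg : 0 < q ^ (2 * ν) := Real.rpow_pos_of_pos hq0 _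
  have hg1 := rpow_two_mul_gt_one hq0 hq1 hν
  have hp : 0 < q ^ 2 := by positivity
  have h := tendsto_tsum_of_dominated_convergence (𝓕 := (atTop : Filter ℝ))
    (f := fun (t : ℝ) (k : ℤ) => Real.exp (-(q ^ (2 * ν) * t) * (q ^ 2) ^ k) *
      (((q ^ (2 * ν))⁻¹) ^ k * latticeBessel q (-ν) (r + k)))
    (g := fun k => 0 * (((q ^ (2 * ν))⁻¹) ^ k * latticeBessel q (-ν) (r + k)))
    (summable_zpow_mul_shift hq0 hq1 hν' (inv_pos.2 hg) (inv_lt_one_of_one_lt₀ hg1) r)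
    (fun k => ?_) ?_
  · simpa using h
  · refine Tendsto.mul_const _ (Real.tendsto_exp_atBot.comp ?_)
    have hc : -(q ^ (2 * ν) * (q ^ 2) ^ k) < 0 := by
      have := mul_pos hg (zpow_pos hp k)
      linarith
    refine (tendsto_id.const_mul_atTop_of_neg hc).congr fun t => ?_
    simp only [id]
    ring
  · filter_upwards [eventually_ge_atTop 0] with t ht k
    rw [Real.norm_eq_abs, abs_mul, abs_mul (_ ^ k), abs_of_pos (zpow_pos (inv_pos.2 hg) k)]
    exact mul_le_of_le_one_left (by positivity) (abs_heatMult_le hq0 (by positivity) k)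

/-- A vanishing density would keep the mass equal to `1`, but every term of its series decays in
time and the mass tends to `0`: explosion is almost sure. -/
theorem exitDensity_ne_zero (hq0 : 0 < q) (hq1 : q < 1) (hν : ν < 0) (r : ℤ) :
    ∃ t, 0 < t ∧ exitDensity q ν r t ≠ 0 := by
  by_contra! hcon
  have h1 : ∀ t, 0 ≤ t → (1 - (q ^ (2 * ν))⁻¹) * orthoConst q (-ν) ^ 2 * ((q ^ (2 * ν)) ^ r)⁻¹ *
        ∑' k : ℤ, Real.exp (-(q ^ (2 * ν) * t) * (q ^ 2) ^ k) *
          (((q ^ (2 * ν))⁻¹) ^ k * latticeBessel q (-ν) (r + k)) = 1 := fun t ht => by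
    have h2 := hasSum_killedTransition_integral hq0 hq1 hν r ht
    have h3 : ∫ v in (0 : ℝ)..t, exitDensity q ν r v = 0 := by
      rw [intervalIntegral.integral_of_le ht,
        setIntegral_congr_fun (g := fun _ => 0) measurableSet_Ioc fun v hv => hcon v hv.1]
      simp
    rw [h3, sub_zero] at h2
    exact (hasSum_killedTransition hq0 hq1 hν r ht).unique h2
  have h4 := (tendsto_mass_atTop hq0 hq1 hν r).const_mul
    ((1 - (q ^ (2 * ν))⁻¹) * orthoConst q (-ν) ^ 2 * ((q ^ (2 * ν)) ^ r)⁻¹)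
  rw [mul_zero] at h4
  have h5 : Tendsto (fun _ : ℝ => (1 : ℝ)) atTop (𝓝 0) := by
    refine h4.congr' ?_
    filter_upwards [eventually_ge_atTop 0] with t ht using h1 t ht
  exact one_ne_zero (tendsto_nhds_unique tendsto_const_nhds h5)

/-- A rate `x` becomes `q^{2ν(n-r+1)} x`, one factor coming from the change of time. This turns the
birth rate `q^{-2ν-2i}` into `q^{2ν-2i}` and leaves the death rate `q^{-2i}` unchanged. -/
theorem isLittleO_killedTransition (hq0 : 0 < q) {n r : ℤ} {d x : ℝ}
    (h : (fun h => qTransition q (-ν) n r h - (d + x * h)) =o[𝓝[>] 0] (fun h => h)) :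
    (fun h => killedTransition q ν n r (max h 0) - ((q ^ (2 * ν)) ^ (n - r) * d
      + (q ^ (2 * ν)) ^ (n - r) * x * q ^ (2 * ν) * h)) =o[𝓝[>] 0] (fun h => h) := by
  have hg : 0 < q ^ (2 * ν) := Real.rpow_pos_of_pos hq0 _
  have ht : Tendsto (fun h : ℝ => q ^ (2 * ν) * h) (𝓝[>] 0) (𝓝[>] 0) := by
    refine tendsto_nhdsWithin_iff.2 ⟨?_, ?_⟩
    · have : Tendsto (fun h : ℝ => q ^ (2 * ν) * h) (𝓝 0) (𝓝 (q ^ (2 * ν) * 0)) :=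
        tendsto_id.const_mul _
      rw [mul_zero] at this
      exact this.mono_left nhdsWithin_le_nhds
    · filter_upwards [self_mem_nhdsWithin] with h hh using mul_pos hg hh
  have h1 := ((h.comp_tendsto ht).const_mul_left ((q ^ (2 * ν)) ^ (n - r)))
  have h2 : ((fun h : ℝ => h) ∘ fun h => q ^ (2 * ν) * h) =O[𝓝[>] 0] (fun h : ℝ => h) :=
    Asymptotics.isBigO_const_mul_self _ _ _
  refine (h1.trans_isBigO h2).congr' ?_ (EventuallyEq.refl _ _)
  filter_upwards [self_mem_nhdsWithin] with h hh
  have hh : 0 < h := hh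
  simp only [Function.comp, killedTransition]
  rw [max_eq_left hh.le]
  ring

theorem isExitSystem_killed (hq0 : 0 < q) (hq1 : q < 1) (hν : -1 < ν) (hν' : ν < 0) :
    IsExitSystem q ν (fun n r t => killedTransition q ν n r (max t 0))
      (fun r t => exitDensity q ν r (max t 0)) := by
  have hneg : -1 < -ν := by linarith
  have hg : 0 < q ^ (2 * ν) := Real.rpow_pos_of_pos hq0 _
  have P := isTransitionFunction_qTransition hq0 hq1 hneg
  have hmax : ∀ t : ℝ, 0 ≤ max t 0 := fun t => le_max_right _ _
  have hnn : ∀ n r t, 0 ≤ t → 0 ≤ killedTransition q ν n r t := fun n r t ht =>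
    mul_nonneg (zpow_pos hg _).le (P.nonneg n r _ (by positivity))
  have hmass := fun r t (ht : 0 ≤ t) => hasSum_killedTransition_integral hq0 hq1 hν' r ht
  have hint : ∀ r t, 0 ≤ t → 0 ≤ ∫ v in (0 : ℝ)..t, exitDensity q ν r v := fun r t ht =>
    intervalIntegral.integral_nonneg ht fun v hv => exitDensity_nonneg hq0 hq1 hν' r hv.1
  have hbirth : birthRate q (-ν) = fun i => (q ^ (2 * ν))⁻¹ * ((q ^ 2) ^ i)⁻¹ := funext fun i => by
    rw [birthRate_eq hq0, rpow_two_mul_neg hq0]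
  constructor
  · intro n r
    have h : ContinuousOn (killedTransition q ν n r) (Set.Ici 0) := by
      refine continuousOn_const.mul ((P.continuousOn n r).comp (by fun_prop) fun t ht => ?_)
      exact mul_nonneg hg.le ht
    exact h.comp_continuous (by fun_prop) hmax
  · exact fun r => (continuousOn_exitDensity hq0 hq1 hν' r).comp_continuous (by fun_prop) hmax
  · exact fun n r t => hnn n r _ (hmax t)
  · intro n r t
    refine (le_hasSum (hmass r _ (hmax t)) n fun k _ => hnn k r _ (hmax t)).trans ?_
    linarith [hint r _ (hmax t)]
  · exact fun r t => exitDensity_nonneg hq0 hq1 hν' r (hmax t)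
  · intro r
    obtain ⟨B, hB⟩ := exitDensity_bdd hq0 hq1 hν' r
    exact ⟨B, fun t => hB _ (hmax t)⟩
  · intro r t ht
    have e : ∫ v in (0 : ℝ)..t, exitDensity q ν r (max v 0)
        = ∫ v in (0 : ℝ)..t, exitDensity q ν r v :=
      intervalIntegral.integral_congr fun v hv => by
        rw [Set.uIcc_of_le ht] at hv
        simp only [max_eq_left hv.1]
    rw [e]
    simp only [max_eq_left ht]
    exact hmass r t ht
  · intro n r
    simp only [max_self]
    exact killedTransition_zero hq0 hq1 hν' n r
  · intro n r t s ht hs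
    simp only [max_eq_left ht, max_eq_left hs, max_eq_left (add_nonneg ht hs)]
    have h := (P.chapman_kolmogorov n r (q ^ (2 * ν) * t) (q ^ (2 * ν) * s) (by positivity)
      (by positivity)).mul_left ((q ^ (2 * ν)) ^ (n - r))
    rw [← mul_add] at h
    refine h.congr_fun fun k => ?_
    rw [killedTransition, killedTransition, show n - r = (n - k) + (k - r) by ring,
      zpow_add₀ hg.ne']
    ring
  · intro r t s ht hs
    simp only [max_eq_left ht.le, max_eq_left hs, max_eq_left (add_nonneg hs ht.le)]
    exact hasSum_exit_law hq0 hq1 hν hν' r ht hs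
  · intro i
    have h := isLittleO_killedTransition (ν := ν) hq0 (d := 0) (x := birthRate q (-ν) i)
      ((P.birth i).congr_left fun h => by ring)
    refine h.congr_left fun h => ?_
    rw [hbirth, birthRate_eq hq0, add_sub_cancel_left, zpow_one]
    field_simp
    ring
  · intro i
    have h := isLittleO_killedTransition (ν := ν) hq0 (d := 0) (x := deathRate q i)
      ((P.death i).congr_left fun h => by ring)
    refine h.congr_left fun h => ?_
    rw [show i - 1 - i = -1 by ring, zpow_neg_one]
    field_simp
    ring
  · intro i
    have h := isLittleO_killedTransition (ν := ν) hq0 (d := 1)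
      (x := -(birthRate q (-ν) i + deathRate q i)) ((P.stay i).congr_left fun h => by ring)
    refine h.congr_left fun h => ?_
    rw [hbirth, birthRate_eq hq0, deathRate_eq, sub_self, zpow_zero]
    field_simp
    ring

end Killed

end QBirthDeath

end

theorem proposition2 (q ν : ℝ) (hq0 : 0 < q) (hq1 : q < 1) (hν : -1 < ν) :
    QBirthDeath.IsTransitionFunction q ν (QBirthDeath.qTransition q ν) ∧
      ((∀ p : ℤ → ℤ → ℝ → ℝ, QBirthDeath.IsTransitionFunction q ν p →
          ∀ (n r : ℤ) (t : ℝ), 0 ≤ t → p n r t = QBirthDeath.qTransition q ν n r t) ↔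
        0 ≤ ν) := by
  refine ⟨QBirthDeath.isTransitionFunction_qTransition hq0 hq1 hν, fun huniq => ?_,
    fun h p hp n r t ht => hp.eq_of_nonneg hq0 hq1 h
      (QBirthDeath.isTransitionFunction_qTransition hq0 hq1 hν) n r ht⟩
  by_contra! hneg
  obtain ⟨t, ht, hne⟩ := QBirthDeath.exitDensity_ne_zero hq0 hq1 hneg 0
  refine (QBirthDeath.isExitSystem_killed hq0 hq1 hν hneg).not_unique ⟨0, t, ht, ?_⟩ _ huniq
  simpa only [max_eq_left ht.le] using hne
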